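/- **Setting.** Let $\Bbbk$ be a field of characteristic $0$ and $\Bbbk_q=\bigcup_{m\ge1}\Bbbk(q^{1/m})$, $q$ an indeterminate, so that $q^r\in\Bbbk_q$ for $r\in\mathbb Q$. Let $A=(a_{ij})_{i,j\in I}$, $I=\{1,\dots,n\}$, be a symmetrizable generalized Cartan matrix and $D=\mathrm{diag}(d_1,\dots,d_n)$ with positive integers $d_i$ such that $DA$ is symmetric. Let $Q=\bigoplus_i\mathbb Z\alpha_i\subset\mathbb QQ=\bigoplus_i\mathbb Q\alpha_i$, with the symmetric form $(\alpha_i,\alpha_j)=d_ia_{ij}$; put $q_i=q^{d_i}$. For $\gamma\in\mathbb QQ$ write $\gamma_+=(\gamma,0)$, $\gamma_-=(0,\gamma)$ in $\mathbb QQ\times\mathbb QQ$. Put $(m)_p=\frac{p^m-1}{p-1}$ and $[m]_p=\frac{p^m-p^{-m}}{p-p^{-1}}$, with the corresponding $q$-binomial coefficients $\binom mk_p$ and $\left[{m\atop k}\right]_p$. *MpQUEA.* Let $\mathbf q=(q_{ij})$, $q_{ij}=q^{r_{ij}}$, be a $q$-rational multiparameter of Cartan type: $R=(r_{ij})\in M_n(\mathbb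 Q)$, $R+R^T=2DA$ (i.e. $q_{ij}q_{ji}=q_{ii}^{a_{ij}}$, $q_{ii}=q^{2d_i}$). Let $R(\cdot,\cdot)$ be the bilinear form on $\mathbb QQ$ with $R(\alpha_i,\alpha_j)=r_{ij}$. Let $M_\pm$ be lattices in $\mathbb QQ$ containing $Q$, and $M_\bullet=M_+\times M_-$. The Hopf algebra $U_{\mathbf q,M_\bullet}(\mathfrak g_D)$ over $\Bbbk_q$ is generated by $E_i,F_i$ ($i\in I$), $K_\gamma$ ($\gamma\in M_+$), $L_\delta$ ($\delta\in M_-$) with relations: $K_0=L_0=1$, $K_\gamma K_{\gamma'}=K_{\gamma+\gamma'}$, $L_\delta L_{\delta'}=L_{\delta+\delta'}$, $K_\gamma L_\delta=L_\delta K_\gamma$; $$K_\gamma E_jK_\gamma^{-1}=q^{R(\gamma,\alpha_j)}E_j,\quad L_\delta E_jL_\delta^{-1}=q^{-R(\alpha_j,\delta)}E_j,\quad K_\gamma F_jK_\gamma^{-1}=q^{-R(\gamma,\alpha_j)}F_j,\quad L_\delta F_jL_\delta^{-1}=q^{R(\alpha_j,\delta)}F_j;$$ $$E_iF_j-F_jE_i=\delta_{ij}\frac{q_{ii}}{q_{ii}-1}(K_{\alpha_i}-L_{\alpha_i});$$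 and for $i\ne j$ $$\sum_{k=0}^{1-a_{ij}}(-1)^k\tbinom{1-a_{ij}}{k}_{q_{ii}}q_{ii}^{\binom k2}q_{ij}^kE_i^{1-a_{ij}-k}E_jE_i^k=0,\qquad \sum_{k=0}^{1-a_{ij}}(-1)^k\tbinom{1-a_{ij}}{k}_{q_{ii}}q_{ii}^{\binom k2}q_{ji}^kF_i^{1-a_{ij}-k}F_jF_i^k=0 .$$ The $K_\gamma,L_\delta$ are group-like, $\Delta(E_i)=E_i\otimes1+K_{\alpha_i}\otimes E_i$, $\Delta(F_i)=F_i\otimes L_{\alpha_i}+1\otimes F_i$, $\epsilon(E_i)=\epsilon(F_i)=0$, $S(E_i)=-K_{\alpha_i}^{-1}E_i$, $S(F_i)=-F_iL_{\alpha_i}^{-1}$. *TwQUEA.* Let $\Psi=(\psi_{ij})\in M_n(\mathbb Q)$ with $\Psi^T=-\Psi$. Let $\psi_\pm$ be the $\mathbb Q$-linear endomorphisms of $\mathbb QQ$ with $\psi_+(\alpha_l)=\sum_{i,j}\psi_{ij}a_{jl}d_i^{-1}\alpha_i$, $\psi_-(\alpha_l)=\sum_{i,j}\psi_{ji}a_{jl}d_i^{-1}\alpha_i$;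 write $\psi_\pm(\gamma_\bullet)=\psi_\pm(\gamma)_\bullet$ for $\bullet\in\{+,-\}$. Let $U^\Psi_q$ be the Hopf algebra over $\Bbbk_q$ generated by $E_i,F_i,K_y$ ($y\in\mathbb QQ\times\mathbb QQ$) with relations $K_0=1$, $K_yK_{y'}=K_{y+y'}$, $K_yE_jK_y^{-1}=q^{(\gamma+\delta,\alpha_j)}E_j$, $K_yF_jK_y^{-1}=q^{-(\gamma+\delta,\alpha_j)}F_j$ for $y=(\gamma,\delta)$, $$E_iF_j-F_jE_i=\delta_{ij}\frac{K_{\alpha_i^+}-K_{\alpha_i^-}^{-1}}{q_i-q_i^{-1}},\qquad \sum_{k=0}^{1-a_{ij}}(-1)^k\Big[{1-a_{ij}\atop k}\Big]_{q_i}X_i^{1-a_{ij}-k}X_jX_i^k=0\quad(i\ne j,\ X\in\{E,F\}),$$ with the Hopf structure twisted by $\Psi$: the $K_y$ are group-like, $\epsilon(E_i)=\epsilon(F_i)=0$, $$\Delta(E_i)=E_i\otimes K_{\psi_-(\alpha_i^-)}+K_{\alpha_i^++\psi_+(\alpha_i^+)}\otimes E_i,\qquad \Delta(F_i)=F_i\otimes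 K_{-\alpha_i^--\psi_-(\alpha_i^-)}+K_{-\psi_+(\alpha_i^+)}\otimes F_i,$$ $$S(E_i)=-K_{-\alpha_i^+-\psi_+(\alpha_i^+)}E_iK_{-\psi_-(\alpha_i^-)},\qquad S(F_i)=-K_{\psi_+(\alpha_i^+)}F_iK_{\alpha_i^-+\psi_-(\alpha_i^-)}.$$ Put $E_i^\Psi=K_{-\psi_-(\alpha_i^-)}E_i$, $F_i^\Psi=K_{\psi_+(\alpha_i^+)}F_i$. For a subgroup $M\subseteq\mathbb QQ\times\mathbb QQ$ containing all $\alpha_i^\pm+\psi_\pm(\alpha_i^\pm)-\psi_\mp(\alpha_i^\mp)$, let $\hat U^\Psi_{q,M}(\mathfrak g_D)$ be the subalgebra of $U^\Psi_q$ generated by all $E_i^\Psi$, $F_i^\Psi$ and $K_y$ ($y\in M$); it is a Hopf subalgebra. **Theorem.** Let $\Psi\in M_n(\mathbb Q)$ be antisymmetric and let $\mathbf q=(q^{r_{ij}})$ be the $q$-rational multiparameter corresponding to $\Psi$, i.e. $R=DA+A^T(\Psi^T-\Psi)A$. Let $M_\pm$ be lattices in $\mathbb QQ$ containing $Q$ with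 $\mathbb Z$-bases $\{\mu^{(\pm)}_i\}_{i\in I}$, and put $$\varpi_i^+=(\gamma_++\psi_+(\gamma_+)-\psi_-(\gamma_-))\big|_{\gamma=\mu_i^{(+)}},\qquad \varpi_i^-=(\gamma_-+\psi_-(\gamma_-)-\psi_+(\gamma_+))\big|_{\gamma=\mu_i^{(-)}}.$$ Let $M_\pm^\Psi$ be the images of $M_\pm$ under $\gamma\mapsto\gamma_\pm+\psi_\pm(\gamma_\pm)-\psi_\mp(\gamma_\mp)$, and $M_*^\Psi=M_+^\Psi+M_-^\Psi$. Then $\{\varpi_i^\pm\}_{i\in I}$ is a $\mathbb Z$-basis of $M_\pm^\Psi$, and there is an isomorphism of Hopf algebras $$U_{\mathbf q,M_\bullet}(\mathfrak g_D)\;\cong\;\hat U^\Psi_{q,M_*^\Psi}(\mathfrak g_D),\qquad E_i\mapsto q_iE_i^\Psi,\quad F_i\mapsto F_i^\Psi,\quad K_{\mu_i^{(+)}}\mapsto K_{\varpi_i^+},\quad L_{\mu_i^{(-)}}\mapsto K_{-\varpi_i^-}\qquad(i\in I).$$ Moreover, let $\check{\mathbf q}=(q^{d_ia_{ij}})$,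 let $B$ be the bilinear form on $\mathbb QQ$ with matrix $-(DA+A^T\Psi A)$, and let $p$ be the algebra map from $U_{\check{\mathbf q},M_\bullet}(\mathfrak g_D)$ to the group algebra of $\mathbb QQ$ (with basis $G_\gamma$) such that $E_i,F_i\mapsto0$, $K_\gamma\mapsto G_\gamma$, $L_\delta\mapsto G_\delta$. Then $\sigma=\chi\circ(p\otimes p)$, where $\chi(G_\gamma,G_\delta)=q^{B(\gamma,\delta)}$, is a normalized Hopf $2$-cocycle, with convolution inverse obtained from $-B$ in the same way, and the same formulas on $E_i,F_i,K_{\mu_i^{(+)}},L_{\mu_i^{(-)}}$ define an isomorphism of Hopf algebras $$\big(U_{\check{\mathbf q},M_\bullet}(\mathfrak g_D)\big)_\sigma\;\cong\;\hat U^\Psi_{q,M_*^\Psi}(\mathfrak g_D).$$ Here $H_\sigma$ is the coalgebra $H$ with its unit, product $a\cdot_\sigma b=\sigma(a_{(1)},b_{(1)})\,a_{(2)}b_{(2)}\,\sigma^{-1}(a_{(3)},b_{(3)})$ and antipode $S_\sigma(a)=\sigma(a_{(1)},S(a_{(2)}))\,S(a_{(3)})\,\sigma^{-1}(S(a_{(4)}),a_{(5)})$.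 -/

import Mathlib

open scoped TensorProduct

/-! ### `q`-numbers -/

section QNumbers
variable {K : Type*} [Field K]

/-- `(m)_p = (p^m - 1)/(p - 1)` -/
def qNum (p : K) (m : ℕ) : K := (p ^ m - 1) / (p - 1)
/-- `(m)_p! = (1)_p (2)_p ⋯ (m)_p` -/
def qFact (p : K) (m : ℕ) : K := ∏ s ∈ Finset.range m, qNum p (s + 1)
/-- the `q`-binomial coefficient built on `(m)_p` -/
def qBinom (p : K) (m k : ℕ) : K := qFact p m / (qFact p k * qFact p (m - k))

/-- `[m]_p = (p^m - p^{-m})/(p - p⁻¹)` -/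
def qNumS (p : K) (m : ℕ) : K := (p ^ m - (p ^ m)⁻¹) / (p - p⁻¹)
/-- `[m]_p! = [1]_p [2]_p ⋯ [m]_p` -/
def qFactS (p : K) (m : ℕ) : K := ∏ s ∈ Finset.range m, qNumS p (s + 1)
/-- the symmetric `q`-binomial coefficient built on `[m]_p` -/
def qBinomS (p : K) (m k : ℕ) : K := qFactS p m / (qFactS p k * qFactS p (m - k))

theorem qNum_ne_zero {p : K} (hp : ∀ k : ℕ, 0 < k → p ^ k ≠ 1) (m : ℕ) (hm : 0 < m) :
    qNum p m ≠ 0 := by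
  have h1 := hp m hm
  have h2 := hp 1 one_pos
  rw [pow_one] at h2
  exact div_ne_zero (sub_ne_zero.2 h1) (sub_ne_zero.2 h2)

theorem qFact_ne_zero {p : K} (hp : ∀ k : ℕ, 0 < k → p ^ k ≠ 1) (m : ℕ) : qFact p m ≠ 0 :=
  Finset.prod_ne_zero_iff.2 fun s _ => qNum_ne_zero hp _ (Nat.succ_pos s)

theorem qFact_succ (p : K) (m : ℕ) : qFact p (m + 1) = qFact p m * qNum p (m + 1) :=
  Finset.prod_range_succ _ _

theorem qBinom_zero_right {p : K} (hp : ∀ k : ℕ, 0 < k → p ^ k ≠ 1) (m : ℕ) :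
    qBinom p m 0 = 1 := by
  have := qFact_ne_zero hp m
  rw [qBinom, show qFact p 0 = 1 from Finset.prod_range_zero _, Nat.sub_zero, one_mul, div_self this]

theorem qBinom_self {p : K} (hp : ∀ k : ℕ, 0 < k → p ^ k ≠ 1) (m : ℕ) :
    qBinom p m m = 1 := by
  have := qFact_ne_zero hp m
  rw [qBinom, Nat.sub_self, show qFact p 0 = 1 from Finset.prod_range_zero _, mul_one, div_self this]

theorem qBinom_pascal {p : K} (hp : ∀ k : ℕ, 0 < k → p ^ k ≠ 1) (k l : ℕ) :
    qBinom p (k + 1 + l + 1) (k + 1)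
      = qBinom p (k + 1 + l) (k + 1) + p ^ (l + 1) * qBinom p (k + 1 + l) k := by
  have h1 : k + 1 + l + 1 - (k + 1) = l + 1 := by omega
  have h2 : k + 1 + l - (k + 1) = l := by omega
  have h3 : k + 1 + l - k = l + 1 := by omega
  have hk := qFact_ne_zero hp k
  have hl := qFact_ne_zero hp l
  have hk1 := qNum_ne_zero hp (k + 1) (Nat.succ_pos _)
  have hl1 := qNum_ne_zero hp (l + 1) (Nat.succ_pos _)
  have hp1 : p - 1 ≠ 0 := sub_ne_zero.2 (by simpa using hp 1 one_pos)
  have key : qNum p (k + 1 + l + 1) = qNum p (l + 1) + p ^ (l + 1) * qNum p (k + 1) := by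
    simp only [qNum]
    field_simp
    ring
  simp only [qBinom, h1, h2, h3, qFact_succ p (k + 1 + l), qFact_succ p k, qFact_succ p l, key]
  field_simp

theorem qBinomS_eq {p : K} (hp0 : p ≠ 0) (m k : ℕ) (hk : k ≤ m)
    (hp : ∀ k : ℕ, 0 < k → (p ^ 2) ^ k ≠ 1) :
    qBinomS p m k = qBinom (p ^ 2) m k * (p⁻¹) ^ (k * (m - k)) := by
  have hn : ∀ m : ℕ, qNumS p (m + 1) = qNum (p ^ 2) (m + 1) * (p⁻¹) ^ m := by
    intro m
    have h1 : p ^ 2 - 1 ≠ 0 := sub_ne_zero.2 (by simpa using hp 1 one_pos)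
    have h2 : p - p⁻¹ ≠ 0 := by
      intro h
      apply h1
      field_simp at h
      linear_combination h
    simp only [qNumS, qNum]
    rw [div_mul_eq_mul_div, div_eq_div_iff h2 h1, inv_pow]
    field_simp
    ring
  have hf : ∀ m : ℕ, qFactS p m * p ^ (m.choose 2) = qFact (p ^ 2) m := by
    intro m
    induction m with
    | zero => simp [qFactS, qFact]
    | succ m ih =>
      rw [qFact_succ, ← ih, qFactS, Finset.prod_range_succ, ← qFactS, hn,
        Nat.choose_succ_succ' m 1, Nat.choose_one_right, pow_add]
      have : (p⁻¹) ^ m * p ^ m = 1 := by rw [← mul_pow, inv_mul_cancel₀ hp0, one_pow]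
      linear_combination (qFactS p m * qNum (p ^ 2) (m + 1) * p ^ (m.choose 2)) * this
  obtain ⟨l, rfl⟩ := Nat.exists_eq_add_of_le hk
  have hc : (k + l).choose 2 = k.choose 2 + l.choose 2 + k * l := by
    have := Nat.add_choose_eq k l 2
    rw [this]
    simp [Finset.Nat.antidiagonal_succ]
    ring
  have hS : ∀ m, qFactS p m ≠ 0 := fun m h => qFact_ne_zero hp m (by rw [← hf, h, zero_mul])
  rw [qBinomS, qBinom, Nat.add_sub_cancel_left, ← hf, ← hf, ← hf, hc, inv_pow]
  have := hS k
  have := hS l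
  field_simp
  ring
end QNumbers

/-! ### Serre sums -/

section Serre
variable {K : Type*} [Field K] {T : Type*} [Ring T] [Algebra K T]

/-- `∑_{k ≤ m} c(k) X^{m-k} Y X^k` -/
def serreSum (c : ℕ → K) (m : ℕ) (X Y : T) : T :=
  ∑ k ∈ Finset.range (m + 1), c k • (X ^ (m - k) * Y * X ^ k)

/-- The product of the commuting operators `Z ↦ X Z - f(r) Z X`, `r < m`, applied to `Y`. -/
def adProd (f : ℕ → K) (X Y : T) : ℕ → T
  | 0 => Y
  | m + 1 => X * adProd f X Y m - f m • (adProd f X Y m * X)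

theorem adProd_succ' (f : ℕ → K) (X Y : T) (m : ℕ) :
    adProd f X Y (m + 1) = X * adProd (fun k => f (k + 1)) X Y m
      - f 0 • (adProd (fun k => f (k + 1)) X Y m * X) := by
  induction m with
  | zero => rfl
  | succ m ih =>
    rw [adProd, ih]
    simp only [adProd]
    simp only [mul_sub, sub_mul, smul_sub, mul_smul_comm, smul_mul_assoc, mul_assoc]
    rw [smul_comm (f 0)]
    abel

theorem adProd_congr {f g : ℕ → K} (X Y : T) (m : ℕ) (h : ∀ k < m, f k = g k) :
    adProd f X Y m = adProd g X Y m := by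
  induction m with
  | zero => rfl
  | succ m ih =>
    simp only [adProd]
    rw [ih fun k hk => h k (by omega), h m (by omega)]

theorem adProd_reverse (X Y : T) (m : ℕ) : ∀ f g : ℕ → K, (∀ k < m, f k = g (m - 1 - k)) →
    adProd f X Y m = adProd g X Y m := by
  induction m with
  | zero => intros; rfl
  | succ m ih =>
    intro f g h
    rw [adProd_succ' g]
    simp only [adProd]
    rw [ih f (fun k => g (k + 1))]
    · rw [h m (by omega)]; simp
    · intro k hk
      rw [h k (by omega)]
      congr 1
      omega

theorem serreSum_eq_adProd {p : K} (hp : ∀ k : ℕ, 0 < k → p ^ k ≠ 1) (s : K) (X Y : T) (m : ℕ) :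
    serreSum (fun k => (-1) ^ k * qBinom p m k * p ^ (k.choose 2) * s ^ k) m X Y
      = adProd (fun k => s * p ^ k) X Y m := by
  induction m with
  | zero => simp [serreSum, adProd, qBinom_zero_right hp]
  | succ m ih =>
    rw [adProd, ← ih]
    unfold serreSum
    rw [Finset.sum_range_succ' _ (m + 1), Finset.sum_range_succ _ m]
    rw [Finset.mul_sum, Finset.sum_mul]
    rw [Finset.sum_range_succ' _ m, Finset.sum_range_succ _ m]
    have hc : ∀ k : ℕ, (k + 1).choose 2 = k.choose 2 + k := fun k => by
      rw [Nat.choose_succ_succ' k 1, Nat.choose_one_right, add_comm]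
    have key : ∀ k ∈ Finset.range m,
        ((-1 : K) ^ (k + 1) * qBinom p (m + 1) (k + 1) * p ^ ((k + 1).choose 2) * s ^ (k + 1)) •
          (X ^ (m + 1 - (k + 1)) * Y * X ^ (k + 1))
        = X * (((-1 : K) ^ (k + 1) * qBinom p m (k + 1) * p ^ ((k + 1).choose 2) * s ^ (k + 1)) •
          (X ^ (m - (k + 1)) * Y * X ^ (k + 1)))
        - (s * p ^ m) • ((((-1 : K) ^ k * qBinom p m k * p ^ (k.choose 2) * s ^ k) •
          (X ^ (m - k) * Y * X ^ k)) * X) := by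
      intro k hk
      obtain ⟨l, rfl⟩ := Nat.exists_eq_add_of_lt (Finset.mem_range.1 hk)
      have e1 : k + l + 1 + 1 - (k + 1) = l + 1 := by omega
      have e2 : k + l + 1 - (k + 1) = l := by omega
      have e3 : k + l + 1 - k = l + 1 := by omega
      have e4 : k + l + 1 = k + 1 + l := by omega
      rw [e1, e2, e3, mul_smul_comm, smul_mul_assoc, smul_smul]
      have w1 : X * (X ^ l * Y * X ^ (k + 1)) = X ^ (l + 1) * Y * X ^ (k + 1) := by
        rw [pow_succ' X l]; simp only [mul_assoc]
      have w2 : X ^ (l + 1) * Y * X ^ k * X = X ^ (l + 1) * Y * X ^ (k + 1) := by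
        rw [pow_succ X k]; simp only [mul_assoc]
      rw [w1, w2, ← sub_smul, e4, qBinom_pascal hp, hc]
      congr 1
      ring
    rw [Finset.sum_congr rfl key, Finset.sum_sub_distrib]
    have t0 : ((-1 : K) ^ 0 * qBinom p (m + 1) 0 * p ^ (Nat.choose 0 2) * s ^ 0) •
          (X ^ (m + 1 - 0) * Y * X ^ 0)
        = X * (((-1 : K) ^ 0 * qBinom p m 0 * p ^ (Nat.choose 0 2) * s ^ 0) •
          (X ^ (m - 0) * Y * X ^ 0)) := by
      simp [qBinom_zero_right hp, pow_succ', mul_assoc]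
    have tm : ((-1 : K) ^ (m + 1) * qBinom p (m + 1) (m + 1) * p ^ ((m + 1).choose 2) * s ^ (m + 1)) •
          (X ^ (m + 1 - (m + 1)) * Y * X ^ (m + 1))
        = - ((s * p ^ m) • ((((-1 : K) ^ m * qBinom p m m * p ^ (m.choose 2) * s ^ m) •
          (X ^ (m - m) * Y * X ^ m)) * X)) := by
      rw [qBinom_self hp, qBinom_self hp, hc, smul_mul_assoc, smul_smul, ← neg_smul]
      simp only [Nat.sub_self, pow_zero, one_mul, mul_assoc, ← pow_succ]
      congr 1
      ring
    rw [t0, tm, smul_add, Finset.smul_sum]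
    beta_reduce
    abel

theorem adProd_left {p s : K} {a b c : T} (hba : b * a = p • (a * b)) (hbc : b * c = s • (c * b))
    (m : ℕ) : adProd (fun k => s * p ^ k) (a + b) c m = adProd (fun k => s * p ^ k) a c m
      ∧ b * adProd (fun k => s * p ^ k) a c m
        = (s * p ^ m) • (adProd (fun k => s * p ^ k) a c m * b) := by
  induction m with
  | zero => exact ⟨rfl, by simpa [adProd] using hbc⟩
  | succ m ih =>
    obtain ⟨h1, h2⟩ := ih
    simp only [adProd]
    rw [h1]
    set w := adProd (fun k => s * p ^ k) a c m
    refine ⟨?_, ?_⟩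
    · rw [add_mul, mul_add, smul_add, h2]; abel
    · rw [mul_sub, sub_mul, ← mul_assoc, hba, smul_mul_assoc, mul_assoc a, h2, mul_smul_comm,
        mul_smul_comm (s * p ^ m) b, ← mul_assoc b w a, h2, smul_mul_assoc _ (w * b) a,
        mul_assoc w b a, hba, smul_mul_assoc, smul_sub]
      simp only [mul_smul_comm, smul_smul, mul_assoc]
      congr 2 <;> ring

theorem adProd_comm {p t : K} {a b d : T} (hba : b * a = p • (a * b)) (hda : d * a = t • (a * d))
    (f : ℕ → K) (m : ℕ) :
    adProd f b d m * a = (t * p ^ m) • (a * adProd f b d m) := by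
  induction m with
  | zero => simpa [adProd] using hda
  | succ m ih =>
    simp only [adProd]
    set w := adProd f b d m
    rw [sub_mul, mul_sub, mul_assoc, ih, mul_smul_comm, ← mul_assoc b a w, hba]
    rw [smul_mul_assoc (f m), mul_assoc w b a, hba, mul_smul_comm, ← mul_assoc w a b, ih]
    simp only [mul_smul_comm, smul_mul_assoc, smul_smul, mul_assoc, smul_sub]
    congr 2 <;> ring

theorem adProd_right {p t : K} {a b d : T} (hba : b * a = p • (a * b))
    (hda : d * a = t • (a * d)) (m : ℕ) : ∀ s : K, (0 < m → s * t * p ^ (m - 1) = 1) →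
    adProd (fun k => s * p ^ k) (a + b) d m = adProd (fun k => s * p ^ k) b d m := by
  induction m with
  | zero => intros; rfl
  | succ m ih =>
    intro s h
    have hs : (fun k => s * p ^ (k + 1)) = fun k => (s * p) * p ^ k := by
      funext k; ring
    rw [adProd_succ', adProd_succ', hs, ih (s * p)]
    · have hw := adProd_comm hba hda (fun k => (s * p) * p ^ k) m
      set w := adProd (fun k => (s * p) * p ^ k) b d m
      have h' := h (Nat.succ_pos m)
      rw [Nat.add_sub_cancel] at h'
      rw [add_mul, mul_add, hw, smul_add, smul_smul]
      have : s * p ^ 0 * (t * p ^ m) = 1 := by rw [← h']; ring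
      rw [this, one_smul]
      abel
    · intro hm
      have h' := h (Nat.succ_pos m)
      rw [Nat.add_sub_cancel] at h'
      obtain ⟨m, rfl⟩ := Nat.exists_eq_succ_of_ne_zero hm.ne'
      rw [← h']
      simp only [Nat.succ_eq_add_one, Nat.add_sub_cancel]
      ring

theorem adProd_add (f : ℕ → K) (X Y Z : T) (m : ℕ) :
    adProd f X (Y + Z) m = adProd f X Y m + adProd f X Z m := by
  induction m with
  | zero => rfl
  | succ m ih =>
    simp only [adProd, ih, mul_add, add_mul, smul_add]
    abel

theorem adProd_skew {p s t : K} {a b c d : T} {m : ℕ}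
    (hba : b * a = p • (a * b)) (hbc : b * c = s • (c * b)) (hda : d * a = t • (a * d))
    (hst : 0 < m → s * t * p ^ (m - 1) = 1)
    (h1 : adProd (fun k => s * p ^ k) a c m = 0) (h2 : adProd (fun k => s * p ^ k) b d m = 0) :
    adProd (fun k => s * p ^ k) (a + b) (c + d) m = 0 := by
  rw [adProd_add, (adProd_left hba hbc m).1, adProd_right hba hda m s hst, h1, h2, add_zero]

end Serre

/-! ### Presented Hopf algebras -/

section Presented

/-- Data for an algebra presented by generators `E_i`, `F_i` and `K_g` (`g` in an abelian group `G`,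
the torus) with relations
* `K_0 = 1`, `K_g K_h = K_{g+h}`;
* `K_g E_j = χ_j(g) E_j K_g`, `K_g F_j = χ_j(-g) F_j K_g`;
* `E_i F_j - F_j E_i = δ_ij c_i (K_{κ_i} - K_{λ_i})`;
* `∑_{s ≤ m_ij} cE_ij(s) E_i^{m_ij - s} E_j E_i^s = 0` for `i ≠ j`;
* `∑_{s ≤ m_ij} cF_ij(s) F_i^{m_ij - s} F_j F_i^s = 0` for `i ≠ j`

and for a Hopf structure on it such that the `K_g` are group-like and
* `Δ(E_i) = E_i ⊗ K_{u_i} + K_{v_i} ⊗ E_i`, `ε(E_i) = 0`, `S(E_i) = -K_{-v_i} E_i K_{-u_i}`;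
* `Δ(F_i) = F_i ⊗ K_{w_i} + K_{z_i} ⊗ F_i`, `ε(F_i) = 0`, `S(F_i) = -K_{-z_i} F_i K_{-w_i}`.

The propositional fields are the identities between the data that make `Δ` compatible with the
relations; the two quantum groups below are instances, for which these identities are proved. -/
structure QDatum (K : Type*) [Field K] (n : ℕ) (G : Type*) [AddCommGroup G] where
  chi : Fin n → AddChar G K
  kap : Fin n → G
  lam : Fin n → G
  c : Fin n → K
  m : Fin n → Fin n → ℕ
  cE : Fin n → Fin n → ℕ → K
  cF : Fin n → Fin n → ℕ → K
  u : Fin n → G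
  v : Fin n → G
  w : Fin n → G
  z : Fin n → G
  kap_eq : ∀ i, kap i = v i + z i
  lam_eq : ∀ i, lam i = u i + w i
  chi_zu : ∀ i j, chi i (z j) * chi j (u i) = 1
  chi_vw : ∀ i j, chi j (v i) * chi i (w j) = 1
  not_root : ∀ i, ∀ k : ℕ, 0 < k → (chi i (v i) * chi i (-u i)) ^ k ≠ 1
  serre_cond : ∀ i j, i ≠ j → 0 < m i j →
    (chi j (v i) * chi i (-u j)) * (chi i (v j) * chi j (-u i))
      * (chi i (v i) * chi i (-u i)) ^ (m i j - 1) = 1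
  cE_eq : ∀ i j, i ≠ j → ∀ k ≤ m i j, cE i j k
    = (-1) ^ k * qBinom (chi i (v i) * chi i (-u i)) (m i j) k
      * (chi i (v i) * chi i (-u i)) ^ (k.choose 2) * (chi j (v i) * chi i (-u j)) ^ k
  cF_eq : ∀ i j, i ≠ j → ∀ k ≤ m i j, cF i j k
    = (-1) ^ k * qBinom (chi i (v i) * chi i (-u i)) (m i j) k
      * (chi i (v i) * chi i (-u i)) ^ (k.choose 2) * (chi i (v j) * chi j (-u i)) ^ k

/-- generators of the presented algebra -/
inductive QGen (n : ℕ) (G : Type*) : Type _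
  | E (i : Fin n) : QGen n G
  | F (i : Fin n) : QGen n G
  | K (g : G) : QGen n G

namespace QDatum
variable {K : Type*} [Field K] {n : ℕ} {G : Type*} [AddCommGroup G] (D : QDatum K n G)

/-- `e`, `f`, `t` satisfy the defining relations in the algebra `T` -/
structure IsRep {T : Type*} [Ring T] [Algebra K T] (e f : Fin n → T) (t : G → T) : Prop where
  t_zero : t 0 = 1
  t_add : ∀ g h, t g * t h = t (g + h)
  t_e : ∀ g j, t g * e j = D.chi j g • (e j * t g)
  t_f : ∀ g j, t g * f j = D.chi j (-g) • (f j * t g)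
  e_f : ∀ i j, e i * f j - f j * e i = if i = j then D.c i • (t (D.kap i) - t (D.lam i)) else 0
  serre_e : ∀ i j, i ≠ j → serreSum (D.cE i j) (D.m i j) (e i) (e j) = 0
  serre_f : ∀ i j, i ≠ j → serreSum (D.cF i j) (D.m i j) (f i) (f j) = 0

/-- the free algebra on the generators -/
abbrev Free (K : Type*) [Field K] (n : ℕ) (G : Type*) := FreeAlgebra K (QGen n G)
abbrev fE (K : Type*) [Field K] {n : ℕ} (G : Type*) (i : Fin n) : Free K n G :=
  FreeAlgebra.ι K (QGen.E i)
abbrev fF (K : Type*) [Field K] {n : ℕ} (G : Type*) (i : Fin n) : Free K n G :=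
  FreeAlgebra.ι K (QGen.F i)
abbrev fK (K : Type*) [Field K] (n : ℕ) {G : Type*} (g : G) : Free K n G :=
  FreeAlgebra.ι K (QGen.K g)

/-- the defining relations -/
inductive Rel : Free K n G → Free K n G → Prop
  | K_zero : Rel (fK K n 0) 1
  | K_add (g h : G) : Rel (fK K n g * fK K n h) (fK K n (g + h))
  | K_E (g : G) (j : Fin n) :
      Rel (fK K n g * fE K G j) (D.chi j g • (fE K G j * fK K n g))
  | K_F (g : G) (j : Fin n) :
      Rel (fK K n g * fF K G j) (D.chi j (-g) • (fF K G j * fK K n g))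
  | E_F (i j : Fin n) : Rel (fE K G i * fF K G j - fF K G j * fE K G i)
      (if i = j then D.c i • (fK K n (D.kap i) - fK K n (D.lam i)) else 0)
  | serre_E (i j : Fin n) : i ≠ j →
      Rel (serreSum (D.cE i j) (D.m i j) (fE K G i) (fE K G j)) 0
  | serre_F (i j : Fin n) : i ≠ j →
      Rel (serreSum (D.cF i j) (D.m i j) (fF K G i) (fF K G j)) 0

/-- the presented algebra -/
def Alg : Type _ := RingQuot D.Rel
noncomputable instance : Ring D.Alg := inferInstanceAs (Ring (RingQuot D.Rel))
noncomputable instance : Algebra K D.Alg := inferInstanceAs (Algebra K (RingQuot D.Rel))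

/-- the quotient map -/
noncomputable def proj : Free K n G →ₐ[K] D.Alg := RingQuot.mkAlgHom K D.Rel
/-- the generator `E_i` -/
noncomputable def E (i : Fin n) : D.Alg := D.proj (fE K G i)
/-- the generator `F_i` -/
noncomputable def F (i : Fin n) : D.Alg := D.proj (fF K G i)
/-- the torus element `K_g` -/
noncomputable def Kt (g : G) : D.Alg := D.proj (fK K n g)

theorem proj_rel {x y : Free K n G} (h : D.Rel x y) : D.proj x = D.proj y :=
  RingQuot.mkAlgHom_rel K h

theorem map_serreSum {T T' : Type*} [Ring T] [Algebra K T] [Ring T'] [Algebra K T']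
    (φ : T →ₐ[K] T') (c : ℕ → K) (m : ℕ) (X Y : T) :
    φ (serreSum c m X Y) = serreSum c m (φ X) (φ Y) := by
  simp [serreSum, map_sum]

theorem isRep_self : D.IsRep D.E D.F D.Kt where
  t_zero := (D.proj_rel Rel.K_zero).trans (map_one _)
  t_add g h := (map_mul D.proj _ _).symm.trans (D.proj_rel (Rel.K_add g h))
  t_e g j := by
    have := D.proj_rel (Rel.K_E g j)
    rwa [map_smul, map_mul, map_mul] at this
  t_f g j := by
    have := D.proj_rel (Rel.K_F g j)
    rwa [map_smul, map_mul, map_mul] at this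
  e_f i j := by
    have := D.proj_rel (Rel.E_F i j)
    simp only [map_sub, map_mul, apply_ite D.proj, map_smul, map_zero] at this
    exact this
  serre_e i j h := by
    have := D.proj_rel (Rel.serre_E i j h)
    rwa [map_serreSum, map_zero] at this
  serre_f i j h := by
    have := D.proj_rel (Rel.serre_F i j h)
    rwa [map_serreSum, map_zero] at this

section lift
variable {D}
variable {T : Type*} [Ring T] [Algebra K T] {e f : Fin n → T} {t : G → T}

def genMap (e f : Fin n → T) (t : G → T) : QGen n G → T
  | .E i => e i
  | .F i => f i
  | .K g => t g

/-- the universal property of the presented algebra -/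
noncomputable def lift (h : D.IsRep e f t) : D.Alg →ₐ[K] T :=
  RingQuot.liftAlgHom K ⟨FreeAlgebra.lift K (genMap e f t), by
    intro x y r
    induction r with
    | K_zero => simpa [genMap] using h.t_zero
    | K_add g g' => simpa [genMap] using h.t_add g g'
    | K_E g j => simpa [genMap] using h.t_e g j
    | K_F g j => simpa [genMap] using h.t_f g j
    | E_F i j =>
      have := h.e_f i j
      simp only [map_sub, map_mul, apply_ite (FreeAlgebra.lift K (genMap e f t)), map_smul,
        map_zero, FreeAlgebra.lift_ι_apply, genMap]
      exact this
    | serre_E i j hij => rw [map_serreSum, map_zero]; simpa [genMap] using h.serre_e i j hij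
    | serre_F i j hij => rw [map_serreSum, map_zero]; simpa [genMap] using h.serre_f i j hij⟩

theorem lift_proj (h : D.IsRep e f t) (x : Free K n G) :
    lift h (D.proj x) = FreeAlgebra.lift K (genMap e f t) x :=
  RingQuot.liftAlgHom_mkAlgHom_apply (S := K) _ _ x

@[simp] theorem lift_E (h : D.IsRep e f t) (i : Fin n) : lift h (D.E i) = e i := by
  simp [E, lift_proj, genMap]
@[simp] theorem lift_F (h : D.IsRep e f t) (i : Fin n) : lift h (D.F i) = f i := by
  simp [F, lift_proj, genMap]
@[simp] theorem lift_Kt (h : D.IsRep e f t) (g : G) : lift h (D.Kt g) = t g := by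
  simp [Kt, lift_proj, genMap]

theorem induction {P : D.Alg → Prop} (hE : ∀ i, P (D.E i)) (hF : ∀ i, P (D.F i))
    (hK : ∀ g, P (D.Kt g)) (hs : ∀ r : K, P (algebraMap K _ r))
    (hadd : ∀ x y, P x → P y → P (x + y)) (hmul : ∀ x y, P x → P y → P (x * y)) (x : D.Alg) :
    P x := by
  obtain ⟨x, rfl⟩ := RingQuot.mkAlgHom_surjective K D.Rel x
  change P (D.proj x)
  induction x using FreeAlgebra.induction with
  | grade0 r => simpa using hs r
  | grade1 x => cases x with
    | E i => exact hE i
    | F i => exact hF i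
    | K g => exact hK g
  | mul a b ha hb => rw [map_mul]; exact hmul _ _ ha hb
  | add a b ha hb => rw [map_add]; exact hadd _ _ ha hb

theorem hom_ext {T : Type*} [Semiring T] [Algebra K T] {φ ψ : D.Alg →ₐ[K] T}
    (hE : ∀ i, φ (D.E i) = ψ (D.E i))
    (hF : ∀ i, φ (D.F i) = ψ (D.F i)) (hK : ∀ g, φ (D.Kt g) = ψ (D.Kt g)) : φ = ψ := by
  ext x
  induction x using induction with
  | hE i => exact hE i
  | hF i => exact hF i
  | hK g => exact hK g
  | hs r => simp
  | hadd x y hx hy => simp [hx, hy]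
  | hmul x y hx hy => simp [hx, hy]
end lift

section Hopf
open TensorProduct

theorem chi_neg_mul (i : Fin n) (g : G) : D.chi i (-g) * D.chi i g = 1 := by
  rw [← AddChar.map_add_eq_mul, neg_add_cancel, AddChar.map_zero_eq_one]

theorem chi_ne_zero (i : Fin n) (g : G) : D.chi i g ≠ 0 := right_ne_zero_of_mul_eq_one (D.chi_neg_mul i g)

theorem chi_neg (i : Fin n) (g : G) : D.chi i (-g) = (D.chi i g)⁻¹ :=
  eq_inv_of_mul_eq_one_left (D.chi_neg_mul i g)

theorem Kt_mul (g h : G) : D.Kt g * D.Kt h = D.Kt (g + h) := D.isRep_self.t_add g h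
theorem Kt_comm (g h : G) : D.Kt g * D.Kt h = D.Kt h * D.Kt g := by
  rw [Kt_mul, Kt_mul, add_comm]
theorem Kt_zero : D.Kt 0 = 1 := D.isRep_self.t_zero
theorem Kt_E (g : G) (i : Fin n) : D.Kt g * D.E i = D.chi i g • (D.E i * D.Kt g) :=
  D.isRep_self.t_e g i
theorem Kt_F (g : G) (i : Fin n) : D.Kt g * D.F i = D.chi i (-g) • (D.F i * D.Kt g) :=
  D.isRep_self.t_f g i

theorem serreSum_congr {T : Type*} [Ring T] [Algebra K T] {c c' : ℕ → K} {m : ℕ}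
    (h : ∀ k ≤ m, c k = c' k) (X Y : T) : serreSum c m X Y = serreSum c' m X Y :=
  Finset.sum_congr rfl fun k hk => by rw [h k (Nat.lt_succ_iff.1 (Finset.mem_range.1 hk))]

/-- the scalar `s_ij` -/
def sc (i j : Fin n) : K := D.chi j (D.v i) * D.chi i (-D.u j)

theorem serreE_iff {T : Type*} [Ring T] [Algebra K T] {i j : Fin n} (hij : i ≠ j) (X Y : T) :
    serreSum (D.cE i j) (D.m i j) X Y
      = adProd (fun k => D.sc i j * D.sc i i ^ k) X Y (D.m i j) :=
  (serreSum_congr (D.cE_eq i j hij) X Y).trans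
    (serreSum_eq_adProd (D.not_root i) (D.sc i j) X Y _)

theorem serreF_iff {T : Type*} [Ring T] [Algebra K T] {i j : Fin n} (hij : i ≠ j) (X Y : T) :
    serreSum (D.cF i j) (D.m i j) X Y
      = adProd (fun k => D.sc j i * D.sc i i ^ k) X Y (D.m i j) :=
  (serreSum_congr (D.cF_eq i j hij) X Y).trans
    (serreSum_eq_adProd (D.not_root i) (D.sc j i) X Y _)

theorem adProd_tmul_left (f : ℕ → K) (x y : D.Alg) (g h : G) (m : ℕ) :
    adProd f (x ⊗ₜ[K] D.Kt g) (y ⊗ₜ[K] D.Kt h) m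
      = (adProd f x y m) ⊗ₜ[K] D.Kt (m • g + h) := by
  induction m with
  | zero => simp [adProd]
  | succ m ih =>
    have e1 : g + (m • g + h) = (m + 1) • g + h := by rw [succ_nsmul]; abel
    have e2 : m • g + h + g = (m + 1) • g + h := by rw [succ_nsmul]; abel
    simp only [adProd, ih, Algebra.TensorProduct.tmul_mul_tmul, Kt_mul, e1, e2, sub_tmul,
      smul_tmul']

theorem adProd_tmul_right (f : ℕ → K) (x y : D.Alg) (g h : G) (m : ℕ) :
    adProd f (D.Kt g ⊗ₜ[K] x) (D.Kt h ⊗ₜ[K] y) m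
      = D.Kt (m • g + h) ⊗ₜ[K] (adProd f x y m) := by
  induction m with
  | zero => simp [adProd]
  | succ m ih =>
    have e1 : g + (m • g + h) = (m + 1) • g + h := by rw [succ_nsmul]; abel
    have e2 : m • g + h + g = (m + 1) • g + h := by rw [succ_nsmul]; abel
    simp only [adProd, ih, Algebra.TensorProduct.tmul_mul_tmul, Kt_mul, e1, e2, tmul_sub,
      tmul_smul]

theorem isRep_comul : D.IsRep
    (fun i => D.E i ⊗ₜ[K] D.Kt (D.u i) + D.Kt (D.v i) ⊗ₜ[K] D.E i)
    (fun i => D.F i ⊗ₜ[K] D.Kt (D.w i) + D.Kt (D.z i) ⊗ₜ[K] D.F i)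
    (fun g => D.Kt g ⊗ₜ[K] D.Kt g) where
  t_zero := by rw [Kt_zero]; rfl
  t_add g h := by simp [Kt_mul]
  t_e g j := by
    simp only [mul_add, add_mul, Algebra.TensorProduct.tmul_mul_tmul, Kt_E, smul_add,
      tmul_smul, smul_tmul', D.Kt_comm g]
  t_f g j := by
    simp only [mul_add, add_mul, Algebra.TensorProduct.tmul_mul_tmul, Kt_F, smul_add,
      tmul_smul, smul_tmul', D.Kt_comm g]
  e_f i j := by
    have key : ∀ a b : D.Alg, a * b = (a * b - b * a) + b * a := fun a b => by abel
    have h1 : (D.E i * D.Kt (D.z j)) ⊗ₜ[K] (D.Kt (D.u i) * D.F j)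
        = (D.Kt (D.z j) * D.E i) ⊗ₜ[K] (D.F j * D.Kt (D.u i)) := by
      rw [Kt_E, Kt_F, ← smul_tmul', tmul_smul, chi_neg]
      congr 1
      exact inv_eq_of_mul_eq_one_left (D.chi_zu i j)
    have h2 : (D.Kt (D.v i) * D.F j) ⊗ₜ[K] (D.E i * D.Kt (D.w j))
        = (D.F j * D.Kt (D.v i)) ⊗ₜ[K] (D.Kt (D.w j) * D.E i) := by
      rw [Kt_E, Kt_F, ← smul_tmul', tmul_smul, chi_neg]
      congr 1
      exact inv_eq_of_mul_eq_one_right (D.chi_vw i j)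
    simp only [mul_add, add_mul, Algebra.TensorProduct.tmul_mul_tmul, h1, h2]
    have h3 := D.isRep_self.e_f i j
    rw [key (D.E i) (D.F j), h3, D.Kt_comm (D.u i), D.Kt_comm (D.v i), add_tmul, tmul_add]
    split_ifs with hij
    · subst hij
      rw [D.kap_eq, D.lam_eq, Kt_mul, Kt_mul, add_comm (D.z i), add_comm (D.w i)]
      simp only [smul_sub, sub_tmul, tmul_sub, tmul_smul, ← smul_tmul']
      abel
    · simp only [zero_tmul, tmul_zero]
      abel
  serre_e i j hij := by
    have h0 := D.isRep_self.serre_e i j hij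
    rw [D.serreE_iff hij] at h0 ⊢
    refine adProd_skew (t := D.sc j i) ?_ ?_ ?_ (fun hm => ?_) ?_ ?_
    · simp only [Algebra.TensorProduct.tmul_mul_tmul, Kt_E, sc, chi_neg, ← smul_tmul', tmul_smul,
        smul_smul, mul_assoc]
      rw [inv_mul_cancel₀ (D.chi_ne_zero _ _), mul_one]
    · simp only [Algebra.TensorProduct.tmul_mul_tmul, Kt_E, sc, chi_neg, ← smul_tmul', tmul_smul,
        smul_smul, mul_assoc]
      rw [inv_mul_cancel₀ (D.chi_ne_zero _ _), mul_one]
    · simp only [Algebra.TensorProduct.tmul_mul_tmul, Kt_E, sc, chi_neg, ← smul_tmul', tmul_smul,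
        smul_smul, mul_assoc]
      rw [inv_mul_cancel₀ (D.chi_ne_zero _ _), mul_one]
    · exact D.serre_cond i j hij hm
    · rw [adProd_tmul_left, h0, zero_tmul]
    · rw [adProd_tmul_right, h0, tmul_zero]
  serre_f i j hij := by
    have h0 := D.isRep_self.serre_f i j hij
    have e1 : ∀ i j, D.chi i (-D.z j) = D.chi j (D.u i) := fun i j => by
      rw [chi_neg]; exact inv_eq_of_mul_eq_one_right (D.chi_zu i j)
    have e2 : ∀ i j, D.chi i (-D.w j) = D.chi j (D.v i) := fun i j => by
      rw [chi_neg]; exact inv_eq_of_mul_eq_one_left (D.chi_vw i j)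
    rw [D.serreF_iff hij] at h0 ⊢
    rw [add_comm (D.F i ⊗ₜ[K] D.Kt (D.w i)), add_comm (D.F j ⊗ₜ[K] D.Kt (D.w j))]
    have e3 : ∀ (i : Fin n) (g : G) (x : K), x * D.chi i (-g) * D.chi i g = x := fun i g x => by
      rw [mul_assoc, chi_neg_mul, mul_one]
    refine adProd_skew (t := D.sc i j) ?_ ?_ ?_ (fun hm => ?_) ?_ ?_
    · simp only [Algebra.TensorProduct.tmul_mul_tmul, Kt_F, sc, ← smul_tmul', tmul_smul,
        smul_smul, e1, e2, e3]
    · simp only [Algebra.TensorProduct.tmul_mul_tmul, Kt_F, sc, ← smul_tmul', tmul_smul,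
        smul_smul, e1, e2, e3]
    · simp only [Algebra.TensorProduct.tmul_mul_tmul, Kt_F, sc, ← smul_tmul', tmul_smul,
        smul_smul, e1, e2, e3]
    · rw [mul_comm (D.sc j i)]; exact D.serre_cond i j hij hm
    · rw [adProd_tmul_right, h0, tmul_zero]
    · rw [adProd_tmul_left, h0, zero_tmul]

theorem isRep_counit : D.IsRep (T := K) (fun _ => 0) (fun _ => 0) (fun _ => 1) where
  t_zero := rfl
  t_add _ _ := mul_one _
  t_e _ _ := by simp
  t_f _ _ := by simp
  e_f _ _ := by simp
  serre_e i j hij := by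
    simp [serreSum, mul_zero]
  serre_f i j hij := by
    simp [serreSum, mul_zero]

noncomputable instance instBialgebra : Bialgebra K D.Alg :=
  Bialgebra.ofAlgHom (lift D.isRep_comul) (lift D.isRep_counit)
    (by
      apply hom_ext <;> intro i <;>
        simp [tmul_add, add_tmul, add_assoc])
    (by apply hom_ext <;> intro i <;> simp)
    (by apply hom_ext <;> intro i <;> simp)

theorem comul_E (i : Fin n) : Coalgebra.comul (R := K) (D.E i)
    = D.E i ⊗ₜ[K] D.Kt (D.u i) + D.Kt (D.v i) ⊗ₜ[K] D.E i := lift_E D.isRep_comul i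
theorem comul_F (i : Fin n) : Coalgebra.comul (R := K) (D.F i)
    = D.F i ⊗ₜ[K] D.Kt (D.w i) + D.Kt (D.z i) ⊗ₜ[K] D.F i := lift_F D.isRep_comul i
theorem comul_Kt (g : G) : Coalgebra.comul (R := K) (D.Kt g) = D.Kt g ⊗ₜ[K] D.Kt g :=
  lift_Kt D.isRep_comul g
theorem counit_E (i : Fin n) : Coalgebra.counit (R := K) (D.E i) = 0 := lift_E D.isRep_counit i
theorem counit_F (i : Fin n) : Coalgebra.counit (R := K) (D.F i) = 0 := lift_F D.isRep_counit i
theorem counit_Kt (g : G) : Coalgebra.counit (R := K) (D.Kt g) = 1 := lift_Kt D.isRep_counit g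


theorem Kt_adProd {x y : D.Alg} {a b : AddChar G K}
    (ha : ∀ g, D.Kt g * x = a g • (x * D.Kt g))
    (hb : ∀ g, D.Kt g * y = b g • (y * D.Kt g)) (f : ℕ → K) (g : G) (m : ℕ) :
    D.Kt g * adProd f x y m = (a g ^ m * b g) • (adProd f x y m * D.Kt g) := by
  induction m with
  | zero => simpa [adProd] using hb g
  | succ m ih =>
    simp only [adProd]
    set V := adProd f x y m
    rw [mul_sub, sub_mul, ← mul_assoc, ha, smul_mul_assoc, mul_assoc x, ih, mul_smul_comm (f m),
      ← mul_assoc _ V x, ih, smul_mul_assoc _ _ x, mul_assoc V _ x, ha]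
    simp only [mul_smul_comm, smul_mul_assoc, smul_smul, smul_sub, mul_assoc]
    congr 2 <;> ring

open MulOpposite in
theorem adProd_op {x y : D.Alg} {a b : AddChar G K}
    (ha : ∀ g, D.Kt g * x = a g • (x * D.Kt g))
    (hb : ∀ g, D.Kt g * y = b g • (y * D.Kt g)) (r r' : K) (g h : G) (f f' : ℕ → K) (m : ℕ) :
    (∀ k < m, f' k * f k * b g = a h) →
    ∃ C : K, unop (adProd f (op (r • (x * D.Kt g))) (op (r' • (y * D.Kt h))) m)
      = C • (adProd f' x y m * D.Kt (m • g + h)) := by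
  induction m with
  | zero => intro _; exact ⟨r', by simp [adProd]⟩
  | succ m ih =>
    intro hf
    obtain ⟨C, hC⟩ := ih fun k hk => hf k (by omega)
    have h1 := hf m (by omega)
    refine ⟨-(C * r * f m * (a g ^ m * b g)), ?_⟩
    simp only [adProd, unop_sub, unop_mul, unop_smul, unop_op, hC]
    have hV := D.Kt_adProd ha hb f' g m
    set V := adProd f' x y m
    have e1 : m • g + h + g = (m + 1) • g + h := by rw [succ_nsmul]; abel
    have e2 : g + (m • g + h) = (m + 1) • g + h := by rw [succ_nsmul]; abel
    have w1 : V * D.Kt (m • g + h) * (x * D.Kt g)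
        = a (m • g + h) • (V * x * D.Kt ((m + 1) • g + h)) := by
      rw [mul_assoc, ← mul_assoc (D.Kt _) x, ha, smul_mul_assoc, mul_assoc x, Kt_mul, e1,
        mul_smul_comm, mul_assoc]
    have w2 : x * D.Kt g * (V * D.Kt (m • g + h))
        = (a g ^ m * b g) • (x * V * D.Kt ((m + 1) • g + h)) := by
      rw [mul_assoc, ← mul_assoc (D.Kt _) V, hV, smul_mul_assoc, mul_assoc V, Kt_mul, e2,
        mul_smul_comm, mul_assoc]
    have w3 : a (m • g + h) = a g ^ m * (f' m * f m * b g) := by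
      rw [AddChar.map_add_eq_mul, AddChar.map_nsmul_eq_pow, h1]
    simp only [smul_mul_assoc, mul_smul_comm, w1, w2, w3, sub_mul, smul_sub, smul_smul]
    rw [sub_eq_add_neg, sub_eq_add_neg, add_comm, ← neg_smul, ← neg_smul]
    congr 2 <;> ring

/-- `S(E_i) = -K_{-v_i} E_i K_{-u_i}` -/
noncomputable def SE (i : Fin n) : D.Alg := -(D.Kt (-D.v i) * D.E i * D.Kt (-D.u i))
/-- `S(F_i) = -K_{-z_i} F_i K_{-w_i}` -/
noncomputable def SF (i : Fin n) : D.Alg := -(D.Kt (-D.z i) * D.F i * D.Kt (-D.w i))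

theorem SE_eq (i : Fin n) :
    D.SE i = (-D.chi i (-D.v i)) • (D.E i * D.Kt (-D.v i + -D.u i)) := by
  rw [SE, Kt_E, smul_mul_assoc, mul_assoc, Kt_mul, neg_smul]
theorem SF_eq (i : Fin n) :
    D.SF i = (-D.chi i (D.z i)) • (D.F i * D.Kt (-D.z i + -D.w i)) := by
  rw [SF, Kt_F, smul_mul_assoc, mul_assoc, Kt_mul, neg_smul, neg_neg]

theorem chi_neg_z (i j : Fin n) : D.chi i (-D.z j) = D.chi j (D.u i) := by
  rw [chi_neg]; exact inv_eq_of_mul_eq_one_right (D.chi_zu i j)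
theorem chi_neg_w (i j : Fin n) : D.chi i (-D.w j) = D.chi j (D.v i) := by
  rw [chi_neg]; exact inv_eq_of_mul_eq_one_left (D.chi_vw i j)
theorem chi_z (i j : Fin n) : D.chi i (D.z j) = D.chi j (-D.u i) := by
  rw [chi_neg]; exact eq_inv_of_mul_eq_one_left (D.chi_zu i j)
theorem chi_w (i j : Fin n) : D.chi i (D.w j) = D.chi j (-D.v i) := by
  rw [chi_neg]; exact eq_inv_of_mul_eq_one_right (D.chi_vw i j)

open MulOpposite in
theorem isRep_antipode : D.IsRep (fun i => op (D.SE i)) (fun i => op (D.SF i))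
    (fun g => op (D.Kt (-g))) where
  t_zero := by rw [neg_zero, Kt_zero, op_one]
  t_add g h := by rw [← op_mul, Kt_mul, neg_add_rev]
  t_e g j := by
    rw [← op_mul, ← op_mul, ← op_smul, SE_eq]
    congr 1
    rw [mul_smul_comm, ← mul_assoc (D.Kt (-g)), Kt_E]
    simp only [smul_mul_assoc, smul_smul, mul_assoc, D.Kt_comm (-g)]
    congr 1
    linear_combination (D.chi j (-D.v j)) * D.chi_neg_mul j g
  t_f g j := by
    rw [← op_mul, ← op_mul, ← op_smul, SF_eq]
    congr 1
    rw [mul_smul_comm, ← mul_assoc (D.Kt (-g)), Kt_F]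
    simp only [smul_mul_assoc, smul_smul, mul_assoc, D.Kt_comm (-g), neg_neg]
    congr 1
    linear_combination (D.chi j (D.z j)) * D.chi_neg_mul j g
  e_f i j := by
    have h3 := D.isRep_self.e_f i j
    rw [← op_mul, ← op_mul, ← op_sub]
    have w1 : D.SF j * D.SE i = (D.chi j (D.z j) * D.chi i (-D.v i) * D.chi j (D.u i) *
        D.chi j (D.v i)) • (D.F j * D.E i * D.Kt (-D.v i + -D.u i + (-D.z j + -D.w j))) := by
      rw [SF_eq, SE_eq, smul_mul_smul_comm, mul_assoc (D.F j), ← mul_assoc (D.Kt _) (D.E i), Kt_E,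
        smul_mul_assoc, mul_assoc (D.E i), Kt_mul, mul_smul_comm, smul_smul, ← mul_assoc,
        AddChar.map_add_eq_mul, chi_neg_z, chi_neg_w, add_comm (-D.z j + -D.w j)]
      congr 1
      ring
    have w2 : D.SE i * D.SF j = (D.chi j (D.z j) * D.chi i (-D.v i) * D.chi j (D.u i) *
        D.chi j (D.v i)) • (D.E i * D.F j * D.Kt (-D.v i + -D.u i + (-D.z j + -D.w j))) := by
      rw [SF_eq, SE_eq, smul_mul_smul_comm, mul_assoc (D.E i), ← mul_assoc (D.Kt _) (D.F j), Kt_F,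
        smul_mul_assoc, mul_assoc (D.F j), Kt_mul, mul_smul_comm, smul_smul, ← mul_assoc,
        neg_add, neg_neg, neg_neg, AddChar.map_add_eq_mul]
      congr 1
      ring
    rw [w1, w2, ← smul_sub, ← sub_mul, ← neg_sub (D.E i * D.F j), h3]
    split_ifs with hij
    · subst hij
      rw [← op_sub, ← op_smul]
      congr 1
      have : D.chi i (D.z i) * D.chi i (-D.v i) * D.chi i (D.u i) * D.chi i (D.v i) = 1 := by
        linear_combination D.chi_neg_mul i (D.v i) * (D.chi i (D.z i) * D.chi i (D.u i))
          + D.chi_zu i i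
      rw [this, one_smul, neg_mul, smul_mul_assoc, sub_mul, Kt_mul, Kt_mul, D.kap_eq, D.lam_eq,
        ← smul_neg, neg_sub]
      congr 3 <;> abel_nf
    · simp
  serre_e i j hij := by
    have h0 := D.isRep_self.serre_e i j hij
    rw [D.serreE_iff hij] at h0 ⊢
    apply unop_injective
    rw [SE_eq, SE_eq]
    obtain ⟨C, hC⟩ := D.adProd_op (D.Kt_E · i) (D.Kt_E · j) (-D.chi i (-D.v i))
      (-D.chi j (-D.v j)) (-D.v i + -D.u i) (-D.v j + -D.u j)
      (fun k => D.sc i j * D.sc i i ^ k)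
      (fun k => D.sc i j * D.sc i i ^ (D.m i j - 1 - k)) (D.m i j) (by
        intro k hk
        have hc := D.serre_cond i j hij (by omega)
        have hpow : D.sc i i ^ (D.m i j - 1 - k) * D.sc i i ^ k = D.sc i i ^ (D.m i j - 1) := by
          rw [← pow_add]; congr 1; omega
        change _ * D.sc i i ^ _ = (1 : K) at hc
        have e1 := D.chi_neg_mul j (D.v i)
        have e2 := D.chi_neg_mul j (D.u i)
        have e3 := D.chi_neg_mul i (D.v j)
        rw [AddChar.map_add_eq_mul, AddChar.map_add_eq_mul]
        calc _ = D.sc i j * D.sc i j * (D.sc i i ^ (D.m i j - 1 - k) * D.sc i i ^ k)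
              * (D.chi j (-D.v i) * D.chi j (-D.u i)) := by ring
          _ = D.sc i j * D.sc i j * D.sc i i ^ (D.m i j - 1)
              * (D.chi j (-D.v i) * D.chi j (-D.u i)) := by rw [hpow]
          _ = (D.chi j (-D.v i) * D.chi j (D.v i)) * (D.chi i (-D.v j) * D.chi i (D.v j))
              * D.chi i (-D.u j) * D.sc i j * D.sc i i ^ (D.m i j - 1) * D.chi j (-D.u i) := by
              rw [e3]; simp only [sc]; ring
          _ = (D.chi i (-D.v j) * D.chi i (-D.u j)) * (D.chi j (D.v i) * D.chi i (-D.u j)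
              * (D.chi i (D.v j) * D.chi j (-D.u i)) * D.sc i i ^ (D.m i j - 1)) := by
              rw [e1]; simp only [sc]; ring
          _ = _ := by rw [hc, mul_one])
    rw [hC, adProd_reverse (D.E i) (D.E j) (D.m i j) _ (fun k => D.sc i j * D.sc i i ^ k)
      (fun k _ => rfl), h0, zero_mul, smul_zero, unop_zero]
  serre_f i j hij := by
    have h0 := D.isRep_self.serre_f i j hij
    rw [D.serreF_iff hij] at h0 ⊢
    apply unop_injective
    rw [SF_eq, SF_eq]
    obtain ⟨C, hC⟩ := D.adProd_op (a := (D.chi i)⁻¹) (b := (D.chi j)⁻¹)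
      (D.Kt_F · i) (D.Kt_F · j) (-D.chi i (D.z i))
      (-D.chi j (D.z j)) (-D.z i + -D.w i) (-D.z j + -D.w j)
      (fun k => D.sc j i * D.sc i i ^ k)
      (fun k => D.sc j i * D.sc i i ^ (D.m i j - 1 - k)) (D.m i j) (by
        intro k hk
        have hc := D.serre_cond i j hij (by omega)
        have hpow : D.sc i i ^ (D.m i j - 1 - k) * D.sc i i ^ k = D.sc i i ^ (D.m i j - 1) := by
          rw [← pow_add]; congr 1; omega
        change _ * D.sc i i ^ _ = (1 : K) at hc
        have e1 := D.chi_neg_mul i (D.v j)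
        have e3 := D.chi_neg_mul j (D.v i)
        rw [AddChar.map_add_eq_mul, AddChar.map_add_eq_mul]
        simp only [AddChar.inv_apply, neg_neg, chi_z, chi_w]
        calc _ = D.sc j i * D.sc j i * (D.sc i i ^ (D.m i j - 1 - k) * D.sc i i ^ k)
              * (D.chi i (-D.u j) * D.chi i (-D.v j)) := by ring
          _ = D.sc j i * D.sc j i * D.sc i i ^ (D.m i j - 1)
              * (D.chi i (-D.u j) * D.chi i (-D.v j)) := by rw [hpow]
          _ = (D.chi i (-D.v j) * D.chi i (D.v j)) * (D.chi j (-D.v i) * D.chi j (D.v i))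
              * D.chi j (-D.u i) * D.sc j i * D.sc i i ^ (D.m i j - 1) * D.chi i (-D.u j) := by
              rw [e3]; simp only [sc]; ring
          _ = (D.chi j (-D.u i) * D.chi j (-D.v i)) * (D.chi j (D.v i) * D.chi i (-D.u j)
              * (D.chi i (D.v j) * D.chi j (-D.u i)) * D.sc i i ^ (D.m i j - 1)) := by
              rw [e1]; simp only [sc]; ring
          _ = _ := by rw [hc, mul_one])
    rw [hC, adProd_reverse (D.F i) (D.F j) (D.m i j) _ (fun k => D.sc j i * D.sc i i ^ k)
      (fun k _ => rfl), h0, zero_mul, smul_zero, unop_zero]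

/-- the antipode -/
noncomputable def S : D.Alg →ₗ[K] D.Alg :=
  (MulOpposite.opLinearEquiv K).symm.toLinearMap ∘ₗ (lift D.isRep_antipode).toLinearMap

theorem S_E (i : Fin n) : D.S (D.E i) = D.SE i := by simp [S]
theorem S_F (i : Fin n) : D.S (D.F i) = D.SF i := by simp [S]
theorem S_Kt (g : G) : D.S (D.Kt g) = D.Kt (-g) := by simp [S]
theorem S_algebraMap (r : K) : D.S (algebraMap K _ r) = algebraMap K _ r := by
  simp [S, MulOpposite.algebraMap_apply]
theorem S_one : D.S 1 = 1 := by simp [S]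
theorem S_mul (x y : D.Alg) : D.S (x * y) = D.S y * D.S x := by simp [S]

theorem S_left (T : D.Alg ⊗[K] D.Alg) (y z : D.Alg) :
    LinearMap.mul' K D.Alg (D.S.rTensor D.Alg (T * y ⊗ₜ[K] z))
      = D.S y * LinearMap.mul' K D.Alg (D.S.rTensor D.Alg T) * z := by
  induction T with
  | zero => simp
  | add a b ha hb => simp only [add_mul, map_add, mul_add, ha, hb]
  | tmul a b => simp [S_mul, mul_assoc]

theorem S_right (T : D.Alg ⊗[K] D.Alg) (y z : D.Alg) :
    LinearMap.mul' K D.Alg (D.S.lTensor D.Alg (y ⊗ₜ[K] z * T))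
      = y * LinearMap.mul' K D.Alg (D.S.lTensor D.Alg T) * D.S z := by
  induction T with
  | zero => simp
  | add a b ha hb => simp only [add_mul, map_add, mul_add, ha, hb]
  | tmul a b => simp [S_mul, mul_assoc]

theorem S_left' {T : D.Alg ⊗[K] D.Alg} {c : K}
    (h : LinearMap.mul' K D.Alg (D.S.rTensor D.Alg T) = algebraMap K _ c)
    (T' : D.Alg ⊗[K] D.Alg) :
    LinearMap.mul' K D.Alg (D.S.rTensor D.Alg (T * T'))
      = c • LinearMap.mul' K D.Alg (D.S.rTensor D.Alg T') := by
  induction T' with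
  | zero => simp
  | add a b ha hb => simp only [mul_add, map_add, smul_add, ha, hb]
  | tmul a b => simp [S_left, h, Algebra.algebraMap_eq_smul_one]

theorem S_right' {T : D.Alg ⊗[K] D.Alg} {c : K}
    (h : LinearMap.mul' K D.Alg (D.S.lTensor D.Alg T) = algebraMap K _ c)
    (T' : D.Alg ⊗[K] D.Alg) :
    LinearMap.mul' K D.Alg (D.S.lTensor D.Alg (T' * T))
      = c • LinearMap.mul' K D.Alg (D.S.lTensor D.Alg T') := by
  induction T' with
  | zero => simp
  | add a b ha hb => simp only [add_mul, map_add, smul_add, ha, hb]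
  | tmul a b => simp [S_right, h, Algebra.algebraMap_eq_smul_one]

theorem antipode_left (x : D.Alg) :
    LinearMap.mul' K D.Alg (D.S.rTensor D.Alg (Coalgebra.comul (R := K) x))
      = algebraMap K _ (Coalgebra.counit (R := K) x) := by
  induction x using induction with
  | hE i => simp [comul_E, counit_E, S_E, S_Kt, SE, mul_assoc, Kt_mul, Kt_zero]
  | hF i => simp [comul_F, counit_F, S_F, S_Kt, SF, mul_assoc, Kt_mul, Kt_zero]
  | hK g => simp [comul_Kt, counit_Kt, S_Kt, Kt_mul, Kt_zero]
  | hs r => simp [Algebra.TensorProduct.algebraMap_apply, S_algebraMap]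
  | hadd x y hx hy => simp [map_add, hx, hy]
  | hmul x y hx hy =>
    rw [Bialgebra.comul_mul, S_left' D hx, hy, Bialgebra.counit_mul, map_mul, Algebra.smul_def]

theorem antipode_right (x : D.Alg) :
    LinearMap.mul' K D.Alg (D.S.lTensor D.Alg (Coalgebra.comul (R := K) x))
      = algebraMap K _ (Coalgebra.counit (R := K) x) := by
  induction x using induction with
  | hE i => simp [comul_E, counit_E, S_E, S_Kt, SE, ← mul_assoc, Kt_mul, Kt_zero]
  | hF i => simp [comul_F, counit_F, S_F, S_Kt, SF, ← mul_assoc, Kt_mul, Kt_zero]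
  | hK g => simp [comul_Kt, counit_Kt, S_Kt, Kt_mul, Kt_zero]
  | hs r => simp [Algebra.TensorProduct.algebraMap_apply, S_one]
  | hadd x y hx hy => simp [map_add, hx, hy]
  | hmul x y hx hy =>
    rw [Bialgebra.comul_mul, S_right' D hy, hx, Bialgebra.counit_mul, map_mul, Algebra.smul_def]
    exact Algebra.commutes _ _

noncomputable instance instHopf : HopfAlgebra K D.Alg where
  antipode := D.S
  mul_antipode_rTensor_comul := LinearMap.ext D.antipode_left
  mul_antipode_lTensor_comul := LinearMap.ext D.antipode_right

end Hopf
end QDatum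
end Presented

/-! ### Hopf subalgebras -/

section SubHopf
open TensorProduct
variable {K : Type*} [Field K] {H : Type*} [Ring H] [HopfAlgebra K H]

/-- A subalgebra `S` of a Hopf algebra over a field is a Hopf subalgebra if `Δ(S) ⊆ S ⊗ S`
(the image of `S ⊗ S` in `H ⊗ H`) and `S` is stable under the antipode. -/
structure IsHopfSubalgebra (S : Subalgebra K H) : Prop where
  comul_mem : ∀ x ∈ S, Coalgebra.comul (R := K) x ∈
    (Algebra.TensorProduct.map S.val S.val).range
  antipode_mem : ∀ x ∈ S, HopfAlgebra.antipode K x ∈ S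

namespace IsHopfSubalgebra
variable {S : Subalgebra K H}

theorem map_inj (S : Subalgebra K H) : Function.Injective (Algebra.TensorProduct.map S.val S.val) :=
  TensorProduct.map_injective_of_flat_flat (R := K) S.val.toLinearMap S.val.toLinearMap
    Subtype.val_injective Subtype.val_injective

theorem map_inj3 (S : Subalgebra K H) : Function.Injective
    (Algebra.TensorProduct.map S.val (Algebra.TensorProduct.map S.val S.val)) :=
  TensorProduct.map_injective_of_flat_flat (R := K) S.val.toLinearMap
    (Algebra.TensorProduct.map S.val S.val).toLinearMap
    Subtype.val_injective (map_inj S)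

/-- the comultiplication of `H` restricted to the Hopf subalgebra `S` -/
noncomputable def comul (hS : IsHopfSubalgebra S) : S →ₐ[K] S ⊗[K] S :=
  (AlgEquiv.ofInjective (Algebra.TensorProduct.map S.val S.val) (map_inj S)).symm.toAlgHom.comp
    (((Bialgebra.comulAlgHom K H).comp S.val).codRestrict _ fun x => hS.comul_mem x x.2)

theorem map_comul (hS : IsHopfSubalgebra S) (x : S) :
    Algebra.TensorProduct.map S.val S.val (hS.comul x) = Coalgebra.comul (R := K) (x : H) := by
  have := AlgEquiv.apply_symm_apply
    (AlgEquiv.ofInjective (Algebra.TensorProduct.map S.val S.val) (map_inj S))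
    ((((Bialgebra.comulAlgHom K H).comp S.val).codRestrict _ fun x => hS.comul_mem x x.2) x)
  exact congrArg Subtype.val this

/-- a Hopf subalgebra is a bialgebra -/
@[reducible] noncomputable def bialgebra (hS : IsHopfSubalgebra S) : Bialgebra K S :=
  Bialgebra.ofAlgHom hS.comul ((Bialgebra.counitAlgHom K H).comp S.val)
    (by
      apply AlgHom.ext
      intro x
      apply map_inj3 S
      have h1 : ∀ t : S ⊗[K] S, Algebra.TensorProduct.map S.val
          (Algebra.TensorProduct.map S.val S.val)
          (Algebra.TensorProduct.assoc K K K S S S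
            (Algebra.TensorProduct.map hS.comul (AlgHom.id K S) t))
          = TensorProduct.assoc K H H H (Coalgebra.comul.rTensor H
            (Algebra.TensorProduct.map S.val S.val t)) := by
        intro t
        induction t with
        | zero => simp
        | add a b ha hb => simp only [map_add, ha, hb]
        | tmul a b =>
          simp only [Algebra.TensorProduct.map_tmul, AlgHom.coe_id, id_eq, Subalgebra.coe_val,
            LinearMap.rTensor_tmul, ← map_comul hS]
          induction hS.comul a with
          | zero => simp
          | add a b ha hb => simp only [map_add, add_tmul, ha, hb]
          | tmul a b => simp
      have h2 : ∀ t : S ⊗[K] S, Algebra.TensorProduct.map S.val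
          (Algebra.TensorProduct.map S.val S.val)
            (Algebra.TensorProduct.map (AlgHom.id K S) hS.comul t)
          = Coalgebra.comul.lTensor H (Algebra.TensorProduct.map S.val S.val t) := by
        intro t
        induction t with
        | zero => simp
        | add a b ha hb => simp only [map_add, ha, hb]
        | tmul a b => simp [map_comul hS]
      have h3 := Coalgebra.coassoc_apply (R := K) (x : H)
      rw [← map_comul hS, ← h1, ← h2] at h3
      exact h3)
    (by
      apply AlgHom.ext
      intro x
      have h1 : ∀ t : S ⊗[K] S, (Algebra.TensorProduct.map (AlgHom.id K K) S.val)
          (Algebra.TensorProduct.map ((Bialgebra.counitAlgHom K H).comp S.val) (AlgHom.id K S) t)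
          = Coalgebra.counit.rTensor H (Algebra.TensorProduct.map S.val S.val t) := by
        intro t
        induction t with
        | zero => simp
        | add a b ha hb => simp only [map_add, ha, hb]
        | tmul a b => simp
      have hi : Function.Injective (Algebra.TensorProduct.map (AlgHom.id K K) S.val) :=
        TensorProduct.map_injective_of_flat_flat (R := K) LinearMap.id S.val.toLinearMap
          Function.injective_id Subtype.val_injective
      apply hi
      have h3 := Coalgebra.rTensor_counit_comul (R := K) (x : H)
      rw [← map_comul hS, ← h1] at h3
      simpa using h3)
    (by
      apply AlgHom.ext
      intro x
      have h1 : ∀ t : S ⊗[K] S, (Algebra.TensorProduct.map S.val (AlgHom.id K K))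
          (Algebra.TensorProduct.map (AlgHom.id K S) ((Bialgebra.counitAlgHom K H).comp S.val) t)
          = Coalgebra.counit.lTensor H (Algebra.TensorProduct.map S.val S.val t) := by
        intro t
        induction t with
        | zero => simp
        | add a b ha hb => simp only [map_add, ha, hb]
        | tmul a b => simp
      have hi : Function.Injective (Algebra.TensorProduct.map S.val (AlgHom.id K K)) :=
        TensorProduct.map_injective_of_flat_flat (R := K) S.val.toLinearMap LinearMap.id
          Subtype.val_injective Function.injective_id
      apply hi
      have h3 := Coalgebra.lTensor_counit_comul (R := K) (x : H)
      rw [← map_comul hS, ← h1] at h3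
      simpa using h3)

/-- the antipode of `H` restricted to the Hopf subalgebra `S` -/
noncomputable def antipode (hS : IsHopfSubalgebra S) : S →ₗ[K] S :=
  (HopfAlgebra.antipode K ∘ₗ S.val.toLinearMap).codRestrict (Subalgebra.toSubmodule S)
    fun x => hS.antipode_mem x x.2

theorem coe_antipode (hS : IsHopfSubalgebra S) (x : S) :
    ((hS.antipode x : S) : H) = HopfAlgebra.antipode K (x : H) := rfl

/-- a Hopf subalgebra is a Hopf algebra -/
@[reducible] noncomputable def hopfAlgebra (hS : IsHopfSubalgebra S) : HopfAlgebra K S :=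
  letI := hS.bialgebra
  { hS.bialgebra with
    antipode := hS.antipode
    mul_antipode_rTensor_comul := by
      apply LinearMap.ext
      intro x
      apply Subtype.val_injective
      have h1 : ∀ t : S ⊗[K] S,
          ((LinearMap.mul' K S (hS.antipode.rTensor S t) : S) : H)
            = LinearMap.mul' K H ((HopfAlgebra.antipode K).rTensor H
              (Algebra.TensorProduct.map S.val S.val t)) := by
        intro t
        induction t with
        | zero => simp
        | add a b ha hb => simp only [map_add, ← ha, ← hb, Subalgebra.coe_add]
        | tmul a b => simp [coe_antipode]
      have h2 := HopfAlgebra.mul_antipode_rTensor_comul_apply (R := K) (x : H)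
      rw [← map_comul hS, ← h1] at h2
      exact h2
    mul_antipode_lTensor_comul := by
      apply LinearMap.ext
      intro x
      apply Subtype.val_injective
      have h1 : ∀ t : S ⊗[K] S,
          ((LinearMap.mul' K S (hS.antipode.lTensor S t) : S) : H)
            = LinearMap.mul' K H ((HopfAlgebra.antipode K).lTensor H
              (Algebra.TensorProduct.map S.val S.val t)) := by
        intro t
        induction t with
        | zero => simp
        | add a b ha hb => simp only [map_add, ← ha, ← hb, Subalgebra.coe_add]
        | tmul a b => simp [coe_antipode]
      have h2 := HopfAlgebra.mul_antipode_lTensor_comul_apply (R := K) (x : H)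
      rw [← map_comul hS, ← h1] at h2
      exact h2 }

end IsHopfSubalgebra

/-- The subalgebra generated by a set is a Hopf subalgebra as soon as `Δ` and `S` map the
generators into the right place. -/
theorem IsHopfSubalgebra.of_adjoin (X : Set H)
    (hc : ∀ x ∈ X, Coalgebra.comul (R := K) x ∈ (Algebra.TensorProduct.map
      (Algebra.adjoin K X).val (Algebra.adjoin K X).val).range)
    (ha : ∀ x ∈ X, HopfAlgebra.antipode K x ∈ Algebra.adjoin K X) :
    IsHopfSubalgebra (Algebra.adjoin K X) where
  comul_mem := by
    intro x hx
    have : Algebra.adjoin K X ≤ Subalgebra.comap (Bialgebra.comulAlgHom K H)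
        (Algebra.TensorProduct.map (Algebra.adjoin K X).val (Algebra.adjoin K X).val).range :=
      Algebra.adjoin_le hc
    exact this hx
  antipode_mem := by
    intro x hx
    induction hx using Algebra.adjoin_induction with
    | mem x hx => exact ha x hx
    | algebraMap r =>
      rw [Algebra.algebraMap_eq_smul_one, map_smul, HopfAlgebra.antipode_one]
      exact Subalgebra.smul_mem _ (one_mem _) r
    | add x y _ _ hx hy => rw [map_add]; exact add_mem hx hy
    | mul x y _ _ hx hy =>
      rw [HopfAlgebra.antipode_mul_antidistrib]; exact mul_mem hy hx

end SubHopf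

/-! ### The quantum groups -/

section Quantum
open TensorProduct

/-- The ground field `k_q = ⋃_m k(q^{1/m})`, realized as the field of fractions of the group algebra
of the additive group `ℚ` over `k`. -/
def Kq (k : Type*) [Field k] : Type _ := FractionRing (AddMonoidAlgebra k ℚ)

noncomputable instance (k : Type*) [Field k] : Field (Kq k) :=
  inferInstanceAs (Field (FractionRing (AddMonoidAlgebra k ℚ)))

/-- the powers `q^r`, `r ∈ ℚ` -/
noncomputable def qpow (k : Type*) [Field k] : AddChar ℚ (Kq k) where
  toFun r := algebraMap (AddMonoidAlgebra k ℚ) (FractionRing (AddMonoidAlgebra k ℚ))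
    (AddMonoidAlgebra.single r 1)
  map_zero_eq_one' := map_one _
  map_add_eq_mul' r s :=
    (congrArg (algebraMap (AddMonoidAlgebra k ℚ) (FractionRing (AddMonoidAlgebra k ℚ)))
      (by rw [AddMonoidAlgebra.single_mul_single, one_mul])).trans
      (map_mul (algebraMap (AddMonoidAlgebra k ℚ) (FractionRing (AddMonoidAlgebra k ℚ))) _ _)

theorem qpow_inj (k : Type*) [Field k] : Function.Injective (qpow k) := by
  intro r s h
  have h1 := IsFractionRing.injective (AddMonoidAlgebra k ℚ)
    (FractionRing (AddMonoidAlgebra k ℚ)) h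
  have h2 := congrArg AddMonoidAlgebra.coeff h1
  simpa [Finsupp.single_eq_single_iff] using h2

theorem qpow_pow (k : Type*) [Field k] (r : ℚ) (m : ℕ) : qpow k r ^ m = qpow k (m * r) := by
  rw [← AddChar.map_nsmul_eq_pow, nsmul_eq_mul]

theorem qpow_neg (k : Type*) [Field k] (r : ℚ) : qpow k (-r) = (qpow k r)⁻¹ := by
  apply eq_inv_of_mul_eq_one_left
  rw [← AddChar.map_add_eq_mul, neg_add_cancel, AddChar.map_zero_eq_one]

theorem qpow_ne_zero (k : Type*) [Field k] (r : ℚ) : qpow k r ≠ 0 := by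
  intro h
  have : qpow k (-r) * qpow k r = 1 := by
    rw [← AddChar.map_add_eq_mul, neg_add_cancel, AddChar.map_zero_eq_one]
  rw [h, mul_zero] at this
  exact zero_ne_one this

theorem qpow_pow_ne_one (k : Type*) [Field k] {r : ℚ} (hr : r ≠ 0) (m : ℕ) (hm : 0 < m) :
    qpow k r ^ m ≠ 1 := by
  rw [qpow_pow, ← AddChar.map_zero_eq_one (qpow k)]
  intro h
  have := qpow_inj k h
  have hm' : (m : ℚ) ≠ 0 := by exact_mod_cast hm.ne'
  exact mul_ne_zero hm' hr this

/-- A symmetrizable generalized Cartan matrix `A` of size `n` with a choice of positive integers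
`d_i` such that `(d_i a_ij)` is symmetric. -/
structure CartanDatum (n : ℕ) where
  A : Matrix (Fin n) (Fin n) ℤ
  d : Fin n → ℕ
  diag : ∀ i, A i i = 2
  off_diag : ∀ i j, i ≠ j → A i j ≤ 0
  zero_symm : ∀ i j, A i j = 0 → A j i = 0
  d_pos : ∀ i, 0 < d i
  symmetrizable : ∀ i j, (d i : ℤ) * A i j = d j * A j i

/-- `ℚQ`, with the simple roots as standard basis. -/
abbrev QRoot (n : ℕ) := Fin n → ℚ

/-- the simple root `α_i` -/
def sroot {n : ℕ} (i : Fin n) : QRoot n := Pi.single i 1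

/-- the bilinear form on `ℚQ` with Gram matrix `M` in the basis of simple roots -/
def bil {n : ℕ} (M : Matrix (Fin n) (Fin n) ℚ) (x y : QRoot n) : ℚ := x ⬝ᵥ M.mulVec y

section bil
variable {n : ℕ} (M N : Matrix (Fin n) (Fin n) ℚ) (x y z : QRoot n)
theorem bil_add_left : bil M (x + y) z = bil M x z + bil M y z := add_dotProduct _ _ _
theorem bil_add_right : bil M x (y + z) = bil M x y + bil M x z := by
  rw [bil, Matrix.mulVec_add, dotProduct_add]; rfl
theorem bil_zero_left : bil M 0 z = 0 := zero_dotProduct _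
theorem bil_zero_right : bil M x 0 = 0 := by rw [bil, Matrix.mulVec_zero, dotProduct_zero]
theorem bil_neg_left : bil M (-x) z = -bil M x z := neg_dotProduct _ _
theorem bil_sroot (i j : Fin n) : bil M (sroot i) (sroot j) = M i j := by
  simp [bil, sroot]
theorem bil_mulVec (i j : Fin n) :
    bil M (N.mulVec (sroot i)) (sroot j) = (N.transpose * M) i j := by
  simp [bil, sroot, Matrix.mul_apply, dotProduct]
end bil

namespace CartanDatum
variable {n : ℕ} (C : CartanDatum n)

/-- the Cartan matrix over `ℚ` -/
def AQ : Matrix (Fin n) (Fin n) ℚ := C.A.map (Int.cast : ℤ → ℚ)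
/-- the matrix `D = diag(d_1, …, d_n)` over `ℚ` -/
def DQ : Matrix (Fin n) (Fin n) ℚ := Matrix.diagonal fun i => (C.d i : ℚ)
/-- the matrix `D⁻¹` over `ℚ` -/
def DInvQ : Matrix (Fin n) (Fin n) ℚ := Matrix.diagonal fun i => (C.d i : ℚ)⁻¹
/-- the matrix `DA = (d_i a_ij)` -/
def DA : Matrix (Fin n) (Fin n) ℚ := C.DQ * C.AQ

theorem DA_apply (i j : Fin n) : C.DA i j = C.d i * C.A i j := by
  simp [DA, DQ, AQ, Matrix.diagonal_mul]

theorem DA_symm (i j : Fin n) : C.DA i j = C.DA j i := by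
  rw [DA_apply, DA_apply]; exact_mod_cast C.symmetrizable i j

theorem DInvQ_mul_DQ : C.DInvQ * C.DQ = 1 := by
  rw [DInvQ, DQ, Matrix.diagonal_mul_diagonal, ← Matrix.diagonal_one]
  congr 1
  funext i
  have : (C.d i : ℚ) ≠ 0 := by exact_mod_cast (C.d_pos i).ne'
  field_simp

/-- the symmetric form `(α_i, α_j) = d_i a_ij` -/
def form (x y : QRoot n) : ℚ := bil C.DA x y

/-- `ψ_+(α_l) = ∑_{i,j} ψ_ij a_jl d_i⁻¹ α_i` -/
def psiP (Ψ : Matrix (Fin n) (Fin n) ℚ) : QRoot n →ₗ[ℚ] QRoot n :=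
  (C.DInvQ * Ψ * C.AQ).mulVecLin
/-- `ψ_-(α_l) = ∑_{i,j} ψ_ji a_jl d_i⁻¹ α_i` -/
def psiM (Ψ : Matrix (Fin n) (Fin n) ℚ) : QRoot n →ₗ[ℚ] QRoot n :=
  (C.DInvQ * Ψ.transpose * C.AQ).mulVecLin

theorem form_psiP (Ψ : Matrix (Fin n) (Fin n) ℚ) (i j : Fin n) :
    C.form (C.psiP Ψ (sroot i)) (sroot j) = (C.AQ.transpose * Ψ.transpose * C.AQ) i j := by
  rw [form, psiP, Matrix.mulVecLin_apply, bil_mulVec]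
  have h : C.DInvQ.transpose = C.DInvQ := Matrix.diagonal_transpose _
  rw [Matrix.transpose_mul, Matrix.transpose_mul, h, DA]
  simp only [Matrix.mul_assoc]
  rw [← Matrix.mul_assoc C.DInvQ, DInvQ_mul_DQ, Matrix.one_mul]

theorem form_psiM (Ψ : Matrix (Fin n) (Fin n) ℚ) (i j : Fin n) :
    C.form (C.psiM Ψ (sroot i)) (sroot j) = (C.AQ.transpose * Ψ * C.AQ) i j := by
  have := C.form_psiP Ψ.transpose i j
  rwa [Matrix.transpose_transpose] at this

theorem psi_swap (Ψ : Matrix (Fin n) (Fin n) ℚ) (i j : Fin n) :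
    C.form (C.psiP Ψ (sroot i)) (sroot j) = C.form (C.psiM Ψ (sroot j)) (sroot i) := by
  rw [form_psiP, form_psiM, ← Matrix.transpose_apply (C.AQ.transpose * Ψ * C.AQ),
    Matrix.transpose_mul, Matrix.transpose_mul, Matrix.transpose_transpose, Matrix.mul_assoc]

theorem form_add (x y z : QRoot n) : C.form (x + y) z = C.form x z + C.form y z :=
  bil_add_left _ _ _ _
theorem form_neg (x z : QRoot n) : C.form (-x) z = -C.form x z := bil_neg_left _ _ _
theorem form_sroot (i j : Fin n) : C.form (sroot i) (sroot j) = C.DA i j := bil_sroot _ _ _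

/-- the integer `1 - a_ij`, for `i ≠ j` -/
def serreDeg (i j : Fin n) : ℕ := (1 - C.A i j).toNat

theorem serreDeg_sub_one {i j : Fin n} (h : i ≠ j) :
    ((C.serreDeg i j - 1 : ℕ) : ℚ) = -(C.A i j : ℚ) := by
  have := C.off_diag i j h
  have h1 : ((C.serreDeg i j - 1 : ℕ) : ℤ) = -C.A i j := by unfold serreDeg; omega
  exact_mod_cast h1

theorem serreDeg_cast {i j : Fin n} (h : i ≠ j) :
    ((C.serreDeg i j : ℕ) : ℚ) = 1 - (C.A i j : ℚ) := by
  have := C.off_diag i j h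
  have h1 : ((C.serreDeg i j : ℕ) : ℤ) = 1 - C.A i j := by unfold serreDeg; omega
  exact_mod_cast h1

end CartanDatum

/-- A `q`-rational multiparameter of Cartan type: `q_ij = q^{r_ij}` with `q_ii = q^{2 d_i}` and
`q_ij q_ji = q_ii^{a_ij}`. -/
structure QRatMultiparameter {n : ℕ} (C : CartanDatum n) where
  R : Matrix (Fin n) (Fin n) ℚ
  cartan : R + R.transpose = 2 • C.DA

namespace QRatMultiparameter
variable {n : ℕ} {C : CartanDatum n} (qm : QRatMultiparameter C)

/-- the entry `q_ij = q^{r_ij}` -/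
noncomputable def ent (k : Type*) [Field k] (i j : Fin n) : Kq k := qpow k (qm.R i j)

theorem R_add (i j : Fin n) : qm.R i j + qm.R j i = 2 * C.DA i j := by
  have := congrFun (congrFun qm.cartan i) j
  simpa using this

theorem R_diag (i : Fin n) : qm.R i i = 2 * C.d i := by
  have := qm.R_add i i
  rw [C.DA_apply, C.diag] at this
  push_cast at this
  linarith

/-- the canonical multiparameter `q_ij = q^{d_i a_ij}` -/
def canonical (C : CartanDatum n) : QRatMultiparameter C where
  R := C.DA
  cartan := by
    ext i j
    rw [Matrix.add_apply, Matrix.transpose_apply, C.DA_symm j i, Matrix.smul_apply, two_smul]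

/-- the twist `Ψ` and the multiparameter `qm = q^R` correspond to each other:
`R = DA + Aᵀ (Ψᵀ - Ψ) A` -/
def Corresponds (Ψ : Matrix (Fin n) (Fin n) ℚ) (qm : QRatMultiparameter C) : Prop :=
  qm.R = C.DA + C.AQ.transpose * (Ψ.transpose - Ψ) * C.AQ

end QRatMultiparameter

/-- A subgroup of `ℚQ` containing the root lattice `Q`. -/
structure TorusLattice (n : ℕ) where
  M : Submodule ℤ (QRoot n)
  root_mem : ∀ i, sroot i ∈ M

namespace TorusLattice
/-- the simple root `α_i` as an element of the lattice -/
def root {n : ℕ} (L : TorusLattice n) (i : Fin n) : L.M := ⟨sroot i, L.root_mem i⟩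
end TorusLattice

/-- The character of `M_+ × M_-` by which the torus `K_γ L_δ` of the MpQUEA acts on `E_j`, namely
`K_γ E_j K_γ⁻¹ = q^{R(γ, α_j)} E_j` and `L_δ E_j L_δ⁻¹ = q^{-R(α_j, δ)} E_j`. -/
noncomputable def mpChi (k : Type*) [Field k] {n : ℕ} {C : CartanDatum n}
    (qm : QRatMultiparameter C) (Mp Mm : TorusLattice n) (j : Fin n) :
    AddChar (Mp.M × Mm.M) (Kq k) where
  toFun g := qpow k (bil qm.R g.1 (sroot j) - bil qm.R (sroot j) g.2)
  map_zero_eq_one' := by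
    simp [bil_zero_left, bil_zero_right, AddChar.map_zero_eq_one]
  map_add_eq_mul' g h := by
    rw [← AddChar.map_add_eq_mul]
    simp only [Prod.fst_add, Prod.snd_add, Submodule.coe_add, bil_add_left, bil_add_right]
    congr 1; ring

theorem mpChi_apply (k : Type*) [Field k] {n : ℕ} {C : CartanDatum n}
    (qm : QRatMultiparameter C) (Mp Mm : TorusLattice n) (j : Fin n) (g : Mp.M × Mm.M) :
    mpChi k qm Mp Mm j g = qpow k (bil qm.R g.1 (sroot j) - bil qm.R (sroot j) g.2) := rfl

theorem mpChi_root (k : Type*) [Field k] {n : ℕ} {C : CartanDatum n}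
    (qm : QRatMultiparameter C) (Mp Mm : TorusLattice n) (i j : Fin n) :
    mpChi k qm Mp Mm j (Mp.root i, 0) * mpChi k qm Mp Mm i (-0) = qm.ent k i j := by
  rw [neg_zero, AddChar.map_zero_eq_one, mul_one, mpChi_apply]
  simp only [TorusLattice.root, bil_sroot, Submodule.coe_zero, bil_zero_right, sub_zero]
  rfl

/-- The datum presenting the MpQUEA `U_{q, M_+ × M_-}(g_D)`: generators `E_i`, `F_i`, `K_γ`
(`γ ∈ M_+`), `L_δ` (`δ ∈ M_-`), with `K_γ L_δ` the torus element indexed by `(γ, δ)`. -/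
noncomputable def mpDatum (k : Type*) [Field k] {n : ℕ} {C : CartanDatum n}
    (qm : QRatMultiparameter C) (Mp Mm : TorusLattice n) : QDatum (Kq k) n (Mp.M × Mm.M) where
  chi := mpChi k qm Mp Mm
  kap i := (Mp.root i, 0)
  lam i := (0, Mm.root i)
  c i := qm.ent k i i / (qm.ent k i i - 1)
  m := C.serreDeg
  cE i j s := (-1) ^ s * qBinom (qm.ent k i i) (C.serreDeg i j) s
    * qm.ent k i i ^ (s.choose 2) * qm.ent k i j ^ s
  cF i j s := (-1) ^ s * qBinom (qm.ent k i i) (C.serreDeg i j) s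
    * qm.ent k i i ^ (s.choose 2) * qm.ent k j i ^ s
  u _ := 0
  v i := (Mp.root i, 0)
  w i := (0, Mm.root i)
  z _ := 0
  kap_eq i := (add_zero _).symm
  lam_eq i := (zero_add _).symm
  chi_zu i j := by rw [AddChar.map_zero_eq_one, AddChar.map_zero_eq_one, one_mul]
  chi_vw i j := by
    simp [mpChi_apply, TorusLattice.root, bil_sroot, bil_zero_left, bil_zero_right,
      ← AddChar.map_add_eq_mul, AddChar.map_zero_eq_one]
  not_root i s hs := by
    rw [mpChi_root]
    refine qpow_pow_ne_one k ?_ s hs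
    rw [qm.R_diag]
    have := C.d_pos i
    positivity
  serre_cond i j hij _ := by
    rw [mpChi_root, mpChi_root, mpChi_root]
    simp only [QRatMultiparameter.ent, qpow_pow, ← AddChar.map_add_eq_mul]
    rw [qm.R_add, qm.R_diag, C.DA_apply, C.serreDeg_sub_one hij,
      ← AddChar.map_zero_eq_one (qpow k)]
    congr 1; ring
  cE_eq i j _ s _ := by rw [mpChi_root, mpChi_root]
  cF_eq i j _ s _ := by rw [mpChi_root, mpChi_root]

/-- The character of `ℚQ × ℚQ` by which the torus of the quantum double acts on `E_j`:
`K_{γ_+} E_j K_{γ_+}⁻¹ = q^{(γ, α_j)} E_j` and `K_{γ_-} E_j K_{γ_-}⁻¹ = q^{(γ, α_j)} E_j`. -/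
noncomputable def twChi (k : Type*) [Field k] {n : ℕ} (C : CartanDatum n) (j : Fin n) :
    AddChar (QRoot n × QRoot n) (Kq k) where
  toFun g := qpow k (C.form (g.1 + g.2) (sroot j))
  map_zero_eq_one' := by
    rw [Prod.fst_zero, Prod.snd_zero, add_zero, CartanDatum.form, bil_zero_left,
      AddChar.map_zero_eq_one]
  map_add_eq_mul' g h := by
    rw [← AddChar.map_add_eq_mul]
    simp only [Prod.fst_add, Prod.snd_add, C.form_add]
    congr 1; ring

theorem twChi_apply (k : Type*) [Field k] {n : ℕ} (C : CartanDatum n) (j : Fin n)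
    (x y : QRoot n) : twChi k C j (x, y) = qpow k (C.form (x + y) (sroot j)) := rfl

theorem twChi_root (k : Type*) [Field k] {n : ℕ} (C : CartanDatum n)
    (Ψ : Matrix (Fin n) (Fin n) ℚ) (i j : Fin n) :
    twChi k C j (sroot i + C.psiP Ψ (sroot i), 0) * twChi k C i (-(0, C.psiM Ψ (sroot j)))
      = qpow k (C.DA i j) := by
  have := C.psi_swap Ψ i j
  rw [Prod.neg_mk, twChi_apply, twChi_apply, ← AddChar.map_add_eq_mul, add_zero, neg_zero, zero_add,
    C.form_neg, C.form_add, C.form_sroot, this, add_neg_cancel_right]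

theorem tw_serre (k : Type*) [Field k] {n : ℕ} (C : CartanDatum n) {i j : Fin n} (hij : i ≠ j)
    {s : ℕ} (hs : s ≤ C.serreDeg i j) :
    (-1) ^ s * qBinomS (qpow k (C.d i)) (C.serreDeg i j) s
      = (-1) ^ s * qBinom (qpow k (C.DA i i)) (C.serreDeg i j) s
        * qpow k (C.DA i i) ^ (s.choose 2) * qpow k (C.DA i j) ^ s := by
  have h2 : qpow k (C.d i) ^ 2 = qpow k (C.DA i i) := by
    rw [qpow_pow, C.DA_apply, C.diag]; congr 1; push_cast; ring
  have hd : C.DA i i ≠ 0 := by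
    rw [C.DA_apply, C.diag]
    have := C.d_pos i
    positivity
  rw [qBinomS_eq (qpow_ne_zero k _) _ _ hs (fun r hr => by
    rw [h2]; exact qpow_pow_ne_one k hd r hr), h2, ← qpow_neg]
  have key : qpow k (-(C.d i : ℚ)) ^ (s * (C.serreDeg i j - s))
      = qpow k (C.DA i i) ^ (s.choose 2) * qpow k (C.DA i j) ^ s := by
    rw [qpow_pow, qpow_pow, qpow_pow, ← AddChar.map_add_eq_mul]
    congr 1
    have hc : (s.choose 2 : ℚ) = s * (s - 1) / 2 := Nat.cast_choose_two ℚ s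
    rw [Nat.cast_mul, Nat.cast_sub hs, C.serreDeg_cast hij, hc, C.DA_apply, C.DA_apply, C.diag]
    push_cast
    ring
  rw [key]
  ring

/-- The datum presenting the quantum double `U_{q, ℚQ × ℚQ}(g_D)` (largest torus), with the Hopf
structure twisted by `Ψ`. The first copy of `ℚQ` carries `γ_+ = (γ, 0)`, the second `γ_- = (0, γ)`. -/
noncomputable def twDatum (k : Type*) [Field k] {n : ℕ} (C : CartanDatum n)
    (Ψ : Matrix (Fin n) (Fin n) ℚ) : QDatum (Kq k) n (QRoot n × QRoot n) where
  chi := twChi k C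
  kap i := (sroot i, 0)
  lam i := (0, -sroot i)
  c i := (qpow k (C.d i) - (qpow k (C.d i))⁻¹)⁻¹
  m := C.serreDeg
  cE i j s := (-1) ^ s * qBinomS (qpow k (C.d i)) (C.serreDeg i j) s
  cF i j s := (-1) ^ s * qBinomS (qpow k (C.d i)) (C.serreDeg i j) s
  u i := (0, C.psiM Ψ (sroot i))
  v i := (sroot i + C.psiP Ψ (sroot i), 0)
  w i := (0, -(sroot i + C.psiM Ψ (sroot i)))
  z i := (-C.psiP Ψ (sroot i), 0)
  kap_eq i := by simp
  lam_eq i := by simp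
  chi_zu i j := by
    have := C.psi_swap Ψ j i
    rw [twChi_apply, twChi_apply, ← AddChar.map_add_eq_mul, add_zero, zero_add, C.form_neg, this,
      neg_add_cancel, AddChar.map_zero_eq_one]
  chi_vw i j := by
    have := C.psi_swap Ψ i j
    rw [twChi_apply, twChi_apply, ← AddChar.map_add_eq_mul, add_zero, zero_add, C.form_neg,
      C.form_add, C.form_add, C.form_sroot, C.form_sroot, this, C.DA_symm i j, add_neg_cancel,
      AddChar.map_zero_eq_one]
  not_root i s hs := by
    rw [twChi_root]
    exact qpow_pow_ne_one k (by
      rw [C.DA_apply, C.diag]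
      have := C.d_pos i
      positivity) s hs
  serre_cond i j hij _ := by
    rw [twChi_root, twChi_root, twChi_root, qpow_pow, ← AddChar.map_add_eq_mul,
      ← AddChar.map_add_eq_mul, C.DA_symm j i, C.DA_apply, C.DA_apply, C.diag,
      C.serreDeg_sub_one hij, ← AddChar.map_zero_eq_one (qpow k)]
    congr 1; push_cast; ring
  cE_eq i j hij s hs := by
    rw [twChi_root, twChi_root, tw_serre k C hij hs]
  cF_eq i j hij s hs := by
    rw [twChi_root, twChi_root, C.DA_symm j i, tw_serre k C hij hs]

end Quantum

section Main
open TensorProduct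

/-- The MpQUEA `U_{q, M_+ × M_-}(g_D)`, with its Hopf algebra structure. -/
abbrev MpQUEA (k : Type*) [Field k] {n : ℕ} {C : CartanDatum n}
    (qm : QRatMultiparameter C) (Mp Mm : TorusLattice n) : Type _ := (mpDatum k qm Mp Mm).Alg

/-- The twisted quantum double `U^Ψ_{q, ℚQ × ℚQ}(g_D)` with largest torus. -/
abbrev TwFull (k : Type*) [Field k] {n : ℕ} (C : CartanDatum n)
    (Ψ : Matrix (Fin n) (Fin n) ℚ) : Type _ := (twDatum k C Ψ).Alg

/-- the twisted generator `E_i^Ψ = K_{-ψ_-(α_i^-)} E_i` -/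
noncomputable def twE (k : Type*) [Field k] {n : ℕ} (C : CartanDatum n)
    (Ψ : Matrix (Fin n) (Fin n) ℚ) (i : Fin n) : TwFull k C Ψ :=
  (twDatum k C Ψ).Kt (0, -C.psiM Ψ (sroot i)) * (twDatum k C Ψ).E i

/-- the twisted generator `F_i^Ψ = K_{ψ_+(α_i^+)} F_i` -/
noncomputable def twF (k : Type*) [Field k] {n : ℕ} (C : CartanDatum n)
    (Ψ : Matrix (Fin n) (Fin n) ℚ) (i : Fin n) : TwFull k C Ψ :=
  (twDatum k C Ψ).Kt (C.psiP Ψ (sroot i), 0) * (twDatum k C Ψ).F i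

namespace CartanDatum
variable {n : ℕ} (C : CartanDatum n)

/-- `γ ↦ γ_+ + ψ_+(γ_+) - ψ_-(γ_-)` -/
def phiP (Ψ : Matrix (Fin n) (Fin n) ℚ) : QRoot n →ₗ[ℤ] QRoot n × QRoot n :=
  (LinearMap.prod (LinearMap.id + C.psiP Ψ) (-C.psiM Ψ)).restrictScalars ℤ
/-- `γ ↦ γ_- + ψ_-(γ_-) - ψ_+(γ_+)` -/
def phiM (Ψ : Matrix (Fin n) (Fin n) ℚ) : QRoot n →ₗ[ℤ] QRoot n × QRoot n :=
  (LinearMap.prod (-C.psiP Ψ) (LinearMap.id + C.psiM Ψ)).restrictScalars ℤ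

theorem phiP_apply (Ψ : Matrix (Fin n) (Fin n) ℚ) (x : QRoot n) :
    C.phiP Ψ x = (x + C.psiP Ψ x, -C.psiM Ψ x) := rfl
theorem phiM_apply (Ψ : Matrix (Fin n) (Fin n) ℚ) (x : QRoot n) :
    C.phiM Ψ x = (-C.psiP Ψ x, x + C.psiM Ψ x) := rfl

/-- A torus in `ℚQ × ℚQ` large enough for the Hopf structure twisted by `Ψ`. -/
structure TwLattice (Ψ : Matrix (Fin n) (Fin n) ℚ) where
  M : Submodule ℤ (QRoot n × QRoot n)
  plus_mem : ∀ i, C.phiP Ψ (sroot i) ∈ M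
  minus_mem : ∀ i, C.phiM Ψ (sroot i) ∈ M

/-- the lattice `M_*^Ψ = M_+^Ψ + M_-^Ψ` -/
def starLattice (Ψ : Matrix (Fin n) (Fin n) ℚ) (Mp Mm : TorusLattice n) : C.TwLattice Ψ where
  M := Mp.M.map (C.phiP Ψ) ⊔ Mm.M.map (C.phiM Ψ)
  plus_mem i := Submodule.mem_sup_left (Submodule.mem_map_of_mem (Mp.root_mem i))
  minus_mem i := Submodule.mem_sup_right (Submodule.mem_map_of_mem (Mm.root_mem i))

end CartanDatum

/-- The subalgebra of the twisted quantum double generated by the `E_i^Ψ`, the `F_i^Ψ` and the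
`K_y`, `y ∈ M`. -/
noncomputable def twSub (k : Type*) [Field k] {n : ℕ} (C : CartanDatum n)
    (Ψ : Matrix (Fin n) (Fin n) ℚ) (L : C.TwLattice Ψ) : Subalgebra (Kq k) (TwFull k C Ψ) :=
  Algebra.adjoin (Kq k)
    (Set.range (twE k C Ψ) ∪ Set.range (twF k C Ψ) ∪ (twDatum k C Ψ).Kt '' (L.M : Set _))

section
variable (k : Type*) [Field k] {n : ℕ} (C : CartanDatum n)
    (Ψ : Matrix (Fin n) (Fin n) ℚ) (L : C.TwLattice Ψ)

theorem twE_mem (i : Fin n) : twE k C Ψ i ∈ twSub k C Ψ L :=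
  Algebra.subset_adjoin (Or.inl (Or.inl ⟨i, rfl⟩))
theorem twF_mem (i : Fin n) : twF k C Ψ i ∈ twSub k C Ψ L :=
  Algebra.subset_adjoin (Or.inl (Or.inr ⟨i, rfl⟩))
theorem twK_mem {y : QRoot n × QRoot n} (hy : y ∈ L.M) :
    (twDatum k C Ψ).Kt y ∈ twSub k C Ψ L :=
  Algebra.subset_adjoin (Or.inr ⟨y, hy, rfl⟩)

theorem comul_twE (i : Fin n) : Coalgebra.comul (R := Kq k) (twE k C Ψ i)
    = twE k C Ψ i ⊗ₜ[Kq k] 1 + (twDatum k C Ψ).Kt (C.phiP Ψ (sroot i)) ⊗ₜ[Kq k] twE k C Ψ i := by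
  rw [twE, Bialgebra.comul_mul, QDatum.comul_E, QDatum.comul_Kt, mul_add,
    Algebra.TensorProduct.tmul_mul_tmul, Algebra.TensorProduct.tmul_mul_tmul, QDatum.Kt_mul,
    QDatum.Kt_mul]
  congr 2
  · rw [← QDatum.Kt_zero]; congr 1; simp [twDatum]
  · congr 1; simp [twDatum, CartanDatum.phiP_apply]

theorem comul_twF (i : Fin n) : Coalgebra.comul (R := Kq k) (twF k C Ψ i)
    = twF k C Ψ i ⊗ₜ[Kq k] (twDatum k C Ψ).Kt (-C.phiM Ψ (sroot i))
      + 1 ⊗ₜ[Kq k] twF k C Ψ i := by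
  rw [twF, Bialgebra.comul_mul, QDatum.comul_F, QDatum.comul_Kt, mul_add,
    Algebra.TensorProduct.tmul_mul_tmul, Algebra.TensorProduct.tmul_mul_tmul, QDatum.Kt_mul,
    QDatum.Kt_mul]
  congr 2
  · congr 1; simp [twDatum, CartanDatum.phiM_apply]
  · rw [← QDatum.Kt_zero]; congr 1; simp [twDatum]

theorem antipode_twE (i : Fin n) : HopfAlgebra.antipode (Kq k) (twE k C Ψ i)
    = -((twDatum k C Ψ).Kt (-C.phiP Ψ (sroot i)) * twE k C Ψ i) := by
  have h1 : HopfAlgebra.antipode (Kq k) ((twDatum k C Ψ).E i) = (twDatum k C Ψ).SE i :=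
    QDatum.S_E _ i
  have h2 : ∀ g, HopfAlgebra.antipode (Kq k) ((twDatum k C Ψ).Kt g) = (twDatum k C Ψ).Kt (-g) :=
    QDatum.S_Kt _
  rw [twE, HopfAlgebra.antipode_mul_antidistrib, h1, h2, QDatum.SE, neg_mul, ← mul_assoc,
    QDatum.Kt_mul, mul_assoc, QDatum.Kt_mul]
  have e1 : -(twDatum k C Ψ).u i + -(0, -C.psiM Ψ (sroot i)) = 0 := by simp [twDatum]
  rw [e1, QDatum.Kt_zero, mul_one]
  congr 3
  simp [twDatum, CartanDatum.phiP_apply]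

theorem antipode_twF (i : Fin n) : HopfAlgebra.antipode (Kq k) (twF k C Ψ i)
    = -(twF k C Ψ i * (twDatum k C Ψ).Kt (C.phiM Ψ (sroot i))) := by
  have h1 : HopfAlgebra.antipode (Kq k) ((twDatum k C Ψ).F i) = (twDatum k C Ψ).SF i :=
    QDatum.S_F _ i
  have h2 : ∀ g, HopfAlgebra.antipode (Kq k) ((twDatum k C Ψ).Kt g) = (twDatum k C Ψ).Kt (-g) :=
    QDatum.S_Kt _
  rw [twF, HopfAlgebra.antipode_mul_antidistrib, h1, h2, QDatum.SF, neg_mul, mul_assoc,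
    QDatum.Kt_mul]
  congr 2
  · congr 2; simp [twDatum]
  · congr 1; simp [twDatum, CartanDatum.phiM_apply, add_comm]

theorem twSub_isHopf : IsHopfSubalgebra (twSub k C Ψ L) := by
  have hK : ∀ y ∈ L.M, (twDatum k C Ψ).Kt y ∈ twSub k C Ψ L := fun y hy => twK_mem k C Ψ L hy
  apply IsHopfSubalgebra.of_adjoin
  · have ht : ∀ a b, a ∈ twSub k C Ψ L → b ∈ twSub k C Ψ L → a ⊗ₜ[Kq k] b ∈
        (Algebra.TensorProduct.map (twSub k C Ψ L).val (twSub k C Ψ L).val).range :=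
      fun a b ha hb => ⟨⟨a, ha⟩ ⊗ₜ ⟨b, hb⟩, by simp⟩
    rintro x ((⟨i, rfl⟩ | ⟨i, rfl⟩) | ⟨y, hy, rfl⟩)
    · rw [comul_twE]
      exact add_mem (ht _ _ (twE_mem k C Ψ L i) (one_mem _))
        (ht _ _ (hK _ (L.plus_mem i)) (twE_mem k C Ψ L i))
    · rw [comul_twF]
      exact add_mem (ht _ _ (twF_mem k C Ψ L i) (hK _ (neg_mem (L.minus_mem i))))
        (ht _ _ (one_mem _) (twF_mem k C Ψ L i))
    · rw [QDatum.comul_Kt]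
      exact ht _ _ (hK _ hy) (hK _ hy)
  · rintro x ((⟨i, rfl⟩ | ⟨i, rfl⟩) | ⟨y, hy, rfl⟩)
    · rw [antipode_twE]
      exact neg_mem (mul_mem (hK _ (neg_mem (L.plus_mem i))) (twE_mem k C Ψ L i))
    · rw [antipode_twF]
      exact neg_mem (mul_mem (twF_mem k C Ψ L i) (hK _ (L.minus_mem i)))
    · have h2 : HopfAlgebra.antipode (Kq k) ((twDatum k C Ψ).Kt y) = (twDatum k C Ψ).Kt (-y) :=
        QDatum.S_Kt _ y
      rw [h2]
      exact hK _ (neg_mem hy)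

end

/-- The twisted quantum group `Û^Ψ_{q, M}(g_D)` with torus `M`. -/
abbrev TwQUEA (k : Type*) [Field k] {n : ℕ} (C : CartanDatum n)
    (Ψ : Matrix (Fin n) (Fin n) ℚ) (L : C.TwLattice Ψ) : Type _ := twSub k C Ψ L

noncomputable instance (k : Type*) [Field k] {n : ℕ} (C : CartanDatum n)
    (Ψ : Matrix (Fin n) (Fin n) ℚ) (L : C.TwLattice Ψ) : HopfAlgebra (Kq k) (twSub k C Ψ L) :=
  (twSub_isHopf k C Ψ L).hopfAlgebra

section Cocycle
variable {K : Type*} [Field K] {H : Type*} [Ring H] [HopfAlgebra K H]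

/-- convolution product of linear maps from a coalgebra to an algebra -/
noncomputable def convProd {B T : Type*} [AddCommGroup B] [Module K B] [Coalgebra K B] [Ring T]
    [Algebra K T] (f g : B →ₗ[K] T) : B →ₗ[K] T :=
  LinearMap.mul' K T ∘ₗ TensorProduct.map f g ∘ₗ Coalgebra.comul

/-- `σ` is a normalized Hopf 2-cocycle on `H` with convolution inverse `σ'`. -/
structure IsTwoCocycle (σ σ' : H ⊗[K] H →ₗ[K] K) : Prop where
  conv_inv : convProd σ σ' = Coalgebra.counit
  inv_conv : convProd σ' σ = Coalgebra.counit
  one_left : ∀ a, σ (1 ⊗ₜ a) = Coalgebra.counit (R := K) a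
  one_right : ∀ a, σ (a ⊗ₜ 1) = Coalgebra.counit (R := K) a
  /-- `σ(a₁,b₁) σ(a₂b₂,c) = σ(b₁,c₁) σ(a,b₂c₂)` -/
  cocycle : ∀ a b c : H,
    convProd σ ((TensorProduct.curry σ).flip c ∘ₗ LinearMap.mul' K H) (a ⊗ₜ b)
      = convProd σ ((TensorProduct.curry σ) a ∘ₗ LinearMap.mul' K H) (b ⊗ₜ c)

/-- the deformed product `a ·_σ b = σ(a₁,b₁) a₂b₂ σ⁻¹(a₃,b₃)` -/
noncomputable def deformedMul (σ σ' : H ⊗[K] H →ₗ[K] K) : H ⊗[K] H →ₗ[K] H :=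
  convProd (convProd (Algebra.linearMap K H ∘ₗ σ) (LinearMap.mul' K H)) (Algebra.linearMap K H ∘ₗ σ')

/-- the deformed antipode `S_σ(a) = σ(a₁,S(a₂)) S(a₃) σ⁻¹(S(a₄),a₅)` -/
noncomputable def deformedAntipode (σ σ' : H ⊗[K] H →ₗ[K] K) : H →ₗ[K] H :=
  convProd (convProd
    (Algebra.linearMap K H ∘ₗ σ ∘ₗ (HopfAlgebra.antipode K).lTensor H ∘ₗ Coalgebra.comul)
    (HopfAlgebra.antipode K))
    (Algebra.linearMap K H ∘ₗ σ' ∘ₗ (HopfAlgebra.antipode K).rTensor H ∘ₗ Coalgebra.comul)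

end Cocycle

/-- The toral projection `E_i, F_i ↦ 0`, `K_γ ↦ G_γ`, `L_δ ↦ G_δ` onto the group algebra. -/
noncomputable def toralProj (k : Type*) [Field k] {n : ℕ} {C : CartanDatum n}
    (qm : QRatMultiparameter C) (Mp Mm : TorusLattice n) :
    MpQUEA k qm Mp Mm →ₐ[Kq k] AddMonoidAlgebra (Kq k) (QRoot n) :=
  QDatum.lift (D := mpDatum k qm Mp Mm) (e := fun _ => 0) (f := fun _ => 0)
    (t := fun g => AddMonoidAlgebra.single ((g.1 : QRoot n) + (g.2 : QRoot n)) 1)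
    { t_zero := by simp [AddMonoidAlgebra.one_def]
      t_add := fun g h => by
        rw [AddMonoidAlgebra.single_mul_single, one_mul]
        congr 1
        simp only [Prod.fst_add, Prod.snd_add, Submodule.coe_add]
        abel
      t_e := fun g j => by simp
      t_f := fun g j => by simp
      e_f := fun i j => by simp [mpDatum, TorusLattice.root]
      serre_e := fun i j _ => by simp [serreSum]
      serre_f := fun i j _ => by simp [serreSum] }

/-- the bilinear extension to the group algebra of the bicharacter `(G_γ, G_δ) ↦ q^{B(γ, δ)}` -/
noncomputable def bichar (k : Type*) [Field k] {n : ℕ} (B : Matrix (Fin n) (Fin n) ℚ) :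
    AddMonoidAlgebra (Kq k) (QRoot n) →ₗ[Kq k] AddMonoidAlgebra (Kq k) (QRoot n) →ₗ[Kq k] Kq k :=
  Finsupp.linearCombination (Kq k) (fun γ : QRoot n =>
    Finsupp.linearCombination (Kq k) (fun δ : QRoot n => qpow k (bil B γ δ))
      ∘ₗ (AddMonoidAlgebra.coeffLinearEquiv (Kq k)).toLinearMap)
    ∘ₗ (AddMonoidAlgebra.coeffLinearEquiv (Kq k)).toLinearMap

theorem bichar_single (k : Type*) [Field k] {n : ℕ} (B : Matrix (Fin n) (Fin n) ℚ)
    (γ δ : QRoot n) : bichar k B (AddMonoidAlgebra.single γ 1) (AddMonoidAlgebra.single δ 1)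
      = qpow k (bil B γ δ) := by
  simp [bichar]

/-- the toral form `σ` on the MpQUEA attached to a matrix `B`: on the torus it is
`(K_γ, K_δ) ↦ q^{B(γ, δ)}` -/
noncomputable def toralForm (k : Type*) [Field k] {n : ℕ} {C : CartanDatum n}
    (qm : QRatMultiparameter C) (Mp Mm : TorusLattice n) (B : Matrix (Fin n) (Fin n) ℚ) :
    MpQUEA k qm Mp Mm ⊗[Kq k] MpQUEA k qm Mp Mm →ₗ[Kq k] Kq k :=
  TensorProduct.lift (bichar k B) ∘ₗ
    TensorProduct.map (toralProj k qm Mp Mm).toLinearMap (toralProj k qm Mp Mm).toLinearMap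

/-- the matrix `-(DA + Aᵀ Ψ A)` of exponents of the cocycle corresponding to `Ψ` -/
def CartanDatum.cocycleMatrix {n : ℕ} (C : CartanDatum n) (Ψ : Matrix (Fin n) (Fin n) ℚ) :
    Matrix (Fin n) (Fin n) ℚ := -(C.DA + C.AQ.transpose * Ψ * C.AQ)

end Main

/-!
The theorem compares three realizations of one Hopf algebra, which differ by twists along the torus.

**The quantum group inside the quantum double.** Since `Ψ` is antisymmetric, `ψ_- = -ψ_+`, so that
`(γ, δ) ↦ (γ_+ + ψ_+(γ_+) - ψ_-(γ_-)) - (δ_- + ψ_-(δ_-) - ψ_+(δ_+))` is an injective map of tori, and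
it is bijective on `ℚQ × ℚQ`. Multiplying the generators of a presented algebra by torus elements
multiplies the iterated skew commutators that express the quantum Serre relations by torus elements
and shifts their parameters (`QDatum.isRep_twist`); hence the elements `q_i E_i^Ψ`, `F_i^Ψ`, `K_y`
of the quantum double satisfy the relations of the multiparameter quantum group, which gives a
homomorphism `mpToTw` whose image is the subalgebra in question. The same twist, undone, maps the
quantum double to the multiparameter quantum group with the largest torus, so injectivity reduces
to that of enlarging the torus. This avoids any PBW theorem: the algebra over the large torus acts
on the functions on that torus, with values in the algebra over the small one, that are equivariant
under the small torus, and an element of the small algebra is recovered from its action on one such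
function (`QDatum.injective_of_isRep_coind`).

**The cocycle deformation.** The toral projection gives two coactions on the multiparameter quantum
group, hence a bigrading (`HasBidegree`), and the coproduct matches inner degrees. Convolution with
a toral form multiplies a bihomogeneous element by a value of the bicharacter on its degrees.
Therefore the toral form is a cocycle (`isTwoCocycle_toralForm`), the deformed product of `a` and
`b` of bidegrees `(l, r)` and `(l', r')` is `q^{B(l, l') - B(r, r')} a b`, and the deformed antipode
is `q^{B(r, r) - B(l, l)} S`. It follows that the generators of the deformed algebra satisfy the
relations for the exponents `R + B - Bᵀ` (`isRep_deformed`); deforming by `-B` inverts the resulting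
map (`deformMap_deformMap`), which is an isomorphism of coalgebras because the scalars belonging to
inner degrees cancel. For the matrix of the cocycle attached to `Ψ` the new exponents are those of
the multiparameter corresponding to `Ψ`, and the first isomorphism applies.
-/

/-! ### Serre elements under rescaled multiplications -/

section AdProd
variable {K : Type*} [Field K] {T T' : Type*} [Ring T] [Algebra K T] [Ring T'] [Algebra K T']

/-- Transport of iterated skew commutators along a family of linear maps `L k` which are
multiplicative up to scalars: only the ratio of the scalars enters the parameters. -/
theorem adProd_transfer (L : ℕ → T →ₗ[K] T') {f f' a b : ℕ → K} {X Y : T} {X' Y' : T'}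
    (h0 : Y' = L 0 Y)
    (hl : ∀ k, X' * L k (adProd f X Y k) = a k • L (k + 1) (X * adProd f X Y k))
    (hr : ∀ k, L k (adProd f X Y k) * X' = b k • L (k + 1) (adProd f X Y k * X))
    (hab : ∀ k, a k * f k = f' k * b k) (m : ℕ) :
    adProd f' X' Y' m = (∏ k ∈ Finset.range m, a k) • L m (adProd f X Y m) := by
  induction m with
  | zero => simpa [adProd] using h0
  | succ m ih =>
    simp only [adProd]
    rw [ih, mul_smul_comm, smul_mul_assoc, hl, hr, map_sub, map_smul, Finset.prod_range_succ]
    simp only [smul_sub, smul_smul]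
    congr 2
    linear_combination -(∏ k ∈ Finset.range m, a k) * hab m

end AdProd

namespace QDatum
variable {K : Type*} [Field K] {n : ℕ} {G G' : Type*} [AddCommGroup G] [AddCommGroup G']

/-! ### Changing the generators by torus elements -/

section Twist
variable (D : QDatum K n G) (D' : QDatum K n G')

theorem mul_Kt {x : D.Alg} {a : AddChar G K} (ha : ∀ g, D.Kt g * x = a g • (x * D.Kt g)) (g : G) :
    x * D.Kt g = a (-g) • (D.Kt g * x) := by
  rw [ha, smul_smul, ← AddChar.map_add_eq_mul, neg_add_cancel, AddChar.map_zero_eq_one, one_smul]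

theorem E_mul_Kt (i : Fin n) (g : G) : D.E i * D.Kt g = D.chi i (-g) • (D.Kt g * D.E i) :=
  D.mul_Kt (fun g => D.Kt_E g i) g

theorem F_mul_Kt (i : Fin n) (g : G) : D.F i * D.Kt g = D.chi i g • (D.Kt g * D.F i) := by
  have := D.mul_Kt (a := (D.chi i)⁻¹) (fun g => D.Kt_F g i) g
  rwa [AddChar.inv_apply, neg_neg] at this

/-- Vanishing of iterated skew commutators of weight vectors persists when these are multiplied by
torus elements, after a shift of the parameter. -/
theorem adProd_Kt_mul {x y : D.Alg} {a b : AddChar G K}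
    (ha : ∀ g, D.Kt g * x = a g • (x * D.Kt g)) (hb : ∀ g, D.Kt g * y = b g • (y * D.Kt g))
    (r r' s s' p : K) (g h : G) (hs : s' = s * (b g * a (-h))) (m : ℕ)
    (h0 : adProd (fun k => s * p ^ k) x y m = 0) :
    adProd (fun k => s' * p ^ k) (r • (D.Kt g * x)) (r' • (D.Kt h * y)) m = 0 := by
  have inv : ∀ (c : AddChar G K) (g : G), c g * c (-g) = 1 := fun c g => by
    rw [← AddChar.map_add_eq_mul, add_neg_cancel, AddChar.map_zero_eq_one]
  have key := adProd_transfer (f := fun k => s * p ^ k) (f' := fun k => s' * p ^ k) (X := x) (Y := y)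
    (X' := r • (D.Kt g * x)) (Y' := r' • (D.Kt h * y))
    (fun k => r' • LinearMap.mulLeft K (D.Kt (k • g + h)))
    (a := fun k => r * a (-(k • g + h))) (b := fun k => r * (a (-g) ^ k * b (-g)))
    (by simp) (fun k => ?_) (fun k => ?_) (fun k => ?_) m
  · rw [key, h0, map_zero, smul_zero]
  · set V := adProd (fun k => s * p ^ k) x y k
    simp only [LinearMap.smul_apply, LinearMap.mulLeft_apply, smul_mul_assoc, mul_smul_comm]
    rw [mul_assoc (D.Kt g), ← mul_assoc x, D.mul_Kt ha, smul_mul_assoc, mul_smul_comm, mul_assoc,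
      ← mul_assoc (D.Kt g), Kt_mul, show g + (k • g + h) = (k + 1) • g + h by
        rw [succ_nsmul]; abel]
    simp only [smul_smul]
    congr 1; ring
  · have hV := D.Kt_adProd ha hb (fun k => s * p ^ k) (-g) k
    have hV' : adProd (fun k => s * p ^ k) x y k * D.Kt g
        = (a (-g) ^ k * b (-g)) • (D.Kt g * adProd (fun k => s * p ^ k) x y k) := by
      have h1 := congrArg (fun z => D.Kt g * z * D.Kt g) hV
      simp only [mul_smul_comm, smul_mul_assoc] at h1
      rw [← mul_assoc, Kt_mul, add_neg_cancel, Kt_zero, one_mul] at h1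
      rw [h1, mul_assoc, mul_assoc, Kt_mul, neg_add_cancel, Kt_zero, mul_one]
    set V := adProd (fun k => s * p ^ k) x y k
    simp only [LinearMap.smul_apply, LinearMap.mulLeft_apply, smul_mul_assoc, mul_smul_comm]
    rw [mul_assoc (D.Kt _), ← mul_assoc V, hV', smul_mul_assoc, mul_smul_comm, mul_assoc,
      ← mul_assoc (D.Kt _), Kt_mul, show k • g + h + g = (k + 1) • g + h by
        rw [succ_nsmul]; abel]
    simp only [smul_smul]
    congr 1; ring
  · rw [hs, neg_add, AddChar.map_add_eq_mul, ← smul_neg, AddChar.map_nsmul_eq_pow]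
    linear_combination -(s * p ^ k * r * a (-g) ^ k * a (-h)) * inv b g

/-- If two data differ by a multiplication of the generators by torus elements, the modified
generators of the first algebra satisfy the relations of the second one. -/
theorem isRep_twist (φ : G' →+ G) (x y : Fin n → G) (a : Fin n → K)
    (hchi : ∀ i g, D'.chi i g = D.chi i (φ g))
    (hxy : ∀ i j, D.chi i (-y j) = D.chi j (x i))
    (hc : ∀ i, a i * D.chi i (-y i) * D.c i = D'.c i)
    (hkap : ∀ i, φ (D'.kap i) = x i + y i + D.kap i)
    (hlam : ∀ i, φ (D'.lam i) = x i + y i + D.lam i)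
    (hm : ∀ i j, D'.m i j = D.m i j)
    (hsc : ∀ i j, D'.sc i j = D.sc i j * (D.chi j (x i) * D.chi i (-x j))) :
    D'.IsRep (fun i => a i • (D.Kt (x i) * D.E i)) (fun i => D.Kt (y i) * D.F i)
      (fun g => D.Kt (φ g)) where
  t_zero := by rw [map_zero, Kt_zero]
  t_add g h := by rw [Kt_mul, map_add]
  t_e g j := by
    rw [mul_smul_comm, ← mul_assoc, D.Kt_comm, mul_assoc, Kt_E, hchi, mul_smul_comm,
      smul_mul_assoc, smul_comm, mul_assoc]
  t_f g j := by
    rw [← mul_assoc, D.Kt_comm, mul_assoc, Kt_F, hchi, mul_smul_comm, map_neg φ, mul_assoc]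
  e_f i j := by
    have h1 : D.Kt (x i) * D.E i * (D.Kt (y j) * D.F j)
        = D.chi i (-y j) • (D.Kt (x i + y j) * (D.E i * D.F j)) := by
      rw [mul_assoc, ← mul_assoc (D.E i), E_mul_Kt, smul_mul_assoc, mul_smul_comm, mul_assoc,
        ← mul_assoc, Kt_mul]
    have h2 : D.Kt (y j) * D.F j * (D.Kt (x i) * D.E i)
        = D.chi i (-y j) • (D.Kt (x i + y j) * (D.F j * D.E i)) := by
      rw [mul_assoc, ← mul_assoc (D.F j), F_mul_Kt, smul_mul_assoc, mul_smul_comm, mul_assoc,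
        ← mul_assoc, Kt_mul, hxy, add_comm]
    rw [smul_mul_assoc, mul_smul_comm, h1, h2, ← smul_sub, ← smul_sub, ← mul_sub,
      D.isRep_self.e_f i j]
    split_ifs with hij
    · subst hij
      rw [mul_smul_comm, mul_sub, Kt_mul, Kt_mul, hkap, hlam, smul_smul, smul_smul, hc]
    · simp
  serre_e i j hij := by
    have h0 := D.isRep_self.serre_e i j hij
    rw [D.serreE_iff hij] at h0
    rw [D'.serreE_iff hij, hm, hsc i i, D.chi_neg, mul_inv_cancel₀ (D.chi_ne_zero _ _), mul_one]
    exact D.adProd_Kt_mul (fun g => D.Kt_E g i) (fun g => D.Kt_E g j) _ _ _ _ _ _ _ (hsc i j) _ h0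
  serre_f i j hij := by
    have h0 := D.isRep_self.serre_f i j hij
    rw [D.serreF_iff hij] at h0
    rw [D'.serreF_iff hij, hm, hsc i i, D.chi_neg, mul_inv_cancel₀ (D.chi_ne_zero _ _), mul_one]
    have := D.adProd_Kt_mul (a := (D.chi i)⁻¹) (b := (D.chi j)⁻¹) (fun g => D.Kt_F g i)
      (fun g => D.Kt_F g j) 1 1 (D.sc j i) (D'.sc j i) (D.sc i i) (y i) (y j) (by
        rw [hsc, AddChar.inv_apply, AddChar.inv_apply, neg_neg, hxy, chi_neg,
          ← hxy i j, chi_neg, inv_inv]) _ h0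
    simpa using this

end Twist

/-! ### Enlarging the torus -/

section Coinduced
variable (D : QDatum K n G) (D' : QDatum K n G')

/-- The coinduced module: functions on the large torus `G'` with values in the algebra over the
small torus `G` that are equivariant for the action of `G`. -/
def coind (φ : G →+ G') : Submodule K (G' → D.Alg) where
  carrier := {w | ∀ y g, w (y + φ g) = D.Kt g * w y}
  zero_mem' := fun _ _ => by simp
  add_mem' := fun {v w} hv hw y g => by simp [hv y g, hw y g, mul_add]
  smul_mem' := fun r w hw y g => by simp [hw y g]

variable {φ : G →+ G'}

/-- An element `x` of weight `c` acts on the coinduced module by `(x w)(y) = c(y) x w(y)`. -/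
noncomputable def coindOp (c : AddChar G' K) (x : D.Alg)
    (hx : ∀ g, D.Kt g * x = c (φ g) • (x * D.Kt g)) : Module.End K (D.coind φ) where
  toFun w := ⟨fun y => c y • (x * w.1 y), fun y g => by
    beta_reduce
    rw [w.2 y g, AddChar.map_add_eq_mul, mul_smul_comm, ← mul_assoc, ← mul_assoc, hx,
      smul_mul_assoc, smul_smul]⟩
  map_add' v w := Subtype.ext (funext fun y => by simp [mul_add])
  map_smul' r w := Subtype.ext (funext fun y => by simp [smul_comm r])

/-- The large torus acts on the coinduced module by translations. -/
noncomputable def coindShift (h : G') : Module.End K (D.coind φ) where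
  toFun w := ⟨fun y => w.1 (y + h), fun y g => by
    beta_reduce
    rw [add_right_comm]; exact w.2 (y + h) g⟩
  map_add' _ _ := rfl
  map_smul' _ _ := rfl

@[simp] theorem coindOp_apply (c : AddChar G' K) (x : D.Alg)
    (hx : ∀ g, D.Kt g * x = c (φ g) • (x * D.Kt g)) (w : D.coind φ) (y : G') :
    (D.coindOp c x hx w).1 y = c y • (x * w.1 y) := rfl

@[simp] theorem coindShift_apply (h : G') (w : D.coind φ) (y : G') :
    (D.coindShift h w).1 y = w.1 (y + h) := rfl

theorem adProd_coindOp (c c' : AddChar G' K) (x x' : D.Alg)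
    (hx : ∀ g, D.Kt g * x = c (φ g) • (x * D.Kt g))
    (hx' : ∀ g, D.Kt g * x' = c' (φ g) • (x' * D.Kt g)) (f : ℕ → K) (m : ℕ) :
    ∀ (w : D.coind φ) (y : G'),
    (adProd f (D.coindOp c x hx) (D.coindOp c' x' hx') m w).1 y
      = (c y ^ m * c' y) • (adProd f x x' m * w.1 y) := by
  induction m with
  | zero => intro w y; simp [adProd]
  | succ m ih =>
    intro w y
    simp only [adProd, LinearMap.sub_apply, LinearMap.smul_apply, Module.End.mul_apply,
      Submodule.coe_sub, Submodule.coe_smul, Pi.sub_apply, Pi.smul_apply, coindOp_apply, ih]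
    simp only [sub_mul, smul_sub, mul_smul_comm, smul_mul_assoc, smul_smul, mul_assoc]
    congr 2 <;> ring

/-- The algebra over the large torus acts on the module coinduced from the algebra over the small
torus. -/
theorem isRep_coind
    (hchi : ∀ i g, D.chi i g = D'.chi i (φ g)) (hc : ∀ i, D'.c i = D.c i)
    (hkap : ∀ i, D'.kap i = φ (D.kap i)) (hlam : ∀ i, D'.lam i = φ (D.lam i))
    (hm : ∀ i j, D'.m i j = D.m i j) (hsc : ∀ i j, D'.sc i j = D.sc i j) :
    D'.IsRep
      (fun i => D.coindOp (φ := φ) (D'.chi i) (D.E i) fun g => by rw [Kt_E, hchi])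
      (fun i => D.coindOp (φ := φ) (D'.chi i)⁻¹ (D.F i) fun g => by
        rw [Kt_F, hchi, map_neg, AddChar.inv_apply])
      D.coindShift where
  t_zero := LinearMap.ext fun w => Subtype.ext (funext fun y => by simp)
  t_add g h := LinearMap.ext fun w => Subtype.ext (funext fun y => by
    simp [add_assoc])
  t_e g j := LinearMap.ext fun w => Subtype.ext (funext fun y => by
    simp [AddChar.map_add_eq_mul, smul_smul, mul_comm])
  t_f g j := LinearMap.ext fun w => Subtype.ext (funext fun y => by
    simp [AddChar.map_add_eq_mul, smul_smul, mul_comm])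
  e_f i j := LinearMap.ext fun w => Subtype.ext (funext fun y => by
    have h := D.isRep_self.e_f i j
    have h1 := congrArg (· * w.1 y) h
    simp only [sub_mul, mul_assoc] at h1
    simp only [LinearMap.sub_apply, Module.End.mul_apply, Submodule.coe_sub, Pi.sub_apply,
      coindOp_apply, mul_smul_comm, smul_smul]
    rw [mul_comm ((D'.chi j)⁻¹ y), ← smul_sub, h1]
    split_ifs with hij
    · subst hij
      rw [AddChar.inv_apply, mul_comm, chi_neg_mul, one_smul, smul_mul_assoc, sub_mul, hkap, hlam,
        hc]
      simp only [LinearMap.smul_apply, LinearMap.sub_apply, Submodule.coe_smul, Submodule.coe_sub,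
        Pi.smul_apply, Pi.sub_apply, coindShift_apply]
      rw [w.2, w.2]
    · simp)
  serre_e i j hij := by
    have h0 := D.isRep_self.serre_e i j hij
    rw [D.serreE_iff hij] at h0
    rw [D'.serreE_iff hij, hm, hsc, hsc]
    exact LinearMap.ext fun w => Subtype.ext (funext fun y => by
      rw [adProd_coindOp, h0, zero_mul, smul_zero]; rfl)
  serre_f i j hij := by
    have h0 := D.isRep_self.serre_f i j hij
    rw [D.serreF_iff hij] at h0
    rw [D'.serreF_iff hij, hm, hsc, hsc]
    exact LinearMap.ext fun w => Subtype.ext (funext fun y => by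
      rw [adProd_coindOp, h0, zero_mul, smul_zero]; rfl)

open Classical in
/-- The equivariant function supported on the small torus with value `1` at `0`. -/
noncomputable def coindOne (hφ : Function.Injective φ) : D.coind φ :=
  ⟨fun y => if h : ∃ g, φ g = y then D.Kt h.choose else 0, fun y g => by
    beta_reduce
    by_cases h : ∃ g, φ g = y
    · have h' : ∃ g', φ g' = y + φ g := ⟨h.choose + g, by rw [map_add, h.choose_spec]⟩
      rw [dif_pos h, dif_pos h', Kt_mul]
      congr 1
      apply hφ
      rw [h'.choose_spec, map_add, h.choose_spec, add_comm]
    · have h' : ¬ ∃ g', φ g' = y + φ g := fun ⟨g', hg'⟩ => h ⟨g' - g, by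
        rw [map_sub, hg', add_sub_cancel_right]⟩
      rw [dif_neg h, dif_neg h', mul_zero]⟩

open Classical in
theorem coindOne_zero (hφ : Function.Injective φ) : (D.coindOne hφ).1 0 = 1 := by
  have h : ∃ g, φ g = 0 := ⟨0, map_zero φ⟩
  have h1 : h.choose = 0 := hφ (by rw [h.choose_spec, map_zero])
  change (if h : ∃ g, φ g = 0 then D.Kt h.choose else 0) = 1
  rw [dif_pos h, h1, Kt_zero]

/-- A homomorphism from the algebra over the small torus that is compatible with the standard
generators becomes left multiplication after evaluation at `0` in the coinduced module, hence is
injective. -/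
theorem injective_of_isRep_coind (hφ : Function.Injective φ)
    (hchi : ∀ i g, D.chi i g = D'.chi i (φ g)) (hc : ∀ i, D'.c i = D.c i)
    (hkap : ∀ i, D'.kap i = φ (D.kap i)) (hlam : ∀ i, D'.lam i = φ (D.lam i))
    (hm : ∀ i j, D'.m i j = D.m i j) (hsc : ∀ i j, D'.sc i j = D.sc i j)
    (ι : D.Alg →ₐ[K] D'.Alg) (hE : ∀ i, ι (D.E i) = D'.E i) (hF : ∀ i, ι (D.F i) = D'.F i)
    (hK : ∀ g, ι (D.Kt g) = D'.Kt (φ g)) : Function.Injective ι := by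
  have key : ∀ (x : D.Alg) (w : D.coind φ),
      (lift (D.isRep_coind D' hchi hc hkap hlam hm hsc) (ι x) w).1 0 = x * w.1 0 := by
    intro x
    induction x using induction with
    | hE i => intro w; simp [hE]
    | hF i => intro w; simp [hF]
    | hK g =>
      intro w
      have := w.2 0 g
      rw [zero_add] at this
      simp [hK, this]
    | hs r => intro w; simp [Algebra.algebraMap_eq_smul_one]
    | hadd x y hx hy => intro w; simp [hx, hy, add_mul]
    | hmul x y hx hy => intro w; simp [hx, hy, mul_assoc]
  intro x y hxy
  have h1 := key x (D.coindOne hφ)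
  rw [hxy, key, coindOne_zero, mul_one, mul_one] at h1
  exact h1.symm

end Coinduced
end QDatum

/-! ### The multiparameter quantum group inside the twisted quantum double -/

section Bil
variable {n : ℕ} (M N : Matrix (Fin n) (Fin n) ℚ) (x y : QRoot n)

theorem bil_mulVec_left : bil M (N.mulVec x) y = bil (N.transpose * M) x y := by
  rw [bil, bil, ← Matrix.mulVec_mulVec, Matrix.mulVec_transpose, dotProduct_comm (N.mulVec x),
    Matrix.dotProduct_mulVec, dotProduct_comm]

theorem bil_transpose : bil M.transpose x y = bil M y x := by
  rw [bil, bil, Matrix.mulVec_transpose, dotProduct_comm, ← Matrix.dotProduct_mulVec]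

theorem bil_add : bil (M + N) x y = bil M x y + bil N x y := by
  rw [bil, Matrix.add_mulVec, dotProduct_add]; rfl

theorem bil_neg : bil (-M) x y = -bil M x y := by
  rw [bil, Matrix.neg_mulVec, dotProduct_neg]; rfl

theorem bil_sub : bil (M - N) x y = bil M x y - bil N x y := by
  rw [sub_eq_add_neg, bil_add, bil_neg, sub_eq_add_neg]

theorem bil_neg_right : bil M x (-y) = -bil M x y := by
  rw [bil, Matrix.mulVec_neg, dotProduct_neg]; rfl

end Bil

/-- The lattice `ℚQ` itself. -/
def fullLattice (n : ℕ) : TorusLattice n := ⟨⊤, fun _ => trivial⟩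

namespace CartanDatum
variable {n : ℕ} (C : CartanDatum n) (Ψ : Matrix (Fin n) (Fin n) ℚ)

theorem DA_transpose : C.DA.transpose = C.DA := Matrix.ext fun i j => C.DA_symm j i

theorem form_psiP_left (x y : QRoot n) :
    C.form (C.psiP Ψ x) y = bil (C.AQ.transpose * Ψ.transpose * C.AQ) x y := by
  rw [form, psiP, Matrix.mulVecLin_apply, bil_mulVec_left]
  have h : C.DInvQ.transpose = C.DInvQ := Matrix.diagonal_transpose _
  rw [Matrix.transpose_mul, Matrix.transpose_mul, h, DA]
  simp only [Matrix.mul_assoc]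
  rw [← Matrix.mul_assoc C.DInvQ, DInvQ_mul_DQ, Matrix.one_mul]

theorem form_psiM_left (x y : QRoot n) :
    C.form (C.psiM Ψ x) y = bil (C.AQ.transpose * Ψ * C.AQ) x y := by
  have := C.form_psiP_left Ψ.transpose x y
  rwa [Matrix.transpose_transpose] at this

theorem bil_corresponds_left {qm : QRatMultiparameter C} (hq : qm.Corresponds Ψ) (x y : QRoot n) :
    bil qm.R x y = C.form x y + C.form (C.psiP Ψ x) y - C.form (C.psiM Ψ x) y := by
  rw [form_psiP_left, form_psiM_left, hq, Matrix.mul_sub, Matrix.sub_mul, bil_add, bil_sub, form]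
  ring

theorem bil_corresponds_right {qm : QRatMultiparameter C} (hq : qm.Corresponds Ψ)
    (x y : QRoot n) :
    bil qm.R x y = C.form y x - C.form (C.psiP Ψ y) x + C.form (C.psiM Ψ y) x := by
  have h : (C.AQ.transpose * Ψ.transpose * C.AQ).transpose = C.AQ.transpose * Ψ * C.AQ := by
    rw [Matrix.transpose_mul, Matrix.transpose_mul, Matrix.transpose_transpose,
      Matrix.transpose_transpose, Matrix.mul_assoc]
  have h1 : bil C.DA x y = C.form y x := by
    rw [form, ← bil_transpose, DA_transpose]
  have h2 : bil (C.AQ.transpose * Ψ.transpose * C.AQ) y x = bil (C.AQ.transpose * Ψ * C.AQ) x y := by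
    rw [← h, bil_transpose]
  have h3 : bil (C.AQ.transpose * Ψ * C.AQ) y x = bil (C.AQ.transpose * Ψ.transpose * C.AQ) x y := by
    rw [← h, bil_transpose]
  rw [form_psiP_left, form_psiM_left, hq, Matrix.mul_sub, Matrix.sub_mul, bil_add, bil_sub, h1,
    h2, h3]
  ring

variable {Ψ} in
theorem psiM_eq_neg (hΨ : Ψ.transpose = -Ψ) (x : QRoot n) : C.psiM Ψ x = -C.psiP Ψ x := by
  rw [psiM, psiP, hΨ, Matrix.mul_neg, Matrix.neg_mul, Matrix.mulVecLin_apply,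
    Matrix.mulVecLin_apply, Matrix.neg_mulVec]

variable {Ψ} in
theorem form_psiP_self (hΨ : Ψ.transpose = -Ψ) (i : Fin n) :
    C.form (C.psiP Ψ (sroot i)) (sroot i) = 0 := by
  have h := C.psi_swap Ψ i i
  rw [psiM_eq_neg C hΨ, form_neg] at h
  linarith

/-- The embedding `(γ, δ) ↦ (γ_+ + ψ_+(γ_+) - ψ_-(γ_-)) - (δ_- + ψ_-(δ_-) - ψ_+(δ_+))` of the torus
of the multiparameter quantum group into that of the quantum double. -/
def torusHom (Mp Mm : TorusLattice n) : Mp.M × Mm.M →+ QRoot n × QRoot n where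
  toFun g := C.phiP Ψ g.1 - C.phiM Ψ g.2
  map_zero' := by simp
  map_add' g h := by simp only [Prod.fst_add, Prod.snd_add, Submodule.coe_add, map_add]; abel

theorem torusHom_apply (Mp Mm : TorusLattice n) (g : Mp.M × Mm.M) :
    C.torusHom Ψ Mp Mm g = C.phiP Ψ g.1 - C.phiM Ψ g.2 := rfl

theorem torusHom_fst (Mp Mm : TorusLattice n) (g : Mp.M × Mm.M) :
    (C.torusHom Ψ Mp Mm g).1 = g.1 + C.psiP Ψ g.1 + C.psiP Ψ g.2 := by
  simp [torusHom_apply, phiP_apply, phiM_apply]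

theorem torusHom_snd (Mp Mm : TorusLattice n) (g : Mp.M × Mm.M) :
    (C.torusHom Ψ Mp Mm g).2 = -C.psiM Ψ g.1 - (g.2 + C.psiM Ψ g.2) := by
  simp [torusHom_apply, phiP_apply, phiM_apply]

variable {Ψ}

/-- The difference of the two components of `torusHom (γ, δ)` is `γ + δ`, because `ψ_- = -ψ_+`. -/
theorem torusHom_injective (hΨ : Ψ.transpose = -Ψ) (Mp Mm : TorusLattice n) :
    Function.Injective (C.torusHom Ψ Mp Mm) := by
  rw [injective_iff_map_eq_zero]
  intro g hg
  have h1 := C.torusHom_fst Ψ Mp Mm g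
  have h2 := C.torusHom_snd Ψ Mp Mm g
  rw [hg, Prod.fst_zero] at h1
  rw [hg, Prod.snd_zero, psiM_eq_neg C hΨ, psiM_eq_neg C hΨ] at h2
  have h3 : (g.1 : QRoot n) + g.2 = 0 := by
    linear_combination h2 - h1
  have h4 : C.psiP Ψ g.1 + C.psiP Ψ g.2 = 0 := by rw [← map_add, h3, map_zero]
  have h5 : (g.1 : QRoot n) = 0 := by linear_combination -h1 - h4
  rw [h5, zero_add] at h3
  exact Prod.ext (Subtype.ext h5) (Subtype.ext h3)

theorem torusHom_surjective (hΨ : Ψ.transpose = -Ψ) :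
    Function.Surjective (C.torusHom Ψ (fullLattice n) (fullLattice n)) := by
  rintro ⟨a, b⟩
  refine ⟨(⟨a - C.psiP Ψ (a - b), trivial⟩, ⟨C.psiP Ψ (a - b) - b, trivial⟩), ?_⟩
  apply Prod.ext
  · rw [torusHom_fst]
    simp only [map_sub]
    abel
  · rw [torusHom_snd]
    simp only [psiM_eq_neg C hΨ, map_sub]
    abel

end CartanDatum

section Embedding
variable (k : Type*) [Field k] {n : ℕ} {C : CartanDatum n} {Ψ : Matrix (Fin n) (Fin n) ℚ}
  {qm : QRatMultiparameter C}

theorem mpDatum_sc (qm : QRatMultiparameter C) (Mp Mm : TorusLattice n) (i j : Fin n) :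
    (mpDatum k qm Mp Mm).sc i j = qpow k (qm.R i j) := mpChi_root k qm Mp Mm i j

theorem twDatum_sc (C : CartanDatum n) (Ψ : Matrix (Fin n) (Fin n) ℚ) (i j : Fin n) :
    (twDatum k C Ψ).sc i j = qpow k (C.DA i j) := twChi_root k C Ψ i j

theorem mpChi_eq_twChi (hq : qm.Corresponds Ψ) (Mp Mm : TorusLattice n) (j : Fin n)
    (g : Mp.M × Mm.M) :
    mpChi k qm Mp Mm j g = twChi k C j (C.torusHom Ψ Mp Mm g) := by
  rw [mpChi_apply, ← Prod.mk.eta (p := C.torusHom Ψ Mp Mm g), twChi_apply,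
    C.bil_corresponds_left Ψ hq, C.bil_corresponds_right Ψ hq, C.torusHom_fst, C.torusHom_snd]
  simp only [sub_eq_add_neg, neg_add_rev, C.form_add, C.form_neg]
  congr 1
  ring

/-- The compatibility of the torus factors of `E_i^Ψ` and `F_j^Ψ` that lets the twisted generators
commute when `i ≠ j`. -/
theorem twChi_twist (C : CartanDatum n) (Ψ : Matrix (Fin n) (Fin n) ℚ) (i j : Fin n) :
    twChi k C i (-(C.psiP Ψ (sroot j), 0)) = twChi k C j (0, -C.psiM Ψ (sroot i)) := by
  rw [Prod.neg_mk, neg_zero, twChi_apply, twChi_apply, add_zero, zero_add, C.form_neg, C.form_neg,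
    C.psi_swap]

theorem twChi_psiP_self (hΨ : Ψ.transpose = -Ψ) (i : Fin n) :
    twChi k C i (-(C.psiP Ψ (sroot i), 0)) = 1 := by
  rw [Prod.neg_mk, neg_zero, twChi_apply, add_zero, C.form_neg, C.form_psiP_self hΨ, neg_zero,
    AddChar.map_zero_eq_one]

/-- `q_ii / (q_ii - 1) = q_i / (q_i - q_i⁻¹)`, since `q_ii = q_i²` -/
theorem mpDatum_c (qm : QRatMultiparameter C) (Mp Mm : TorusLattice n) (i : Fin n) :
    (mpDatum k qm Mp Mm).c i = qpow k (C.d i) * (twDatum k C Ψ).c i := by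
  have h0 := qpow_ne_zero k (C.d i : ℚ)
  have hd : (C.d i : ℚ) ≠ 0 := by exact_mod_cast (C.d_pos i).ne'
  have h1 : qm.ent k i i = qpow k (C.d i : ℚ) ^ 2 := by
    rw [QRatMultiparameter.ent, qm.R_diag, qpow_pow]; norm_cast
  have h2 := qpow_pow_ne_one k hd 2 two_pos
  change qm.ent k i i / (qm.ent k i i - 1) = _ * (_ - _)⁻¹
  rw [h1]
  have h3 : qpow k (C.d i : ℚ) ^ 2 - 1 ≠ 0 := sub_ne_zero.2 h2
  have h4 : qpow k (C.d i : ℚ) - (qpow k (C.d i : ℚ))⁻¹ ≠ 0 := by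
    intro h
    apply h3
    field_simp at h
    linear_combination h
  field_simp

/-- The twisted generators of the quantum double satisfy the relations of the multiparameter quantum
group. -/
theorem isRep_tw (hΨ : Ψ.transpose = -Ψ) (hq : qm.Corresponds Ψ) (Mp Mm : TorusLattice n) :
    (mpDatum k qm Mp Mm).IsRep (fun i => qpow k (C.d i) • twE k C Ψ i) (twF k C Ψ)
      (fun g => (twDatum k C Ψ).Kt (C.torusHom Ψ Mp Mm g)) :=
  (twDatum k C Ψ).isRep_twist (mpDatum k qm Mp Mm) (C.torusHom Ψ Mp Mm)
    (fun i => (0, -C.psiM Ψ (sroot i))) (fun i => (C.psiP Ψ (sroot i), 0))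
    (fun i => qpow k (C.d i))
    (mpChi_eq_twChi k hq Mp Mm) (twChi_twist k C Ψ)
    (fun i => by
      rw [mpDatum_c k (Ψ := Ψ)]
      change _ * twChi k C i _ * _ = _
      rw [twChi_psiP_self k hΨ, mul_one])
    (fun i => Prod.ext (by
      simp [C.torusHom_fst, mpDatum, twDatum, TorusLattice.root, add_comm]) (by
      simp [C.torusHom_snd, mpDatum, twDatum, TorusLattice.root]))
    (fun i => Prod.ext (by
      simp [C.torusHom_fst, mpDatum, twDatum, TorusLattice.root]) (by
      simp [C.torusHom_snd, mpDatum, twDatum, TorusLattice.root, sub_eq_add_neg, add_comm]))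
    (fun _ _ => rfl)
    (fun i j => by
      rw [mpDatum_sc, twDatum_sc]
      change _ = _ * (twChi k C j _ * twChi k C i (-(0, -C.psiM Ψ (sroot j))))
      rw [Prod.neg_mk, neg_neg, neg_zero, twChi_apply, twChi_apply, ← AddChar.map_add_eq_mul,
        ← AddChar.map_add_eq_mul, ← bil_sroot qm.R, C.bil_corresponds_left Ψ hq, C.psi_swap,
        zero_add, zero_add, C.form_neg, C.form_sroot]
      congr 1
      ring)

/-- The homomorphism from the multiparameter quantum group to the twisted quantum double. -/
noncomputable def mpToTw (hΨ : Ψ.transpose = -Ψ) (hq : qm.Corresponds Ψ)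
    (Mp Mm : TorusLattice n) : MpQUEA k qm Mp Mm →ₐ[Kq k] TwFull k C Ψ :=
  QDatum.lift (isRep_tw k hΨ hq Mp Mm)

/-- The inverse of the embedding of tori, for the largest lattices. -/
noncomputable def torusInv (hΨ : Ψ.transpose = -Ψ) :
    QRoot n × QRoot n →+ (fullLattice n).M × (fullLattice n).M :=
  (AddEquiv.ofBijective (C.torusHom Ψ (fullLattice n) (fullLattice n))
    ⟨C.torusHom_injective hΨ _ _, C.torusHom_surjective hΨ⟩).symm.toAddMonoidHom

theorem torusHom_torusInv (hΨ : Ψ.transpose = -Ψ) (g : QRoot n × QRoot n) :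
    C.torusHom Ψ _ _ (torusInv (C := C) hΨ g) = g :=
  (AddEquiv.ofBijective (C.torusHom Ψ (fullLattice n) (fullLattice n))
    ⟨C.torusHom_injective hΨ _ _, C.torusHom_surjective hΨ⟩).apply_symm_apply g

theorem torusInv_torusHom (hΨ : Ψ.transpose = -Ψ) (g : (fullLattice n).M × (fullLattice n).M) :
    torusInv (C := C) hΨ (C.torusHom Ψ _ _ g) = g :=
  C.torusHom_injective hΨ _ _ (torusHom_torusInv hΨ _)

/-- Conversely, over the largest torus the relations of the quantum double hold for suitably twisted
generators of the multiparameter quantum group. -/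
theorem isRep_full (hΨ : Ψ.transpose = -Ψ) (hq : qm.Corresponds Ψ) :
    (twDatum k C Ψ).IsRep
      (fun i => qpow k (-(C.d i : ℚ)) • ((mpDatum k qm (fullLattice n) (fullLattice n)).Kt
        (torusInv (C := C) hΨ (0, C.psiM Ψ (sroot i))) * (mpDatum k qm _ _).E i))
      (fun i => (mpDatum k qm (fullLattice n) (fullLattice n)).Kt
        (torusInv (C := C) hΨ (-C.psiP Ψ (sroot i), 0)) * (mpDatum k qm _ _).F i)
      (fun g => (mpDatum k qm (fullLattice n) (fullLattice n)).Kt (torusInv (C := C) hΨ g)) := by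
  have hchi : ∀ i g, mpChi k qm (fullLattice n) (fullLattice n) i (torusInv (C := C) hΨ g)
      = twChi k C i g := fun i g => by rw [mpChi_eq_twChi k hq, torusHom_torusInv hΨ]
  have hchi' : ∀ i g, mpChi k qm (fullLattice n) (fullLattice n) i (-torusInv (C := C) hΨ g)
      = twChi k C i (-g) := fun i g => by rw [← map_neg, hchi]
  refine (mpDatum k qm (fullLattice n) (fullLattice n)).isRep_twist (twDatum k C Ψ)
    (torusInv (C := C) hΨ) (fun i => torusInv (C := C) hΨ (0, C.psiM Ψ (sroot i)))
    (fun i => torusInv (C := C) hΨ (-C.psiP Ψ (sroot i), 0)) (fun i => qpow k (-(C.d i : ℚ)))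
    (fun i g => (hchi i g).symm) (fun i j => ?_) (fun i => ?_) (fun i => ?_) (fun i => ?_)
    (fun _ _ => rfl) (fun i j => ?_)
  · have := twChi_twist k C Ψ i j
    refine (hchi' _ _).trans (Eq.trans ?_ (hchi _ _).symm)
    rw [Prod.neg_mk, twChi_apply, twChi_apply, neg_neg, neg_zero, add_zero, zero_add, C.psi_swap]
  · refine (congrArg (_ * · * _) (hchi' _ _)).trans ?_
    rw [mpDatum_c k (Ψ := Ψ), Prod.neg_mk, twChi_apply, neg_neg, neg_zero, add_zero,
      C.form_psiP_self hΨ, AddChar.map_zero_eq_one, mul_one, ← mul_assoc,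
      ← AddChar.map_add_eq_mul, neg_add_cancel, AddChar.map_zero_eq_one, one_mul]
  · apply C.torusHom_injective hΨ
    simp only [map_add, torusHom_torusInv]
    refine Prod.ext ?_ ?_
    · simp [C.torusHom_fst, mpDatum, twDatum, TorusLattice.root, add_comm]
    · simp [C.torusHom_snd, mpDatum, twDatum, TorusLattice.root]
  · apply C.torusHom_injective hΨ
    simp only [map_add, torusHom_torusInv]
    refine Prod.ext ?_ ?_
    · simp [C.torusHom_fst, mpDatum, twDatum, TorusLattice.root]
    · simp [C.torusHom_snd, mpDatum, twDatum, TorusLattice.root, sub_eq_add_neg, add_comm]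
  · rw [mpDatum_sc, twDatum_sc]
    refine Eq.trans ?_ (congrArg (_ * ·) (congrArg₂ (· * ·) (hchi _ _) (hchi' _ _)).symm)
    rw [Prod.neg_mk, neg_zero, twChi_apply, twChi_apply, ← AddChar.map_add_eq_mul,
      ← AddChar.map_add_eq_mul, ← bil_sroot qm.R, C.bil_corresponds_left Ψ hq, C.psi_swap,
      zero_add, zero_add, C.form_neg, C.form_sroot]
    congr 1
    ring

/-- The inclusion of tori. -/
def latticeIncl (Mp Mm : TorusLattice n) :
    Mp.M × Mm.M →+ (fullLattice n).M × (fullLattice n).M where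
  toFun g := (⟨g.1, trivial⟩, ⟨g.2, trivial⟩)
  map_zero' := rfl
  map_add' _ _ := rfl

theorem torusHom_latticeIncl (Mp Mm : TorusLattice n) (g : Mp.M × Mm.M) :
    C.torusHom Ψ _ _ (latticeIncl Mp Mm g) = C.torusHom Ψ Mp Mm g := rfl

/-- Undoing the twist leads into the multiparameter quantum group with the largest torus, and the
composite is the map induced by the inclusion of tori, which is injective. -/
theorem mpToTw_injective (hΨ : Ψ.transpose = -Ψ) (hq : qm.Corresponds Ψ)
    (Mp Mm : TorusLattice n) : Function.Injective (mpToTw k hΨ hq Mp Mm) := by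
  have hinj : Function.Injective (latticeIncl Mp Mm) := fun g h hgh => by
    have h1 := congrArg (fun p => (p.1 : QRoot n)) hgh
    have h2 := congrArg (fun p => (p.2 : QRoot n)) hgh
    exact Prod.ext (Subtype.ext h1) (Subtype.ext h2)
  refine Function.Injective.of_comp (f := QDatum.lift (isRep_full k hΨ hq)) ?_
  refine QDatum.injective_of_isRep_coind (mpDatum k qm Mp Mm) (mpDatum k qm _ _) hinj
    (fun _ _ => rfl) (fun _ => rfl) (fun _ => rfl) (fun _ => rfl) (fun _ _ => rfl)
    (fun i j => by rw [mpDatum_sc, mpDatum_sc])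
    ((QDatum.lift (isRep_full k hΨ hq)).comp (mpToTw k hΨ hq Mp Mm))
    (fun i => ?_) (fun i => ?_) (fun g => ?_)
  · rw [AlgHom.comp_apply, mpToTw, QDatum.lift_E, twE, map_smul, map_mul, QDatum.lift_E,
      QDatum.lift_Kt, mul_smul_comm, smul_smul, ← AddChar.map_add_eq_mul, add_neg_cancel,
      AddChar.map_zero_eq_one, one_smul, ← mul_assoc, QDatum.Kt_mul, ← map_add, Prod.mk_add_mk,
      neg_add_cancel, zero_add, Prod.mk_zero_zero, map_zero, QDatum.Kt_zero, one_mul]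
  · rw [AlgHom.comp_apply, mpToTw, QDatum.lift_F, twF, map_mul, QDatum.lift_F,
      QDatum.lift_Kt, ← mul_assoc, QDatum.Kt_mul, ← map_add, Prod.mk_add_mk,
      add_neg_cancel, zero_add, Prod.mk_zero_zero, map_zero, QDatum.Kt_zero, one_mul]
  · rw [AlgHom.comp_apply, mpToTw, QDatum.lift_Kt, QDatum.lift_Kt, ← torusHom_latticeIncl,
      torusInv_torusHom]

theorem mpToTw_range (hΨ : Ψ.transpose = -Ψ) (hq : qm.Corresponds Ψ) (Mp Mm : TorusLattice n) :
    (mpToTw k hΨ hq Mp Mm).range = twSub k C Ψ (C.starLattice Ψ Mp Mm) := by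
  have hK : ∀ g : Mp.M × Mm.M, C.torusHom Ψ Mp Mm g ∈ (C.starLattice Ψ Mp Mm).M := fun g =>
    sub_mem (Submodule.mem_sup_left (Submodule.mem_map_of_mem g.1.2))
      (Submodule.mem_sup_right (Submodule.mem_map_of_mem g.2.2))
  apply le_antisymm
  · rintro _ ⟨x, rfl⟩
    change mpToTw k hΨ hq Mp Mm x ∈ _
    induction x using QDatum.induction with
    | hE i =>
      rw [mpToTw, QDatum.lift_E]
      exact Subalgebra.smul_mem _ (twE_mem k C Ψ _ i) _
    | hF i => rw [mpToTw, QDatum.lift_F]; exact twF_mem k C Ψ _ i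
    | hK g => rw [mpToTw, QDatum.lift_Kt]; exact twK_mem k C Ψ _ (hK g)
    | hs r => rw [AlgHom.commutes]; exact Subalgebra.algebraMap_mem _ r
    | hadd x y hx hy => rw [map_add]; exact add_mem hx hy
    | hmul x y hx hy => rw [map_mul]; exact mul_mem hx hy
  · refine Algebra.adjoin_le ?_
    rintro x ((⟨i, rfl⟩ | ⟨i, rfl⟩) | ⟨y, hy, rfl⟩)
    · refine ⟨qpow k (-(C.d i : ℚ)) • (mpDatum k qm Mp Mm).E i, ?_⟩
      change mpToTw k hΨ hq Mp Mm _ = _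
      rw [map_smul, mpToTw, QDatum.lift_E, smul_smul, ← AddChar.map_add_eq_mul, neg_add_cancel,
        AddChar.map_zero_eq_one, one_smul]
    · exact ⟨(mpDatum k qm Mp Mm).F i, QDatum.lift_F _ i⟩
    · obtain ⟨_, ⟨a, ha, rfl⟩, _, ⟨b, hb, rfl⟩, rfl⟩ := Submodule.mem_sup.1 hy
      refine ⟨(mpDatum k qm Mp Mm).Kt (⟨a, ha⟩, ⟨-b, neg_mem hb⟩), ?_⟩
      refine (QDatum.lift_Kt (isRep_tw k hΨ hq Mp Mm) _).trans ?_
      rw [C.torusHom_apply, map_neg, sub_neg_eq_add]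

/-- The algebra isomorphism of the multiparameter quantum group with its image. -/
noncomputable def mpAlgEquiv (hΨ : Ψ.transpose = -Ψ) (hq : qm.Corresponds Ψ)
    (Mp Mm : TorusLattice n) :
    MpQUEA k qm Mp Mm ≃ₐ[Kq k] TwQUEA k C Ψ (C.starLattice Ψ Mp Mm) :=
  (AlgEquiv.ofInjective _ (mpToTw_injective k hΨ hq Mp Mm)).trans
    (Subalgebra.equivOfEq _ _ (mpToTw_range k hΨ hq Mp Mm))

theorem coe_twSub_comul (C : CartanDatum n) (Ψ : Matrix (Fin n) (Fin n) ℚ) (L : C.TwLattice Ψ)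
    (x : twSub k C Ψ L) :
    Algebra.TensorProduct.map (twSub k C Ψ L).val (twSub k C Ψ L).val
      (Coalgebra.comul (R := Kq k) x) = Coalgebra.comul (R := Kq k) (x : TwFull k C Ψ) :=
  (twSub_isHopf k C Ψ L).map_comul x

theorem mpToTw_comul (hΨ : Ψ.transpose = -Ψ) (hq : qm.Corresponds Ψ)
    (Mp Mm : TorusLattice n) :
    (Algebra.TensorProduct.map (mpToTw k hΨ hq Mp Mm) (mpToTw k hΨ hq Mp Mm)).comp
      (Bialgebra.comulAlgHom (Kq k) (MpQUEA k qm Mp Mm))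
      = (Bialgebra.comulAlgHom (Kq k) (TwFull k C Ψ)).comp (mpToTw k hΨ hq Mp Mm) := by
  have hE : ∀ i, mpToTw k hΨ hq Mp Mm ((mpDatum k qm Mp Mm).E i) = qpow k (C.d i) • twE k C Ψ i :=
    fun i => QDatum.lift_E _ i
  have hF : ∀ i, mpToTw k hΨ hq Mp Mm ((mpDatum k qm Mp Mm).F i) = twF k C Ψ i :=
    fun i => QDatum.lift_F _ i
  have hK : ∀ g, mpToTw k hΨ hq Mp Mm ((mpDatum k qm Mp Mm).Kt g)
      = (twDatum k C Ψ).Kt (C.torusHom Ψ Mp Mm g) := fun g => QDatum.lift_Kt _ g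
  apply QDatum.hom_ext
  · intro i
    simp only [AlgHom.comp_apply, Bialgebra.comulAlgHom_apply, QDatum.comul_E, map_add,
      Algebra.TensorProduct.map_tmul, hE, hK, map_smul, comul_twE, smul_add,
      TensorProduct.tmul_smul, TensorProduct.smul_tmul']
    have h1 : C.torusHom Ψ Mp Mm ((mpDatum k qm Mp Mm).v i) = C.phiP Ψ (sroot i) := by
      simp [mpDatum, C.torusHom_apply, TorusLattice.root]
    have h2 : C.torusHom Ψ Mp Mm ((mpDatum k qm Mp Mm).u i) = 0 := map_zero _
    rw [h1, h2, QDatum.Kt_zero]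
  · intro i
    simp only [AlgHom.comp_apply, Bialgebra.comulAlgHom_apply, QDatum.comul_F, map_add,
      Algebra.TensorProduct.map_tmul, hF, hK, comul_twF]
    have h1 : C.torusHom Ψ Mp Mm ((mpDatum k qm Mp Mm).w i) = -C.phiM Ψ (sroot i) := by
      simp [mpDatum, C.torusHom_apply, TorusLattice.root]
    have h2 : C.torusHom Ψ Mp Mm ((mpDatum k qm Mp Mm).z i) = 0 := map_zero _
    rw [h1, h2, QDatum.Kt_zero]
  · intro g
    simp only [AlgHom.comp_apply, Bialgebra.comulAlgHom_apply, QDatum.comul_Kt,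
      Algebra.TensorProduct.map_tmul, hK]

theorem mpToTw_counit (hΨ : Ψ.transpose = -Ψ) (hq : qm.Corresponds Ψ)
    (Mp Mm : TorusLattice n) :
    (Bialgebra.counitAlgHom (Kq k) (TwFull k C Ψ)).comp (mpToTw k hΨ hq Mp Mm)
      = Bialgebra.counitAlgHom (Kq k) (MpQUEA k qm Mp Mm) := by
  apply QDatum.hom_ext
  · intro i
    simp [mpToTw, twE, QDatum.counit_E]
  · intro i
    simp [mpToTw, twF, QDatum.counit_F]
  · intro g
    simp [mpToTw, QDatum.counit_Kt]

/-- The isomorphism of Hopf algebras from the multiparameter quantum group to the twisted one. -/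
noncomputable def mpBialgEquiv (hΨ : Ψ.transpose = -Ψ) (hq : qm.Corresponds Ψ)
    (Mp Mm : TorusLattice n) :
    MpQUEA k qm Mp Mm ≃ₐc[Kq k] TwQUEA k C Ψ (C.starLattice Ψ Mp Mm) :=
  BialgEquiv.ofAlgEquiv (mpAlgEquiv k hΨ hq Mp Mm)
    (by
      apply AlgHom.ext
      intro x
      exact AlgHom.congr_fun (mpToTw_counit k hΨ hq Mp Mm) x)
    (by
      apply AlgHom.ext
      intro x
      apply IsHopfSubalgebra.map_inj
      have h1 := AlgHom.congr_fun (mpToTw_comul k hΨ hq Mp Mm) x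
      refine Eq.trans ?_ (h1.trans ?_)
      · simp only [AlgHom.comp_apply, ← AlgHom.comp_apply (Algebra.TensorProduct.map _ _)
          (Algebra.TensorProduct.map _ _), ← Algebra.TensorProduct.map_comp]
        rfl
      · exact (coe_twSub_comul k C Ψ _ (mpAlgEquiv k hΨ hq Mp Mm x)).symm)

end Embedding

/-! ### The bigrading by the toral coactions -/

section Bidegree
open TensorProduct
variable {k : Type*} [Field k] {n : ℕ} {C : CartanDatum n} {qm : QRatMultiparameter C}
  {Mp Mm : TorusLattice n}

variable (k qm Mp Mm) in
/-- Elements of bidegree `(l, r)`, where `l` and `r` are the weights for the left and right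
coactions of the group algebra of `ℚQ` through the toral projection: `E_i` has bidegree
`(α_i, 0)`, `F_i` has bidegree `(0, α_i)` and `K_γ L_δ` has bidegree `(γ + δ, γ + δ)`. -/
inductive HasBidegree : MpQUEA k qm Mp Mm → QRoot n → QRoot n → Prop
  | one : HasBidegree 1 0 0
  | E (i : Fin n) : HasBidegree ((mpDatum k qm Mp Mm).E i) (sroot i) 0
  | F (i : Fin n) : HasBidegree ((mpDatum k qm Mp Mm).F i) 0 (sroot i)
  | Kt (g : Mp.M × Mm.M) : HasBidegree ((mpDatum k qm Mp Mm).Kt g)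
      ((g.1 : QRoot n) + g.2) ((g.1 : QRoot n) + g.2)
  | mul {a b l r l' r'} : HasBidegree a l r → HasBidegree b l' r' →
      HasBidegree (a * b) (l + l') (r + r')
  | smul {a l r} (c : Kq k) : HasBidegree a l r → HasBidegree (c • a) l r
  | add {a b l r} : HasBidegree a l r → HasBidegree b l r → HasBidegree (a + b) l r

namespace HasBidegree

theorem neg {a : MpQUEA k qm Mp Mm} {l r : QRoot n} (h : HasBidegree k qm Mp Mm a l r) :
    HasBidegree k qm Mp Mm (-a) l r := by
  rw [← neg_one_smul (Kq k)]; exact h.smul _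

theorem sub {a b : MpQUEA k qm Mp Mm} {l r : QRoot n} (h : HasBidegree k qm Mp Mm a l r)
    (h' : HasBidegree k qm Mp Mm b l r) : HasBidegree k qm Mp Mm (a - b) l r := by
  rw [sub_eq_add_neg]; exact h.add h'.neg

theorem of_eq {a : MpQUEA k qm Mp Mm} {l r l' r' : QRoot n}
    (h : HasBidegree k qm Mp Mm a l r) (hl : l = l') (hr : r = r') :
    HasBidegree k qm Mp Mm a l' r' := hl ▸ hr ▸ h

/-- The algebra is spanned by bihomogeneous elements. -/
theorem induction {P : MpQUEA k qm Mp Mm → Prop}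
    (h : ∀ a l r, HasBidegree k qm Mp Mm a l r → P a)
    (hadd : ∀ a b, P a → P b → P (a + b)) (x : MpQUEA k qm Mp Mm) : P x := by
  have hmem : x ∈ AddSubmonoid.closure {a | ∃ l r, HasBidegree k qm Mp Mm a l r} := by
    induction x using QDatum.induction with
    | hE i => exact AddSubmonoid.subset_closure ⟨_, _, .E i⟩
    | hF i => exact AddSubmonoid.subset_closure ⟨_, _, .F i⟩
    | hK g => exact AddSubmonoid.subset_closure ⟨_, _, .Kt g⟩
    | hs c =>
      rw [Algebra.algebraMap_eq_smul_one]
      exact AddSubmonoid.subset_closure ⟨_, _, .smul c .one⟩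
    | hadd x y hx hy => exact add_mem hx hy
    | hmul x y hx hy =>
      induction hx using AddSubmonoid.closure_induction with
      | mem a ha =>
        obtain ⟨l, r, ha⟩ := ha
        induction hy using AddSubmonoid.closure_induction with
        | mem b hb =>
          obtain ⟨l', r', hb⟩ := hb
          exact AddSubmonoid.subset_closure ⟨_, _, ha.mul hb⟩
        | zero => rw [mul_zero]; exact zero_mem _
        | add b b' _ _ h1 h2 => rw [mul_add]; exact add_mem h1 h2
      | zero => rw [zero_mul]; exact zero_mem _
      | add a a' _ _ h1 h2 => rw [add_mul]; exact add_mem h1 h2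
  induction hmem using AddSubmonoid.closure_induction with
  | mem a ha => obtain ⟨l, r, ha⟩ := ha; exact h a l r ha
  | zero => rw [← zero_smul (Kq k) (1 : MpQUEA k qm Mp Mm)]; exact h _ _ _ (.smul 0 .one)
  | add a b _ _ ha hb => exact hadd a b ha hb

theorem toralProj_left {a : MpQUEA k qm Mp Mm} {l r : QRoot n}
    (h : HasBidegree k qm Mp Mm a l r) :
    toralProj k qm Mp Mm a
      = Coalgebra.counit (R := Kq k) a • AddMonoidAlgebra.single l (1 : Kq k) := by
  induction h with
  | one => simp [AddMonoidAlgebra.one_def]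
  | E i => simp [toralProj, QDatum.counit_E]
  | F i => simp [toralProj, QDatum.counit_F]
  | Kt g => simp [toralProj, QDatum.counit_Kt]
  | mul _ _ h1 h2 => simp [h1, h2, AddMonoidAlgebra.single_mul_single]
  | smul c _ h => simp [h]
  | add _ _ h1 h2 => rw [map_add, map_add, h1, h2, add_smul]

theorem toralProj_right {a : MpQUEA k qm Mp Mm} {l r : QRoot n}
    (h : HasBidegree k qm Mp Mm a l r) :
    toralProj k qm Mp Mm a
      = Coalgebra.counit (R := Kq k) a • AddMonoidAlgebra.single r (1 : Kq k) := by
  induction h with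
  | one => simp [AddMonoidAlgebra.one_def]
  | E i => simp [toralProj, QDatum.counit_E]
  | F i => simp [toralProj, QDatum.counit_F]
  | Kt g => simp [toralProj, QDatum.counit_Kt]
  | mul _ _ h1 h2 => simp [h1, h2, AddMonoidAlgebra.single_mul_single]
  | smul c _ h => simp [h]
  | add _ _ h1 h2 => rw [map_add, map_add, h1, h2, add_smul]

/-- The toral projection of an element of bidegree `(l, r)` is a multiple both of `G_l` and of `G_r`,
so the degrees agree unless the counit vanishes. -/
theorem counit_eq_zero_or_eq {a : MpQUEA k qm Mp Mm} {l r : QRoot n}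
    (h : HasBidegree k qm Mp Mm a l r) : Coalgebra.counit (R := Kq k) a = 0 ∨ l = r := by
  by_cases hlr : l = r
  · exact Or.inr hlr
  · left
    have h1 := h.toralProj_left.symm.trans h.toralProj_right
    have h2 := congrArg (fun x => AddMonoidAlgebra.coeff x l) h1
    simpa [Finsupp.single_apply, hlr, Ne.symm hlr] using h2

variable (k qm Mp Mm) in
/-- The span of the products of elements with bidegrees `(l, s)` and `(s, r)`. -/
noncomputable def splitSpan (l r : QRoot n) :
    Submodule (Kq k) (MpQUEA k qm Mp Mm ⊗[Kq k] MpQUEA k qm Mp Mm) :=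
  Submodule.span (Kq k) {t | ∃ s b c, HasBidegree k qm Mp Mm b l s ∧
    HasBidegree k qm Mp Mm c s r ∧ b ⊗ₜ[Kq k] c = t}

theorem tmul_mem_splitSpan {b c : MpQUEA k qm Mp Mm} {l s r : QRoot n}
    (hb : HasBidegree k qm Mp Mm b l s) (hc : HasBidegree k qm Mp Mm c s r) :
    b ⊗ₜ[Kq k] c ∈ splitSpan k qm Mp Mm l r :=
  Submodule.subset_span ⟨s, b, c, hb, hc, rfl⟩

theorem mul_mem_splitSpan {t t' : MpQUEA k qm Mp Mm ⊗[Kq k] MpQUEA k qm Mp Mm}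
    {l r l' r' : QRoot n} (h : t ∈ splitSpan k qm Mp Mm l r) (h' : t' ∈ splitSpan k qm Mp Mm l' r') :
    t * t' ∈ splitSpan k qm Mp Mm (l + l') (r + r') := by
  induction h using Submodule.span_induction with
  | mem t ht =>
    obtain ⟨s, b, c, hb, hc, rfl⟩ := ht
    induction h' using Submodule.span_induction with
    | mem t ht =>
      obtain ⟨s', b', c', hb', hc', rfl⟩ := ht
      rw [Algebra.TensorProduct.tmul_mul_tmul]
      exact tmul_mem_splitSpan (hb.mul hb') (hc.mul hc')
    | zero => rw [mul_zero]; exact zero_mem _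
    | add x y _ _ hx hy => rw [mul_add]; exact add_mem hx hy
    | smul c x _ hx => rw [mul_smul_comm]; exact Submodule.smul_mem _ _ hx
  | zero => rw [zero_mul]; exact zero_mem _
  | add x y _ _ hx hy => rw [add_mul]; exact add_mem hx hy
  | smul c x _ hx => rw [smul_mul_assoc]; exact Submodule.smul_mem _ _ hx

/-- The coproduct is compatible with the bigrading: the inner degrees match. -/
theorem comul_mem {a : MpQUEA k qm Mp Mm} {l r : QRoot n}
    (h : HasBidegree k qm Mp Mm a l r) :
    Coalgebra.comul (R := Kq k) a ∈ splitSpan k qm Mp Mm l r := by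
  induction h with
  | one => rw [Bialgebra.comul_one]; exact tmul_mem_splitSpan .one .one
  | E i =>
    rw [QDatum.comul_E]
    exact add_mem
      (tmul_mem_splitSpan (.E i) (of_eq (.Kt 0) (by simp) (by simp)))
      (tmul_mem_splitSpan (of_eq (.Kt (Mp.root i, 0)) (by simp [TorusLattice.root])
        (by simp [TorusLattice.root])) (.E i))
  | F i =>
    rw [QDatum.comul_F]
    exact add_mem
      (tmul_mem_splitSpan (.F i) (of_eq (.Kt (0, Mm.root i)) (by simp [TorusLattice.root])
        (by simp [TorusLattice.root])))
      (tmul_mem_splitSpan (of_eq (.Kt 0) (by simp) (by simp)) (.F i))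
  | Kt g => rw [QDatum.comul_Kt]; exact tmul_mem_splitSpan (.Kt g) (.Kt g)
  | mul _ _ h1 h2 => rw [Bialgebra.comul_mul]; exact mul_mem_splitSpan h1 h2
  | smul c _ h => rw [map_smul]; exact Submodule.smul_mem _ _ h
  | add _ _ h1 h2 => rw [map_add]; exact add_mem h1 h2

/-- Linear maps on the coproduct of an element of bidegree `(l, r)` need only be compared on the
tensors `b ⊗ c` whose inner degrees match. -/
theorem comul_ext {M : Type*} [AddCommGroup M] [Module (Kq k) M] {a : MpQUEA k qm Mp Mm}
    {l r : QRoot n} (h : HasBidegree k qm Mp Mm a l r)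
    (f g : MpQUEA k qm Mp Mm ⊗[Kq k] MpQUEA k qm Mp Mm →ₗ[Kq k] M)
    (hfg : ∀ s b c, HasBidegree k qm Mp Mm b l s → HasBidegree k qm Mp Mm c s r →
      f (b ⊗ₜ c) = g (b ⊗ₜ c)) :
    f (Coalgebra.comul (R := Kq k) a) = g (Coalgebra.comul (R := Kq k) a) :=
  by
  refine LinearMap.eqOn_span (fun t ht => ?_) h.comul_mem
  obtain ⟨s, b, c, hb, hc, rfl⟩ := ht
  exact hfg s b c hb hc

theorem comul_ext₂ {M : Type*} [AddCommGroup M] [Module (Kq k) M] {a a' : MpQUEA k qm Mp Mm}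
    {l r l' r' : QRoot n} (h : HasBidegree k qm Mp Mm a l r)
    (h' : HasBidegree k qm Mp Mm a' l' r')
    (f g : (MpQUEA k qm Mp Mm ⊗[Kq k] MpQUEA k qm Mp Mm) ⊗[Kq k]
      (MpQUEA k qm Mp Mm ⊗[Kq k] MpQUEA k qm Mp Mm) →ₗ[Kq k] M)
    (hfg : ∀ s b c s' b' c', HasBidegree k qm Mp Mm b l s → HasBidegree k qm Mp Mm c s r →
      HasBidegree k qm Mp Mm b' l' s' → HasBidegree k qm Mp Mm c' s' r' →
      f ((b ⊗ₜ c) ⊗ₜ (b' ⊗ₜ c')) = g ((b ⊗ₜ c) ⊗ₜ (b' ⊗ₜ c'))) :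
    f (Coalgebra.comul (R := Kq k) a ⊗ₜ Coalgebra.comul (R := Kq k) a')
      = g (Coalgebra.comul (R := Kq k) a ⊗ₜ Coalgebra.comul (R := Kq k) a') := by
  refine h.comul_ext (f ∘ₗ (TensorProduct.mk (Kq k) _ _).flip (Coalgebra.comul (R := Kq k) a'))
    (g ∘ₗ (TensorProduct.mk (Kq k) _ _).flip (Coalgebra.comul (R := Kq k) a'))
    fun s b c hb hc => ?_
  exact h'.comul_ext (f ∘ₗ TensorProduct.mk (Kq k) _ _ (b ⊗ₜ c))
    (g ∘ₗ TensorProduct.mk (Kq k) _ _ (b ⊗ₜ c)) fun s' b' c' hb' hc' =>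
      hfg s b c s' b' c' hb hc hb' hc'

theorem antipode {a : MpQUEA k qm Mp Mm} {l r : QRoot n}
    (h : HasBidegree k qm Mp Mm a l r) :
    HasBidegree k qm Mp Mm (HopfAlgebra.antipode (Kq k) a) (-r) (-l) := by
  induction h with
  | one => rw [HopfAlgebra.antipode_one, neg_zero]; exact .one
  | E i =>
    have h1 : HopfAlgebra.antipode (Kq k) ((mpDatum k qm Mp Mm).E i) = (mpDatum k qm Mp Mm).SE i :=
      QDatum.S_E _ i
    rw [h1, QDatum.SE]
    exact of_eq (((HasBidegree.Kt (-(Mp.root i, 0))).mul (.E i)).mul (.Kt (-0))).neg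
      (by simp [TorusLattice.root]) (by simp [TorusLattice.root])
  | F i =>
    have h1 : HopfAlgebra.antipode (Kq k) ((mpDatum k qm Mp Mm).F i) = (mpDatum k qm Mp Mm).SF i :=
      QDatum.S_F _ i
    rw [h1, QDatum.SF]
    exact of_eq (((HasBidegree.Kt (-0)).mul (.F i)).mul (.Kt (-(0, Mm.root i)))).neg
      (by simp [TorusLattice.root]) (by simp [TorusLattice.root])
  | Kt g =>
    have h1 : HopfAlgebra.antipode (Kq k) ((mpDatum k qm Mp Mm).Kt g)
      = (mpDatum k qm Mp Mm).Kt (-g) := QDatum.S_Kt _ g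
    rw [h1]
    exact of_eq (.Kt (-g)) (by simp [add_comm]) (by simp [add_comm])
  | mul _ _ h1 h2 =>
    rw [HopfAlgebra.antipode_mul_antidistrib, neg_add_rev, neg_add_rev]; exact h2.mul h1
  | smul c _ h => rw [map_smul]; exact h.smul c
  | add _ _ h1 h2 => rw [map_add]; exact h1.add h2

end HasBidegree

/-! ### Toral cocycles -/

variable {B : Matrix (Fin n) (Fin n) ℚ} {a b : MpQUEA k qm Mp Mm} {l r l' r' : QRoot n}

theorem toralForm_left (ha : HasBidegree k qm Mp Mm a l r) (hb : HasBidegree k qm Mp Mm b l' r') :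
    toralForm k qm Mp Mm B (a ⊗ₜ b) = Coalgebra.counit (R := Kq k) a
      * Coalgebra.counit (R := Kq k) b * qpow k (bil B l l') := by
  change bichar k B (toralProj k qm Mp Mm a) (toralProj k qm Mp Mm b) = _
  rw [ha.toralProj_left, hb.toralProj_left, map_smul, map_smul, LinearMap.smul_apply,
    bichar_single, smul_eq_mul, smul_eq_mul]
  ring

theorem toralForm_right (ha : HasBidegree k qm Mp Mm a l r) (hb : HasBidegree k qm Mp Mm b l' r') :
    toralForm k qm Mp Mm B (a ⊗ₜ b) = Coalgebra.counit (R := Kq k) a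
      * Coalgebra.counit (R := Kq k) b * qpow k (bil B r r') := by
  change bichar k B (toralProj k qm Mp Mm a) (toralProj k qm Mp Mm b) = _
  rw [ha.toralProj_right, hb.toralProj_right, map_smul, map_smul, LinearMap.smul_apply,
    bichar_single, smul_eq_mul, smul_eq_mul]
  ring

theorem lid_counit_comul (x : MpQUEA k qm Mp Mm) :
    (TensorProduct.lid (Kq k) _).toLinearMap.comp (Coalgebra.counit.rTensor (MpQUEA k qm Mp Mm))
      (Coalgebra.comul (R := Kq k) x) = x := by
  rw [LinearMap.comp_apply, Coalgebra.rTensor_counit_comul]; simp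

theorem rid_counit_comul (x : MpQUEA k qm Mp Mm) :
    (TensorProduct.rid (Kq k) _).toLinearMap.comp (Coalgebra.counit.lTensor (MpQUEA k qm Mp Mm))
      (Coalgebra.comul (R := Kq k) x) = x := by
  rw [LinearMap.comp_apply, Coalgebra.lTensor_counit_comul]; simp

variable {T : Type*} [Ring T] [Algebra (Kq k) T]

/-- Left convolution with a toral form multiplies by its value on the left degrees. -/
theorem convProd_toralForm_left (ha : HasBidegree k qm Mp Mm a l r)
    (hb : HasBidegree k qm Mp Mm b l' r')
    (f : MpQUEA k qm Mp Mm ⊗[Kq k] MpQUEA k qm Mp Mm →ₗ[Kq k] T) :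
    convProd (Algebra.linearMap (Kq k) T ∘ₗ toralForm k qm Mp Mm B) f (a ⊗ₜ b)
      = qpow k (bil B l l') • f (a ⊗ₜ b) := by
  have h := ha.comul_ext₂ hb
    (LinearMap.mul' (Kq k) T ∘ₗ TensorProduct.map (Algebra.linearMap (Kq k) T ∘ₗ
      toralForm k qm Mp Mm B) f ∘ₗ (TensorProduct.tensorTensorTensorComm (Kq k) _ _ _ _).toLinearMap)
    (qpow k (bil B l l') • f ∘ₗ TensorProduct.map
      ((TensorProduct.lid (Kq k) _).toLinearMap.comp (Coalgebra.counit.rTensor _))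
      ((TensorProduct.lid (Kq k) _).toLinearMap.comp (Coalgebra.counit.rTensor _)))
    (fun s b c s' b' c' hb hc hb' hc' => by
      simp only [LinearMap.comp_apply, LinearEquiv.coe_coe,
        TensorProduct.tensorTensorTensorComm_tmul, TensorProduct.map_tmul, LinearMap.mul'_apply,
        toralForm_left hb hb', LinearMap.smul_apply, LinearMap.rTensor_tmul,
        TensorProduct.lid_tmul, Algebra.linearMap_apply, Algebra.algebraMap_eq_smul_one,
        one_mul, TensorProduct.tmul_smul, ← TensorProduct.smul_tmul', map_smul,
        smul_smul]
      congr 1; ring)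
  refine h.trans ?_
  rw [LinearMap.smul_apply, LinearMap.comp_apply, TensorProduct.map_tmul, lid_counit_comul,
    lid_counit_comul]

/-- Right convolution with a toral form multiplies by its value on the right degrees. -/
theorem convProd_toralForm_right (ha : HasBidegree k qm Mp Mm a l r)
    (hb : HasBidegree k qm Mp Mm b l' r')
    (f : MpQUEA k qm Mp Mm ⊗[Kq k] MpQUEA k qm Mp Mm →ₗ[Kq k] T) :
    convProd f (Algebra.linearMap (Kq k) T ∘ₗ toralForm k qm Mp Mm B) (a ⊗ₜ b)
      = qpow k (bil B r r') • f (a ⊗ₜ b) := by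
  have h := ha.comul_ext₂ hb
    (LinearMap.mul' (Kq k) T ∘ₗ TensorProduct.map f (Algebra.linearMap (Kq k) T ∘ₗ
      toralForm k qm Mp Mm B) ∘ₗ (TensorProduct.tensorTensorTensorComm (Kq k) _ _ _ _).toLinearMap)
    (qpow k (bil B r r') • f ∘ₗ TensorProduct.map
      ((TensorProduct.rid (Kq k) _).toLinearMap.comp (Coalgebra.counit.lTensor _))
      ((TensorProduct.rid (Kq k) _).toLinearMap.comp (Coalgebra.counit.lTensor _)))
    (fun s b c s' b' c' hb hc hb' hc' => by
      simp only [LinearMap.comp_apply, LinearEquiv.coe_coe,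
        TensorProduct.tensorTensorTensorComm_tmul, TensorProduct.map_tmul, LinearMap.mul'_apply,
        toralForm_right hc hc', LinearMap.smul_apply, LinearMap.lTensor_tmul,
        TensorProduct.rid_tmul, Algebra.linearMap_apply, Algebra.algebraMap_eq_smul_one,
        mul_one, TensorProduct.tmul_smul, ← TensorProduct.smul_tmul', map_smul,
        smul_smul]
      congr 1; ring)
  refine h.trans ?_
  rw [LinearMap.smul_apply, LinearMap.comp_apply, TensorProduct.map_tmul, rid_counit_comul,
    rid_counit_comul]

theorem convProd_toralForm (ha : HasBidegree k qm Mp Mm a l r)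
    (hb : HasBidegree k qm Mp Mm b l' r')
    (f : MpQUEA k qm Mp Mm ⊗[Kq k] MpQUEA k qm Mp Mm →ₗ[Kq k] Kq k) :
    convProd (toralForm k qm Mp Mm B) f (a ⊗ₜ b) = qpow k (bil B l l') * f (a ⊗ₜ b) :=
  convProd_toralForm_left ha hb f

/-- On bihomogeneous elements the deformed product is a scalar multiple of the product. -/
theorem deformedMul_toralForm (ha : HasBidegree k qm Mp Mm a l r)
    (hb : HasBidegree k qm Mp Mm b l' r') :
    deformedMul (toralForm k qm Mp Mm B) (toralForm k qm Mp Mm (-B)) (a ⊗ₜ b)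
      = qpow k (bil B l l' - bil B r r') • (a * b) := by
  rw [deformedMul, convProd_toralForm_right ha hb, convProd_toralForm_left ha hb, smul_smul,
    ← AddChar.map_add_eq_mul, bil_neg, LinearMap.mul'_apply, neg_add_eq_sub]

theorem linearMap_ext_bidegree {M : Type*} [AddCommGroup M] [Module (Kq k) M]
    {f g : MpQUEA k qm Mp Mm →ₗ[Kq k] M}
    (h : ∀ a l r, HasBidegree k qm Mp Mm a l r → f a = g a) : f = g :=
  LinearMap.ext fun x => HasBidegree.induction h (fun a b ha hb => by rw [map_add, map_add, ha, hb]) x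

theorem convProd_add_right {f g h : MpQUEA k qm Mp Mm ⊗[Kq k] MpQUEA k qm Mp Mm →ₗ[Kq k] Kq k} :
    convProd f (g + h) = convProd f g + convProd f h := by
  rw [convProd, TensorProduct.map_add_right, LinearMap.add_comp, LinearMap.comp_add]; rfl

variable (k qm Mp Mm B) in
/-- A bicharacter of the torus defines a two-cocycle. -/
theorem isTwoCocycle_toralForm :
    IsTwoCocycle (toralForm k qm Mp Mm B) (toralForm k qm Mp Mm (-B)) where
  conv_inv := TensorProduct.ext (linearMap_ext_bidegree fun a l r ha =>
    linearMap_ext_bidegree fun b l' r' hb => by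
      change convProd _ _ (a ⊗ₜ b) = Coalgebra.counit (R := Kq k) (a ⊗ₜ[Kq k] b)
      rw [convProd_toralForm ha hb, toralForm_left ha hb, bil_neg, TensorProduct.counit_tmul,
        smul_eq_mul, mul_left_comm, ← AddChar.map_add_eq_mul, add_neg_cancel,
        AddChar.map_zero_eq_one, mul_one, mul_comm])
  inv_conv := TensorProduct.ext (linearMap_ext_bidegree fun a l r ha =>
    linearMap_ext_bidegree fun b l' r' hb => by
      change convProd _ _ (a ⊗ₜ b) = Coalgebra.counit (R := Kq k) (a ⊗ₜ[Kq k] b)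
      rw [convProd_toralForm ha hb, toralForm_left ha hb, bil_neg, TensorProduct.counit_tmul,
        smul_eq_mul, mul_left_comm, ← AddChar.map_add_eq_mul, neg_add_cancel,
        AddChar.map_zero_eq_one, mul_one, mul_comm])
  one_left a := by
    induction a using HasBidegree.induction with
    | h a l r ha =>
      rw [toralForm_left .one ha, bil_zero_left, AddChar.map_zero_eq_one, Bialgebra.counit_one,
        one_mul, mul_one]
    | hadd a b ha hb => rw [TensorProduct.tmul_add, map_add, map_add, ha, hb]
  one_right a := by
    induction a using HasBidegree.induction with
    | h a l r ha =>
      rw [toralForm_left ha .one, bil_zero_right, AddChar.map_zero_eq_one, Bialgebra.counit_one,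
        mul_one, mul_one]
    | hadd a b ha hb => rw [TensorProduct.add_tmul, map_add, map_add, ha, hb]
  cocycle a b c := by
    induction a using HasBidegree.induction with
    | h a l r ha =>
      induction b using HasBidegree.induction with
      | h b l' r' hb =>
        induction c using HasBidegree.induction with
        | h c l'' r'' hc =>
          rw [convProd_toralForm ha hb, convProd_toralForm hb hc]
          change _ * toralForm k qm Mp Mm B ((a * b) ⊗ₜ c) = _ * toralForm k qm Mp Mm B (a ⊗ₜ (b * c))
          rw [toralForm_left (ha.mul hb) hc, toralForm_left ha (hb.mul hc), Bialgebra.counit_mul,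
            Bialgebra.counit_mul, bil_add_left, bil_add_right, AddChar.map_add_eq_mul,
            AddChar.map_add_eq_mul]
          ring
        | hadd c c' h1 h2 =>
          rw [map_add, LinearMap.add_comp, convProd_add_right, LinearMap.add_apply, h1, h2,
            TensorProduct.tmul_add, map_add]
      | hadd b b' h1 h2 => rw [TensorProduct.tmul_add, map_add, h1, h2, TensorProduct.add_tmul, map_add]
    | hadd a a' h1 h2 =>
      rw [TensorProduct.add_tmul, map_add, h1, h2, map_add, LinearMap.add_comp, convProd_add_right,
        LinearMap.add_apply]

theorem toralForm_antipode (ha : HasBidegree k qm Mp Mm a l r) :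
    (toralForm k qm Mp Mm B ∘ₗ (HopfAlgebra.antipode (Kq k)).lTensor (MpQUEA k qm Mp Mm) ∘ₗ
      Coalgebra.comul) a = qpow k (-bil B l l) * Coalgebra.counit (R := Kq k) a := by
  have h := ha.comul_ext
    (toralForm k qm Mp Mm B ∘ₗ (HopfAlgebra.antipode (Kq k)).lTensor (MpQUEA k qm Mp Mm))
    (qpow k (-bil B l r) • Coalgebra.counit ∘ₗ
      ((TensorProduct.lid (Kq k) _).toLinearMap.comp (Coalgebra.counit.rTensor _)))
    (fun s b c hb hc => by
      simp only [LinearMap.comp_apply, LinearMap.lTensor_tmul, toralForm_left hb hc.antipode,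
        HopfAlgebra.counit_antipode, bil_neg_right, LinearMap.smul_apply, LinearMap.rTensor_tmul,
        LinearEquiv.coe_coe, TensorProduct.lid_tmul, map_smul, smul_eq_mul]
      ring)
  refine h.trans ?_
  rw [LinearMap.smul_apply, LinearMap.comp_apply, lid_counit_comul, smul_eq_mul]
  rcases ha.counit_eq_zero_or_eq with h0 | rfl
  · rw [h0, mul_zero, mul_zero]
  · rfl

theorem toralForm_antipode_rTensor (ha : HasBidegree k qm Mp Mm a l r) :
    (toralForm k qm Mp Mm B ∘ₗ (HopfAlgebra.antipode (Kq k)).rTensor (MpQUEA k qm Mp Mm) ∘ₗ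
      Coalgebra.comul) a = qpow k (-bil B r r) * Coalgebra.counit (R := Kq k) a := by
  have h := ha.comul_ext
    (toralForm k qm Mp Mm B ∘ₗ (HopfAlgebra.antipode (Kq k)).rTensor (MpQUEA k qm Mp Mm))
    (qpow k (-bil B l r) • Coalgebra.counit ∘ₗ
      ((TensorProduct.lid (Kq k) _).toLinearMap.comp (Coalgebra.counit.rTensor _)))
    (fun s b c hb hc => by
      simp only [LinearMap.comp_apply, LinearMap.rTensor_tmul, toralForm_right hb.antipode hc,
        HopfAlgebra.counit_antipode, bil_neg_left, LinearMap.smul_apply,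
        LinearEquiv.coe_coe, TensorProduct.lid_tmul, map_smul, smul_eq_mul]
      ring)
  refine h.trans ?_
  rw [LinearMap.smul_apply, LinearMap.comp_apply, lid_counit_comul, smul_eq_mul]
  rcases ha.counit_eq_zero_or_eq with h0 | rfl
  · rw [h0, mul_zero, mul_zero]
  · rfl

/-- On bihomogeneous elements the deformed antipode is a scalar multiple of the antipode. -/
theorem deformedAntipode_toralForm (ha : HasBidegree k qm Mp Mm a l r) :
    deformedAntipode (toralForm k qm Mp Mm B) (toralForm k qm Mp Mm (-B)) a
      = qpow k (bil B r r - bil B l l) • HopfAlgebra.antipode (Kq k) a := by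
  set u := toralForm k qm Mp Mm B ∘ₗ (HopfAlgebra.antipode (Kq k)).lTensor (MpQUEA k qm Mp Mm) ∘ₗ
      Coalgebra.comul with hu
  set v := toralForm k qm Mp Mm (-B) ∘ₗ
    (HopfAlgebra.antipode (Kq k)).rTensor (MpQUEA k qm Mp Mm) ∘ₗ Coalgebra.comul with hv
  have h1 : ∀ (f : MpQUEA k qm Mp Mm →ₗ[Kq k] MpQUEA k qm Mp Mm) {a : MpQUEA k qm Mp Mm}
      {l r : QRoot n} (_ : HasBidegree k qm Mp Mm a l r),
      convProd (Algebra.linearMap (Kq k) _ ∘ₗ u) f a = qpow k (-bil B l l) • f a := by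
    intro f a l r ha
    have h := ha.comul_ext
      (LinearMap.mul' (Kq k) _ ∘ₗ TensorProduct.map (Algebra.linearMap (Kq k) _ ∘ₗ u) f)
      (qpow k (-bil B l l) • f ∘ₗ
        ((TensorProduct.lid (Kq k) _).toLinearMap.comp (Coalgebra.counit.rTensor _)))
      (fun s b c hb hc => by
        have h1 : u b = _ := toralForm_antipode hb
        rw [LinearMap.comp_apply, TensorProduct.map_tmul, LinearMap.comp_apply, h1,
          LinearMap.mul'_apply, Algebra.linearMap_apply, ← Algebra.smul_def, LinearMap.smul_apply,
          LinearMap.comp_apply, LinearMap.comp_apply, LinearMap.rTensor_tmul, LinearEquiv.coe_coe,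
          TensorProduct.lid_tmul, map_smul, smul_smul])
    refine h.trans ?_
    rw [LinearMap.smul_apply, LinearMap.comp_apply, lid_counit_comul]
  have h2 : ∀ (f : MpQUEA k qm Mp Mm →ₗ[Kq k] MpQUEA k qm Mp Mm) {a : MpQUEA k qm Mp Mm}
      {l r : QRoot n} (_ : HasBidegree k qm Mp Mm a l r),
      convProd f (Algebra.linearMap (Kq k) _ ∘ₗ v) a = qpow k (bil B r r) • f a := by
    intro f a l r ha
    have h := ha.comul_ext
      (LinearMap.mul' (Kq k) _ ∘ₗ TensorProduct.map f (Algebra.linearMap (Kq k) _ ∘ₗ v))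
      (qpow k (bil B r r) • f ∘ₗ
        ((TensorProduct.rid (Kq k) _).toLinearMap.comp (Coalgebra.counit.lTensor _)))
      (fun s b c hb hc => by
        have h1 : v c = _ := toralForm_antipode_rTensor hc
        rw [bil_neg, neg_neg] at h1
        rw [LinearMap.comp_apply, TensorProduct.map_tmul, LinearMap.comp_apply, h1,
          LinearMap.mul'_apply, Algebra.linearMap_apply, ← Algebra.commutes, ← Algebra.smul_def,
          LinearMap.smul_apply, LinearMap.comp_apply, LinearMap.comp_apply, LinearMap.lTensor_tmul,
          LinearEquiv.coe_coe, TensorProduct.rid_tmul, map_smul, smul_smul])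
    refine h.trans ?_
    rw [LinearMap.smul_apply, LinearMap.comp_apply, rid_counit_comul]
  rw [deformedAntipode, ← hu, ← hv, h2 _ ha, h1 _ ha, smul_smul, ← AddChar.map_add_eq_mul,
    sub_eq_add_neg]

end Bidegree

/-! ### The deformed algebra -/

section Deformed
open TensorProduct
variable (k : Type*) [Field k] {n : ℕ} {C : CartanDatum n} (qm qm' : QRatMultiparameter C)
  (Mp Mm : TorusLattice n) (B : Matrix (Fin n) (Fin n) ℚ)

/-- The algebra `H_σ`, for `H` a multiparameter quantum group and `σ` the toral cocycle attached
to the matrix `B`. -/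
def DeformedMp (k : Type*) [Field k] {n : ℕ} {C : CartanDatum n} (qm : QRatMultiparameter C)
    (Mp Mm : TorusLattice n) (_ : Matrix (Fin n) (Fin n) ℚ) : Type _ := MpQUEA k qm Mp Mm

namespace DeformedMp

noncomputable instance : AddCommGroup (DeformedMp k qm Mp Mm B) :=
  inferInstanceAs (AddCommGroup (MpQUEA k qm Mp Mm))
noncomputable instance : Module (Kq k) (DeformedMp k qm Mp Mm B) :=
  inferInstanceAs (Module (Kq k) (MpQUEA k qm Mp Mm))

/-- The identity, as a linear equivalence from `H` to `H_σ`. -/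
noncomputable def of : MpQUEA k qm Mp Mm ≃ₗ[Kq k] DeformedMp k qm Mp Mm B := LinearEquiv.refl _ _

noncomputable instance : Mul (DeformedMp k qm Mp Mm B) where
  mul x y := of k qm Mp Mm B (deformedMul (toralForm k qm Mp Mm B) (toralForm k qm Mp Mm (-B))
    ((of k qm Mp Mm B).symm x ⊗ₜ (of k qm Mp Mm B).symm y))

variable {k qm Mp Mm B}

theorem of_mul_of (a b : MpQUEA k qm Mp Mm) : of k qm Mp Mm B a * of k qm Mp Mm B b
    = of k qm Mp Mm B (deformedMul (toralForm k qm Mp Mm B) (toralForm k qm Mp Mm (-B))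
      (a ⊗ₜ b)) := rfl

theorem of_mul_of_bidegree {a b : MpQUEA k qm Mp Mm} {l r l' r' : QRoot n}
    (ha : HasBidegree k qm Mp Mm a l r) (hb : HasBidegree k qm Mp Mm b l' r') :
    of k qm Mp Mm B a * of k qm Mp Mm B b
      = qpow k (bil B l l' - bil B r r') • of k qm Mp Mm B (a * b) := by
  rw [of_mul_of, deformedMul_toralForm ha hb, map_smul]

theorem add_mul' (x y z : DeformedMp k qm Mp Mm B) : (x + y) * z = x * z + y * z := by
  change of k qm Mp Mm B _ = of k qm Mp Mm B _ + of k qm Mp Mm B _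
  rw [map_add, add_tmul, map_add, map_add]

theorem mul_add' (x y z : DeformedMp k qm Mp Mm B) : x * (y + z) = x * y + x * z := by
  change of k qm Mp Mm B _ = of k qm Mp Mm B _ + of k qm Mp Mm B _
  rw [map_add, tmul_add, map_add, map_add]

theorem smul_mul' (c : Kq k) (x y : DeformedMp k qm Mp Mm B) : c • x * y = c • (x * y) := by
  change of k qm Mp Mm B _ = c • of k qm Mp Mm B _
  rw [map_smul, ← smul_tmul', map_smul, map_smul]

theorem mul_smul' (c : Kq k) (x y : DeformedMp k qm Mp Mm B) : x * c • y = c • (x * y) := by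
  change of k qm Mp Mm B _ = c • of k qm Mp Mm B _
  rw [map_smul, tmul_smul, map_smul, map_smul]

theorem one_mul' (x : MpQUEA k qm Mp Mm) :
    of k qm Mp Mm B 1 * of k qm Mp Mm B x = of k qm Mp Mm B x := by
  induction x using HasBidegree.induction with
  | h a l r ha =>
    rw [of_mul_of_bidegree .one ha, bil_zero_left, bil_zero_left, sub_zero,
      AddChar.map_zero_eq_one, one_smul, one_mul]
  | hadd a b ha hb => rw [map_add, mul_add', ha, hb]

theorem mul_one' (x : MpQUEA k qm Mp Mm) :
    of k qm Mp Mm B x * of k qm Mp Mm B 1 = of k qm Mp Mm B x := by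
  induction x using HasBidegree.induction with
  | h a l r ha =>
    rw [of_mul_of_bidegree ha .one, bil_zero_right, bil_zero_right, sub_zero,
      AddChar.map_zero_eq_one, one_smul, mul_one]
  | hadd a b ha hb => rw [map_add, add_mul', ha, hb]

theorem mul_assoc' (x y z : MpQUEA k qm Mp Mm) :
    of k qm Mp Mm B x * of k qm Mp Mm B y * of k qm Mp Mm B z
      = of k qm Mp Mm B x * (of k qm Mp Mm B y * of k qm Mp Mm B z) := by
  induction x using HasBidegree.induction with
  | h a l r ha =>
    induction y using HasBidegree.induction with
    | h b l' r' hb =>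
      induction z using HasBidegree.induction with
      | h c l'' r'' hc =>
        rw [of_mul_of_bidegree ha hb, of_mul_of_bidegree hb hc, smul_mul', mul_smul',
          of_mul_of_bidegree (ha.mul hb) hc, of_mul_of_bidegree ha (hb.mul hc), smul_smul,
          smul_smul, ← AddChar.map_add_eq_mul, ← AddChar.map_add_eq_mul, mul_assoc]
        simp only [bil_add_left, bil_add_right]
        congr 2
        ring
      | hadd c c' h1 h2 => rw [map_add, mul_add', h1, h2, mul_add', mul_add']
    | hadd b b' h1 h2 => rw [map_add, mul_add', add_mul', h1, h2, add_mul', mul_add']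
  | hadd a a' h1 h2 => rw [map_add, add_mul', add_mul', h1, h2, add_mul']

noncomputable instance : Ring (DeformedMp k qm Mp Mm B) :=
  { (inferInstance : AddCommGroup (DeformedMp k qm Mp Mm B)),
    (inferInstance : Mul (DeformedMp k qm Mp Mm B)) with
    one := of k qm Mp Mm B 1
    left_distrib := mul_add'
    right_distrib := add_mul'
    zero_mul := fun x => by
      have := smul_mul' (0 : Kq k) 0 x
      rwa [zero_smul, zero_smul] at this
    mul_zero := fun x => by
      have := mul_smul' (0 : Kq k) x 0
      rwa [zero_smul, zero_smul] at this
    one_mul := one_mul'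
    mul_one := mul_one'
    mul_assoc := mul_assoc' }

noncomputable instance : Algebra (Kq k) (DeformedMp k qm Mp Mm B) :=
  Algebra.ofModule smul_mul' mul_smul'

theorem of_one : of k qm Mp Mm B 1 = 1 := rfl

end DeformedMp

open DeformedMp

variable {k qm qm' Mp Mm B}

/-- Iterated skew commutators of bihomogeneous elements in `H_σ` and in `H` agree up to scalars,
with the parameters shifted by the antisymmetrization of the cocycle. -/
theorem adProd_of {x y : MpQUEA k qm Mp Mm} {l r l' r' : QRoot n}
    (hx : HasBidegree k qm Mp Mm x l r) (hy : HasBidegree k qm Mp Mm y l' r') (s s' p : ℚ)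
    (hs : s = s' + (bil B l' l - bil B r' r) - (bil B l l' - bil B r r')) (m : ℕ)
    (h0 : adProd (fun i => qpow k s * qpow k p ^ i) x y m = 0) :
    adProd (fun i => qpow k s' * qpow k p ^ i) (of k qm Mp Mm B x) (of k qm Mp Mm B y) m = 0 := by
  have hV : ∀ (f : ℕ → Kq k) (i : ℕ),
      HasBidegree k qm Mp Mm (adProd f x y i) (i • l + l') (i • r + r') := by
    intro f i
    induction i with
    | zero => simpa [adProd] using hy
    | succ i ih =>
      exact ((hx.mul ih).of_eq (by rw [succ_nsmul]; abel) (by rw [succ_nsmul]; abel)).sub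
        ((((ih.mul hx).of_eq (by rw [succ_nsmul]; abel) (by rw [succ_nsmul]; abel))).smul _)
  have hl : ∀ (i : ℕ) (x y z : QRoot n), bil B x (i • y + z) = i * bil B x y + bil B x z := by
    intro i x y z
    rw [bil_add_right]
    congr 1
    induction i with
    | zero => simp [bil_zero_right]
    | succ i ih => rw [succ_nsmul, bil_add_right, ih]; push_cast; ring
  have hr : ∀ (i : ℕ) (x y z : QRoot n), bil B (i • y + z) x = i * bil B y x + bil B z x := by
    intro i x y z
    rw [bil_add_left]
    congr 1
    induction i with
    | zero => simp [bil_zero_left]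
    | succ i ih => rw [succ_nsmul, bil_add_left, ih]; push_cast; ring
  have key := adProd_transfer (fun _ => (of k qm Mp Mm B).toLinearMap) (X := x) (Y := y)
    (X' := of k qm Mp Mm B x) (Y' := of k qm Mp Mm B y) rfl
    (fun i => of_mul_of_bidegree hx (hV _ i)) (fun i => of_mul_of_bidegree (hV _ i) hx)
    (f := fun i => qpow k s * qpow k p ^ i) (f' := fun i => qpow k s' * qpow k p ^ i)
    (fun i => ?_) m
  · rw [key, h0, map_zero, smul_zero]
  simp only [hl, hr]
  rw [mul_left_comm, ← mul_assoc, ← AddChar.map_add_eq_mul, mul_right_comm,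
    ← AddChar.map_add_eq_mul]
  congr 2
  rw [hs]
  ring

/-- If the multiparameters `q'` and `q` differ by the antisymmetrization of `B`, the generators of
`H_σ` satisfy the relations for the multiparameter `q'`. -/
theorem isRep_deformed (h : ∀ x y, bil qm'.R x y = bil qm.R x y + bil B x y - bil B y x) :
    (mpDatum k qm' Mp Mm).IsRep (fun i => of k qm Mp Mm B ((mpDatum k qm Mp Mm).E i))
      (fun i => of k qm Mp Mm B ((mpDatum k qm Mp Mm).F i))
      (fun g => of k qm Mp Mm B ((mpDatum k qm Mp Mm).Kt g)) where
  t_zero := by rw [QDatum.Kt_zero, of_one]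
  t_add g g' := by
    rw [of_mul_of_bidegree (.Kt g) (.Kt g'), sub_self, AddChar.map_zero_eq_one, one_smul,
      QDatum.Kt_mul]
  t_e g j := by
    rw [of_mul_of_bidegree (.Kt g) (.E j), of_mul_of_bidegree (.E j) (.Kt g), QDatum.Kt_E,
      map_smul, smul_smul, smul_smul, bil_zero_left, bil_zero_right, sub_zero, sub_zero]
    change (_ * mpChi k qm Mp Mm j g) • _ = (mpChi k qm' Mp Mm j g * _) • _
    rw [mpChi_apply, mpChi_apply, ← AddChar.map_add_eq_mul, ← AddChar.map_add_eq_mul, h, h,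
      bil_add_left, bil_add_right]
    congr 2
    ring
  t_f g j := by
    rw [of_mul_of_bidegree (.Kt g) (.F j), of_mul_of_bidegree (.F j) (.Kt g), QDatum.Kt_F,
      map_smul, smul_smul, smul_smul, bil_zero_left, bil_zero_right, zero_sub, zero_sub]
    change (_ * mpChi k qm Mp Mm j (-g)) • _ = (mpChi k qm' Mp Mm j (-g) * _) • _
    rw [mpChi_apply, mpChi_apply, ← AddChar.map_add_eq_mul, ← AddChar.map_add_eq_mul, h, h,
      bil_add_left, bil_add_right]
    simp only [Prod.fst_neg, Prod.snd_neg, Submodule.coe_neg, bil_neg_left, bil_neg_right]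
    congr 2
    ring
  e_f i j := by
    have hc : (mpDatum k qm' Mp Mm).c i = (mpDatum k qm Mp Mm).c i := by
      change qm'.ent k i i / (qm'.ent k i i - 1) = qm.ent k i i / (qm.ent k i i - 1)
      simp only [QRatMultiparameter.ent, QRatMultiparameter.R_diag]
    rw [of_mul_of_bidegree (.E i) (.F j), of_mul_of_bidegree (.F j) (.E i)]
    simp only [bil_zero_left, bil_zero_right, sub_zero, AddChar.map_zero_eq_one, one_smul]
    rw [← map_sub, (mpDatum k qm Mp Mm).isRep_self.e_f i j, hc]
    split_ifs
    · rw [map_smul, map_sub]; rfl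
    · rw [map_zero]
  serre_e i j hij := by
    have h0 := (mpDatum k qm Mp Mm).isRep_self.serre_e i j hij
    rw [QDatum.serreE_iff _ hij, mpDatum_sc, mpDatum_sc] at h0
    rw [QDatum.serreE_iff _ hij, mpDatum_sc, mpDatum_sc]
    rw [qm'.R_diag]
    rw [qm.R_diag] at h0
    refine adProd_of (.E i) (.E j) _ _ _ ?_ _ h0
    rw [← bil_sroot qm.R, ← bil_sroot qm'.R, h]
    simp only [bil_zero_left]
    ring
  serre_f i j hij := by
    have h0 := (mpDatum k qm Mp Mm).isRep_self.serre_f i j hij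
    rw [QDatum.serreF_iff _ hij, mpDatum_sc, mpDatum_sc] at h0
    rw [QDatum.serreF_iff _ hij, mpDatum_sc, mpDatum_sc]
    rw [qm'.R_diag]
    rw [qm.R_diag] at h0
    refine adProd_of (.F i) (.F j) _ _ _ ?_ _ h0
    rw [← bil_sroot qm.R, ← bil_sroot qm'.R, h]
    simp only [bil_zero_left]
    ring

variable (h : ∀ x y, bil qm'.R x y = bil qm.R x y + bil B x y - bil B y x)

/-- The homomorphism from the quantum group with multiparameter `q'` to the cocycle deformation of
the one with multiparameter `q`. -/
noncomputable def deformHom : MpQUEA k qm' Mp Mm →ₐ[Kq k] DeformedMp k qm Mp Mm B :=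
  QDatum.lift (isRep_deformed h)

/-- The same map with values in the underlying space of the deformation. -/
noncomputable def deformMap : MpQUEA k qm' Mp Mm →ₗ[Kq k] MpQUEA k qm Mp Mm :=
  (of k qm Mp Mm B).symm.toLinearMap ∘ₗ (deformHom h).toLinearMap

theorem deformMap_one : deformMap (k := k) (Mp := Mp) (Mm := Mm) h 1 = 1 :=
  congrArg (of k qm Mp Mm B).symm (map_one (deformHom h))
theorem deformMap_E (i : Fin n) : deformMap h ((mpDatum k qm' Mp Mm).E i)
    = (mpDatum k qm Mp Mm).E i := congrArg (of k qm Mp Mm B).symm (QDatum.lift_E _ i)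
theorem deformMap_F (i : Fin n) : deformMap h ((mpDatum k qm' Mp Mm).F i)
    = (mpDatum k qm Mp Mm).F i := congrArg (of k qm Mp Mm B).symm (QDatum.lift_F _ i)
theorem deformMap_Kt (g : Mp.M × Mm.M) : deformMap h ((mpDatum k qm' Mp Mm).Kt g)
    = (mpDatum k qm Mp Mm).Kt g := congrArg (of k qm Mp Mm B).symm (QDatum.lift_Kt _ g)

theorem deformMap_mul (x y : MpQUEA k qm' Mp Mm) : deformMap h (x * y)
    = deformedMul (toralForm k qm Mp Mm B) (toralForm k qm Mp Mm (-B))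
      (deformMap h x ⊗ₜ deformMap h y) :=
  congrArg (of k qm Mp Mm B).symm (map_mul (deformHom h) x y)

theorem HasBidegree.deformMap {a : MpQUEA k qm' Mp Mm} {l r : QRoot n}
    (ha : HasBidegree k qm' Mp Mm a l r) :
    HasBidegree k qm Mp Mm (_root_.deformMap h a) l r := by
  induction ha with
  | one => rw [deformMap_one]; exact .one
  | E i => rw [deformMap_E]; exact .E i
  | F i => rw [deformMap_F]; exact .F i
  | Kt g => rw [deformMap_Kt]; exact .Kt g
  | mul _ _ h1 h2 => rw [deformMap_mul, deformedMul_toralForm h1 h2]; exact (h1.mul h2).smul _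
  | smul c _ h1 => rw [map_smul]; exact h1.smul c
  | add _ _ h1 h2 => rw [map_add]; exact h1.add h2

theorem deformMap_mul_bidegree {a b : MpQUEA k qm' Mp Mm} {l r l' r' : QRoot n}
    (ha : HasBidegree k qm' Mp Mm a l r) (hb : HasBidegree k qm' Mp Mm b l' r') :
    deformMap h (a * b)
      = qpow k (bil B l l' - bil B r r') • (deformMap h a * deformMap h b) := by
  rw [deformMap_mul, deformedMul_toralForm (ha.deformMap h) (hb.deformMap h)]

/-- Deforming by `B` and then by `-B` gives back the identity. -/
theorem deformMap_deformMap {B' : Matrix (Fin n) (Fin n) ℚ} (hB : B' = -B)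
    (h' : ∀ x y, bil qm.R x y = bil qm'.R x y + bil B' x y - bil B' y x)
    (x : MpQUEA k qm' Mp Mm) : deformMap h' (deformMap h x) = x := by
  induction x using HasBidegree.induction with
  | h a l r ha =>
    induction ha with
    | one => rw [deformMap_one, deformMap_one]
    | E i => rw [deformMap_E, deformMap_E]
    | F i => rw [deformMap_F, deformMap_F]
    | Kt g => rw [deformMap_Kt, deformMap_Kt]
    | mul ha hb h1 h2 =>
      rw [deformMap_mul_bidegree h ha hb, map_smul,
        deformMap_mul_bidegree h' (ha.deformMap h) (hb.deformMap h), h1, h2, smul_smul,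
        ← AddChar.map_add_eq_mul, hB, bil_neg, bil_neg]
      rw [show ∀ x y : ℚ, x - y + (-x - -y) = 0 from fun x y => by ring,
        AddChar.map_zero_eq_one, one_smul]
    | smul c _ h1 => rw [map_smul, map_smul, h1]
    | add _ _ h1 h2 => rw [map_add, map_add, h1, h2]
  | hadd a b ha hb => rw [map_add, map_add, ha, hb]

theorem counit_deformMap (x : MpQUEA k qm' Mp Mm) :
    Coalgebra.counit (R := Kq k) (deformMap h x) = Coalgebra.counit (R := Kq k) x := by
  induction x using HasBidegree.induction with
  | h a l r ha =>
    induction ha with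
    | one => rw [deformMap_one, Bialgebra.counit_one, Bialgebra.counit_one]
    | E i => rw [deformMap_E, QDatum.counit_E, QDatum.counit_E]
    | F i => rw [deformMap_F, QDatum.counit_F, QDatum.counit_F]
    | Kt g => rw [deformMap_Kt, QDatum.counit_Kt, QDatum.counit_Kt]
    | mul ha hb h1 h2 =>
      rw [deformMap_mul_bidegree h ha hb, map_smul, Bialgebra.counit_mul, Bialgebra.counit_mul,
        h1, h2, smul_eq_mul]
      rcases ha.counit_eq_zero_or_eq with h0 | rfl
      · rw [h0, zero_mul, mul_zero]
      rcases hb.counit_eq_zero_or_eq with h0 | rfl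
      · rw [h0, mul_zero, mul_zero]
      rw [sub_self, AddChar.map_zero_eq_one, one_mul]
    | smul c _ h1 => rw [map_smul, map_smul, map_smul, h1]
    | add _ _ h1 h2 => rw [map_add, map_add, map_add, h1, h2]
  | hadd a b ha hb => rw [map_add, map_add, map_add, ha, hb]

theorem comul_deformMap (x : MpQUEA k qm' Mp Mm) :
    TensorProduct.map (deformMap h) (deformMap h) (Coalgebra.comul (R := Kq k) x)
      = Coalgebra.comul (R := Kq k) (deformMap h x) := by
  induction x using HasBidegree.induction with
  | h a l r ha =>
    induction ha with
    | one =>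
      rw [deformMap_one, Bialgebra.comul_one, Bialgebra.comul_one,
        Algebra.TensorProduct.one_def, TensorProduct.map_tmul, deformMap_one]; rfl
    | E i =>
      rw [deformMap_E, QDatum.comul_E, QDatum.comul_E, map_add, TensorProduct.map_tmul,
        TensorProduct.map_tmul, deformMap_E, deformMap_Kt, deformMap_Kt]; rfl
    | F i =>
      rw [deformMap_F, QDatum.comul_F, QDatum.comul_F, map_add, TensorProduct.map_tmul,
        TensorProduct.map_tmul, deformMap_F, deformMap_Kt, deformMap_Kt]; rfl
    | Kt g =>
      rw [deformMap_Kt, QDatum.comul_Kt, QDatum.comul_Kt, TensorProduct.map_tmul, deformMap_Kt]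
    | @mul a b l r l' r' ha hb h1 h2 =>
      rw [deformMap_mul_bidegree h ha hb, map_smul, Bialgebra.comul_mul, Bialgebra.comul_mul,
        ← h1, ← h2]
      -- the contributions of the inner degrees cancel, since they match in the two coproducts
      exact ha.comul_ext₂ hb
        (TensorProduct.map (deformMap h) (deformMap h) ∘ₗ LinearMap.mul' (Kq k) _)
        (qpow k (bil B l l' - bil B r r') • LinearMap.mul' (Kq k) _ ∘ₗ
          TensorProduct.map (TensorProduct.map (deformMap h) (deformMap h))
            (TensorProduct.map (deformMap h) (deformMap h)))
        (fun s b c s' b' c' hb hc hb' hc' => by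
          simp only [LinearMap.comp_apply, LinearMap.mul'_apply, LinearMap.smul_apply,
            TensorProduct.map_tmul, Algebra.TensorProduct.tmul_mul_tmul,
            deformMap_mul_bidegree h hb hb', deformMap_mul_bidegree h hc hc',
            TensorProduct.tmul_smul, ← TensorProduct.smul_tmul', smul_smul]
          rw [← AddChar.map_add_eq_mul]
          congr 2
          ring)
    | smul c _ h1 => rw [map_smul, map_smul, map_smul, map_smul, h1]
    | add _ _ h1 h2 => rw [map_add, map_add, map_add, map_add, h1, h2]
  | hadd a b ha hb => rw [map_add, map_add, map_add, map_add, ha, hb]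

theorem deformMap_antipode_bidegree {a : MpQUEA k qm' Mp Mm} {l r : QRoot n}
    (ha : HasBidegree k qm' Mp Mm a l r) :
    deformMap h (HopfAlgebra.antipode (Kq k) a)
      = qpow k (bil B r r - bil B l l) • HopfAlgebra.antipode (Kq k) (deformMap h a) := by
  induction ha with
  | one =>
    rw [HopfAlgebra.antipode_one, deformMap_one, HopfAlgebra.antipode_one, sub_self,
      AddChar.map_zero_eq_one, one_smul]
  | E i =>
    have h1 : ∀ qm : QRatMultiparameter C,
        HopfAlgebra.antipode (Kq k) ((mpDatum k qm Mp Mm).E i)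
          = -((mpDatum k qm Mp Mm).Kt (-(Mp.root i, 0)) * (mpDatum k qm Mp Mm).E i) := fun qm => by
      refine (QDatum.S_E _ i).trans ?_
      rw [QDatum.SE, show -(mpDatum k qm Mp Mm).u i = 0 from neg_zero, QDatum.Kt_zero, mul_one]
      rfl
    rw [deformMap_E, h1, h1, map_neg, deformMap_mul_bidegree h (.Kt _) (.E i), deformMap_E,
      deformMap_Kt, smul_neg]
    congr 3
    simp [bil_zero_right, TorusLattice.root, bil_neg_left]
  | F i =>
    have h1 : ∀ qm : QRatMultiparameter C,
        HopfAlgebra.antipode (Kq k) ((mpDatum k qm Mp Mm).F i)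
          = -((mpDatum k qm Mp Mm).F i * (mpDatum k qm Mp Mm).Kt (-(0, Mm.root i))) := fun qm => by
      refine (QDatum.S_F _ i).trans ?_
      rw [QDatum.SF, show -(mpDatum k qm Mp Mm).z i = 0 from neg_zero, QDatum.Kt_zero, one_mul]
      rfl
    rw [deformMap_F, h1, h1, map_neg, deformMap_mul_bidegree h (.F i) (.Kt _), deformMap_F,
      deformMap_Kt, smul_neg]
    congr 3
    simp [bil_zero_left, TorusLattice.root, bil_neg_right]
  | Kt g =>
    have h1 : ∀ qm : QRatMultiparameter C, HopfAlgebra.antipode (Kq k)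
        ((mpDatum k qm Mp Mm).Kt g) = (mpDatum k qm Mp Mm).Kt (-g) := fun qm => QDatum.S_Kt _ g
    rw [deformMap_Kt, h1, h1, deformMap_Kt, sub_self, AddChar.map_zero_eq_one, one_smul]
  | mul ha hb h1 h2 =>
    rw [HopfAlgebra.antipode_mul_antidistrib, deformMap_mul_bidegree h hb.antipode ha.antipode,
      deformMap_mul_bidegree h ha hb, map_smul, HopfAlgebra.antipode_mul_antidistrib, h1, h2]
    simp only [smul_mul_assoc, mul_smul_comm, smul_smul, ← AddChar.map_add_eq_mul, bil_add_left,
      bil_add_right, bil_neg_left, bil_neg_right]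
    congr 2
    ring
  | smul c _ h1 => simp only [map_smul, h1]; rw [smul_comm]
  | add _ _ h1 h2 => simp only [map_add, h1, h2, smul_add]

theorem deformMap_antipode (x : MpQUEA k qm' Mp Mm) :
    deformMap h (HopfAlgebra.antipode (Kq k) x)
      = deformedAntipode (toralForm k qm Mp Mm B) (toralForm k qm Mp Mm (-B)) (deformMap h x) := by
  induction x using HasBidegree.induction with
  | h a l r ha =>
    rw [deformMap_antipode_bidegree h ha, deformedAntipode_toralForm (ha.deformMap h)]
  | hadd a b ha hb => simp only [map_add, ha, hb]

theorem bil_undeform (h : ∀ x y, bil qm'.R x y = bil qm.R x y + bil B x y - bil B y x)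
    (x y : QRoot n) :
    bil qm.R x y = bil qm'.R x y + bil (-B) x y - bil (-B) y x := by
  rw [h, bil_neg, bil_neg]; ring

theorem deformMap_undeform (x : MpQUEA k qm' Mp Mm) :
    deformMap (bil_undeform h) (deformMap h x) = x :=
  deformMap_deformMap h rfl (bil_undeform h) x

theorem undeform_deformMap (x : MpQUEA k qm Mp Mm) :
    deformMap h (deformMap (bil_undeform h) x) = x :=
  deformMap_deformMap (bil_undeform h) (neg_neg B).symm h x

/-- The deformation as an isomorphism of coalgebras, in the direction from the deformed Hopf
algebra to the quantum group with the new multiparameter. -/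
noncomputable def deformEquiv : MpQUEA k qm Mp Mm ≃ₗc[Kq k] MpQUEA k qm' Mp Mm :=
  { deformMap (bil_undeform h) with
    invFun := deformMap h
    left_inv := undeform_deformMap h
    right_inv := deformMap_undeform h
    counit_comp := LinearMap.ext fun x => counit_deformMap (bil_undeform h) x
    map_comp_comul := LinearMap.ext fun x => comul_deformMap (bil_undeform h) x }

end Deformed

/-! ### The two isomorphisms -/

section Final
variable (k : Type*) [Field k] {n : ℕ} {C : CartanDatum n} {Ψ : Matrix (Fin n) (Fin n) ℚ}
  {qm : QRatMultiparameter C}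

theorem mpToTw_antipode (hΨ : Ψ.transpose = -Ψ) (hq : qm.Corresponds Ψ) (Mp Mm : TorusLattice n)
    (x : MpQUEA k qm Mp Mm) :
    mpToTw k hΨ hq Mp Mm (HopfAlgebra.antipode (Kq k) x)
      = HopfAlgebra.antipode (Kq k) (mpToTw k hΨ hq Mp Mm x) := by
  have hE : ∀ i, mpToTw k hΨ hq Mp Mm ((mpDatum k qm Mp Mm).E i) = qpow k (C.d i) • twE k C Ψ i :=
    fun i => QDatum.lift_E _ i
  have hF : ∀ i, mpToTw k hΨ hq Mp Mm ((mpDatum k qm Mp Mm).F i) = twF k C Ψ i :=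
    fun i => QDatum.lift_F _ i
  have hK : ∀ g, mpToTw k hΨ hq Mp Mm ((mpDatum k qm Mp Mm).Kt g)
      = (twDatum k C Ψ).Kt (C.torusHom Ψ Mp Mm g) := fun g => QDatum.lift_Kt _ g
  induction x using QDatum.induction with
  | hE i =>
    have h1 : HopfAlgebra.antipode (Kq k) ((mpDatum k qm Mp Mm).E i) = (mpDatum k qm Mp Mm).SE i :=
      QDatum.S_E _ i
    have h2 : C.torusHom Ψ Mp Mm (-(mpDatum k qm Mp Mm).v i) = -C.phiP Ψ (sroot i) := by
      rw [map_neg]; simp [mpDatum, C.torusHom_apply, TorusLattice.root]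
    have h3 : C.torusHom Ψ Mp Mm (-(mpDatum k qm Mp Mm).u i) = 0 := by
      rw [map_neg]; simp [mpDatum]
    rw [h1, QDatum.SE, map_neg, map_mul, map_mul, hE, hK, hK, h2, h3, QDatum.Kt_zero, mul_one,
      map_smul, antipode_twE, mul_smul_comm, smul_neg]
  | hF i =>
    have h1 : HopfAlgebra.antipode (Kq k) ((mpDatum k qm Mp Mm).F i) = (mpDatum k qm Mp Mm).SF i :=
      QDatum.S_F _ i
    have h2 : C.torusHom Ψ Mp Mm (-(mpDatum k qm Mp Mm).w i) = C.phiM Ψ (sroot i) := by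
      rw [map_neg]; simp [mpDatum, C.torusHom_apply, TorusLattice.root]
    have h3 : C.torusHom Ψ Mp Mm (-(mpDatum k qm Mp Mm).z i) = 0 := by
      rw [map_neg]; simp [mpDatum]
    rw [h1, QDatum.SF, map_neg, map_mul, map_mul, hF, hK, hK, h2, h3, QDatum.Kt_zero, one_mul,
      antipode_twF]
  | hK g =>
    have h1 : HopfAlgebra.antipode (Kq k) ((mpDatum k qm Mp Mm).Kt g)
      = (mpDatum k qm Mp Mm).Kt (-g) := QDatum.S_Kt _ g
    have h2 : ∀ y, HopfAlgebra.antipode (Kq k) ((twDatum k C Ψ).Kt y) = (twDatum k C Ψ).Kt (-y) :=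
      QDatum.S_Kt _
    rw [h1, hK, hK, h2, map_neg]
  | hs c =>
    rw [Algebra.algebraMap_eq_smul_one, map_smul, HopfAlgebra.antipode_one, map_smul, map_one,
      map_smul, HopfAlgebra.antipode_one]
  | hadd x y hx hy => rw [map_add, map_add, hx, hy, map_add, map_add]
  | hmul x y hx hy =>
    rw [HopfAlgebra.antipode_mul_antidistrib, map_mul, hx, hy, map_mul,
      HopfAlgebra.antipode_mul_antidistrib]

theorem mpBialgEquiv_antipode (hΨ : Ψ.transpose = -Ψ) (hq : qm.Corresponds Ψ)
    (Mp Mm : TorusLattice n) (x : MpQUEA k qm Mp Mm) :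
    mpBialgEquiv k hΨ hq Mp Mm (HopfAlgebra.antipode (Kq k) x)
      = HopfAlgebra.antipode (Kq k) (mpBialgEquiv k hΨ hq Mp Mm x) :=
  Subtype.ext (mpToTw_antipode k hΨ hq Mp Mm x)

theorem mpBialgEquiv_E (hΨ : Ψ.transpose = -Ψ) (hq : qm.Corresponds Ψ)
    (Mp Mm : TorusLattice n) (i : Fin n) :
    (mpBialgEquiv k hΨ hq Mp Mm ((mpDatum k qm Mp Mm).E i) : TwFull k C Ψ)
      = qpow k (C.d i) • twE k C Ψ i := QDatum.lift_E (isRep_tw k hΨ hq Mp Mm) i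

theorem mpBialgEquiv_F (hΨ : Ψ.transpose = -Ψ) (hq : qm.Corresponds Ψ)
    (Mp Mm : TorusLattice n) (i : Fin n) :
    (mpBialgEquiv k hΨ hq Mp Mm ((mpDatum k qm Mp Mm).F i) : TwFull k C Ψ)
      = twF k C Ψ i := QDatum.lift_F (isRep_tw k hΨ hq Mp Mm) i

theorem mpBialgEquiv_Kt (hΨ : Ψ.transpose = -Ψ) (hq : qm.Corresponds Ψ)
    (Mp Mm : TorusLattice n) (g : Mp.M × Mm.M) :
    (mpBialgEquiv k hΨ hq Mp Mm ((mpDatum k qm Mp Mm).Kt g) : TwFull k C Ψ)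
      = (twDatum k C Ψ).Kt (C.torusHom Ψ Mp Mm g) := QDatum.lift_Kt (isRep_tw k hΨ hq Mp Mm) g

/-- The multiparameter corresponding to `Ψ` differs from the canonical one by the
antisymmetrization of the cocycle matrix. -/
theorem bil_corresponds_canonical (hq : qm.Corresponds Ψ) (x y : QRoot n) :
    bil qm.R x y = bil (QRatMultiparameter.canonical C).R x y + bil (C.cocycleMatrix Ψ) x y
      - bil (C.cocycleMatrix Ψ) y x := by
  have h : (C.cocycleMatrix Ψ).transpose
      = -(C.DA + C.AQ.transpose * Ψ.transpose * C.AQ) := by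
    rw [CartanDatum.cocycleMatrix, Matrix.transpose_neg, Matrix.transpose_add, C.DA_transpose,
      Matrix.transpose_mul, Matrix.transpose_mul, Matrix.transpose_transpose, Matrix.mul_assoc]
  rw [← bil_transpose (C.cocycleMatrix Ψ) x y, h, CartanDatum.cocycleMatrix, hq, Matrix.mul_sub,
    Matrix.sub_mul]
  simp only [bil_add, bil_sub, bil_neg, QRatMultiparameter.canonical]
  ring

variable (C Ψ) in
theorem phiM_injective (hΨ : Ψ.transpose = -Ψ) : Function.Injective (C.phiM Ψ) := by
  rw [injective_iff_map_eq_zero]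
  intro x hx
  rw [C.phiM_apply, C.psiM_eq_neg hΨ] at hx
  have h1 : -C.psiP Ψ x = 0 := congrArg Prod.fst hx
  have h2 : x + -C.psiP Ψ x = 0 := congrArg Prod.snd hx
  rwa [h1, add_zero] at h2

variable (C Ψ) in
theorem phiP_injective (hΨ : Ψ.transpose = -Ψ) : Function.Injective (C.phiP Ψ) := by
  rw [injective_iff_map_eq_zero]
  intro x hx
  rw [C.phiP_apply, C.psiM_eq_neg hΨ, neg_neg] at hx
  have h1 : x + C.psiP Ψ x = 0 := congrArg Prod.fst hx
  have h2 : C.psiP Ψ x = 0 := congrArg Prod.snd hx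
  rwa [h2, add_zero] at h1

/-- The image of a basis of a submodule under an injective linear map. -/
theorem basis_image {R V W ι : Type*} [Ring R] [AddCommGroup V] [Module R V] [AddCommGroup W]
    [Module R W] {N : Submodule R V} (b : Module.Basis ι R N) (f : V →ₗ[R] W)
    (hf : Function.Injective f) :
    LinearIndependent R (fun i => f (b i)) ∧
      Submodule.span R (Set.range fun i => f (b i)) = N.map f := by
  have e : (fun i => f (b i)) = (f ∘ₗ N.subtype) ∘ b := rfl
  refine ⟨?_, ?_⟩
  · rw [e]
    exact b.linearIndependent.map' _ (LinearMap.ker_eq_bot.2 (hf.comp Subtype.val_injective))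
  · rw [e, Set.range_comp, Submodule.span_image, b.span_eq, Submodule.map_comp,
      Submodule.map_subtype_top]

end Final

theorem mainTheorem1 (k : Type*) [Field k] [CharZero k] {n : ℕ} (C : CartanDatum n)
    (Ψ : Matrix (Fin n) (Fin n) ℚ) (hΨ : Ψ.transpose = -Ψ)
    (qm : QRatMultiparameter C) (hq : qm.Corresponds Ψ)
    (Mp Mm : TorusLattice n)
    (μp : Module.Basis (Fin n) ℤ Mp.M) (μm : Module.Basis (Fin n) ℤ Mm.M) :
    -- `ϖ⁺` and `ϖ⁻` are `ℤ`-bases of `M_+^Ψ` and `M_-^Ψ`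
    (LinearIndependent ℤ (fun i => C.phiP Ψ (μp i)) ∧
      Submodule.span ℤ (Set.range fun i => C.phiP Ψ (μp i)) = Mp.M.map (C.phiP Ψ)) ∧
    (LinearIndependent ℤ (fun i => C.phiM Ψ (μm i)) ∧
      Submodule.span ℤ (Set.range fun i => C.phiM Ψ (μm i)) = Mm.M.map (C.phiM Ψ)) ∧
    (∃ Φ : MpQUEA k qm Mp Mm ≃ₐc[Kq k] TwQUEA k C Ψ (C.starLattice Ψ Mp Mm),
      ∀ i : Fin n,
        (Φ ((mpDatum k qm Mp Mm).E i) : TwFull k C Ψ) = qpow k (C.d i) • twE k C Ψ i ∧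
        (Φ ((mpDatum k qm Mp Mm).F i) : TwFull k C Ψ) = twF k C Ψ i ∧
        (Φ ((mpDatum k qm Mp Mm).Kt (μp i, 0)) : TwFull k C Ψ)
          = (twDatum k C Ψ).Kt (C.phiP Ψ (μp i)) ∧
        (Φ ((mpDatum k qm Mp Mm).Kt (0, μm i)) : TwFull k C Ψ)
          = (twDatum k C Ψ).Kt (-C.phiM Ψ (μm i))) ∧
    IsTwoCocycle
      (toralForm k (QRatMultiparameter.canonical C) Mp Mm (C.cocycleMatrix Ψ))
      (toralForm k (QRatMultiparameter.canonical C) Mp Mm (-C.cocycleMatrix Ψ)) ∧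
    (∃ Θ : MpQUEA k (QRatMultiparameter.canonical C) Mp Mm ≃ₗc[Kq k]
        TwQUEA k C Ψ (C.starLattice Ψ Mp Mm),
      Θ 1 = 1 ∧
      (∀ a b, Θ (deformedMul
          (toralForm k (QRatMultiparameter.canonical C) Mp Mm (C.cocycleMatrix Ψ))
          (toralForm k (QRatMultiparameter.canonical C) Mp Mm (-C.cocycleMatrix Ψ))
          (a ⊗ₜ[Kq k] b)) = Θ a * Θ b) ∧
      (∀ a, Θ (deformedAntipode
          (toralForm k (QRatMultiparameter.canonical C) Mp Mm (C.cocycleMatrix Ψ))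
          (toralForm k (QRatMultiparameter.canonical C) Mp Mm (-C.cocycleMatrix Ψ)) a)
        = HopfAlgebra.antipode (Kq k) (Θ a)) ∧
      ∀ i : Fin n,
        (Θ ((mpDatum k (QRatMultiparameter.canonical C) Mp Mm).E i) : TwFull k C Ψ)
          = qpow k (C.d i) • twE k C Ψ i ∧
        (Θ ((mpDatum k (QRatMultiparameter.canonical C) Mp Mm).F i) : TwFull k C Ψ)
          = twF k C Ψ i ∧
        (Θ ((mpDatum k (QRatMultiparameter.canonical C) Mp Mm).Kt (μp i, 0)) : TwFull k C Ψ)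
          = (twDatum k C Ψ).Kt (C.phiP Ψ (μp i)) ∧
        (Θ ((mpDatum k (QRatMultiparameter.canonical C) Mp Mm).Kt (0, μm i)) : TwFull k C Ψ)
          = (twDatum k C Ψ).Kt (-C.phiM Ψ (μm i))) := by
  have hB := bil_corresponds_canonical hq
  have hp : ∀ x : Mp.M, C.torusHom Ψ Mp Mm (x, 0) = C.phiP Ψ x := fun x => by
    simp [C.torusHom_apply]
  have hm : ∀ x : Mm.M, C.torusHom Ψ Mp Mm (0, x) = -C.phiM Ψ x := fun x => by
    simp [C.torusHom_apply]
  refine ⟨basis_image μp (C.phiP Ψ) (phiP_injective C Ψ hΨ),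
    basis_image μm (C.phiM Ψ) (phiM_injective C Ψ hΨ),
    ⟨mpBialgEquiv k hΨ hq Mp Mm, fun i => ⟨mpBialgEquiv_E k hΨ hq Mp Mm i,
      mpBialgEquiv_F k hΨ hq Mp Mm i, ?_, ?_⟩⟩,
    isTwoCocycle_toralForm k _ Mp Mm _,
    ⟨(deformEquiv hB).trans (mpBialgEquiv k hΨ hq Mp Mm).toCoalgEquiv, ?_, fun a b => ?_,
      fun a => ?_, fun i => ⟨?_, ?_, ?_, ?_⟩⟩⟩
  · rw [mpBialgEquiv_Kt, hp]
  · rw [mpBialgEquiv_Kt, hm]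
  · change mpBialgEquiv k hΨ hq Mp Mm (deformMap (bil_undeform hB) 1) = 1
    rw [deformMap_one, map_one]
  · change mpBialgEquiv k hΨ hq Mp Mm (deformMap (bil_undeform hB) _)
      = mpBialgEquiv k hΨ hq Mp Mm (deformMap (bil_undeform hB) a)
        * mpBialgEquiv k hΨ hq Mp Mm (deformMap (bil_undeform hB) b)
    rw [← map_mul]
    congr 1
    -- both sides correspond to the product for the multiparameter attached to `Ψ`
    have h1 := deformMap_mul hB (deformMap (bil_undeform hB) a) (deformMap (bil_undeform hB) b)
    rw [undeform_deformMap, undeform_deformMap] at h1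
    rw [← h1, deformMap_undeform]
  · change mpBialgEquiv k hΨ hq Mp Mm (deformMap (bil_undeform hB) _) = HopfAlgebra.antipode (Kq k)
      (mpBialgEquiv k hΨ hq Mp Mm (deformMap (bil_undeform hB) a))
    rw [← mpBialgEquiv_antipode]
    congr 1
    have h1 := deformMap_antipode hB (deformMap (bil_undeform hB) a)
    rw [undeform_deformMap] at h1
    rw [← h1, deformMap_undeform]
  · change (mpBialgEquiv k hΨ hq Mp Mm (deformMap (bil_undeform hB) _) : TwFull k C Ψ) = _
    rw [deformMap_E, mpBialgEquiv_E]
  · change (mpBialgEquiv k hΨ hq Mp Mm (deformMap (bil_undeform hB) _) : TwFull k C Ψ) = _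
    rw [deformMap_F, mpBialgEquiv_F]
  · change (mpBialgEquiv k hΨ hq Mp Mm (deformMap (bil_undeform hB) _) : TwFull k C Ψ) = _
    rw [deformMap_Kt, mpBialgEquiv_Kt, hp]
  · change (mpBialgEquiv k hΨ hq Mp Mm (deformMap (bil_undeform hB) _) : TwFull k C Ψ) = _
    rw [deformMap_Kt, mpBialgEquiv_Kt, hm]
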